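/- Let $\mathbb F_q$ be the finite field with $q=p^h$ elements ($p$ prime), let $r\ge 2$ be an integer, and let $k>1+1/r$ be real. For $f\in\mathbb F_q[t]$ put $|f|=q^{\deg f}$ (and $|0|=0$), let $\mathcal M$ be the set of monic polynomials, and let $a_r(f)=1$ if $f$ is $r$-free (not divisible by $\pi^r$ for any irreducible $\pi$) and $a_r(f)=0$ otherwise. For $c\in\mathbb F_q$ put $e_q(c)=\exp(2\pi i\,\mathrm{tr}(c)/p)$, where $\mathrm{tr}:\mathbb F_q\to\mathbb F_p$ is the trace, and for $\alpha=\sum_{i\le M}\alpha_it^i\in\mathbb F_q((1/t))$ put $e(\alpha)=e_q(\alpha_{-1})$. Let $\mathbb T=\{\alpha\in\mathbb F_q((1/t)):|\alpha|<1\}$, let $d\alpha$ be the Haar measure on $\mathbb F_q((1/t))$ with $\int_{\mathbb T}1\,d\alpha=1$, and let $G(\alpha)=\sum_{f\in\mathcal M,\,|f|\le q^N}a_r(f)e(f\alpha)$ for an integer $N\ge 0$. Set \[\zeta_q(r)=\sum_{f\in\mathcal M}|f|^{-r},\qquad \Phi_r(f)=|f|^r\prod_{\pi\mid f}\bigl(1-|\pi|^{-r}\bigr),\qquad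 \mathfrak S_r(k)=\sum_{f\in\mathcal M}\mu(f)^2\,\Phi_r(f)^{1-k},\] where the product is over the monic irreducible divisors $\pi$ of $f$ and $\mu$ is the Möbius function of $\mathbb F_q[t]$ (so $\mu(f)^2=1$ if $f$ is squarefree and $0$ otherwise), and \[B(k)=\frac{q^{k-1}}{q^{k-1}-1}\biggl(\frac1q\sum_{a\in\mathbb F_q}\Bigl|e_q(a)+\frac1{q-1}\Bigr|^k-\frac1{(q-1)^k}\biggr),\qquad C=\zeta_q(r)^{-k}\,\mathfrak S_r(k)\,B(k).\] Put \[\theta_0=\begin{cases}1-\frac1r & \text{if } k>3+\frac1r,\\[2pt] \frac12\bigl(1-\frac1r\bigr)\bigl(k-1-\frac1r\bigr) & \text{if } 2+\frac1r<k\le 3+\frac1r,\\[2pt] \dfrac{(1-1/r)^2(k-1-1/r)}{(1-1/r)(k-1-1/r)+(3-k)} & \text{if } k\le 2+\frac1r,\end{cases}\] and, for $\varepsilon>0$, let $\theta=\theta_0$ if $k>3+1/r$ and $\theta=\theta_0-\varepsilon$ otherwise. Then the series defining $\zeta_q(r)$ and $\mathfrak S_r(k)$ converge absolutely, $\theta_0>0$,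 and for every $\varepsilon>0$ \[\int_{\mathbb T}|G(\alpha)|^k\,d\alpha=C\,q^{N(k-1)}+O\bigl(q^{N(k-1-\theta)}\bigr)\] for all integers $N\ge0$, where the implied constant depends only on $k$, $r$, $q$ and $\varepsilon$. -/

import Mathlib

open scoped Polynomial

namespace RFreeMoments

open MeasureTheory

noncomputable section

/-! ### Polynomials over a finite field -/

/-- The absolute value `|f| = q ^ deg f` of a polynomial over a finite field with `q` elements,
with `|0| = 0`. -/
def polyAbs {F : Type*} [Field F] [Fintype F] (f : F[X]) : ℝ :=
  open Classical in if f = 0 then 0 else (Fintype.card F : ℝ) ^ f.natDegree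

/-- A polynomial is `r`-free if no `r`-th power of an irreducible polynomial divides it. -/
def IsRFree {F : Type*} [Field F] (r : ℕ) (f : F[X]) : Prop :=
  ∀ p : F[X], Irreducible p → ¬ p ^ r ∣ f

/-- The indicator function of the `r`-free polynomials. -/
def rFreeInd {F : Type*} [Field F] (r : ℕ) (f : F[X]) : ℂ :=
  open Classical in if IsRFree r f then 1 else 0

theorem finite_monic_polyAbs_le (F : Type*) [Field F] [Fintype F] (N : ℕ) :
    {f : F[X] | f.Monic ∧ polyAbs f ≤ (Fintype.card F : ℝ) ^ N}.Finite := by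
  have h : Finite (Polynomial.degreeLT F (N + 1)) := Module.finite_of_finite F
  refine (Set.toFinite (Polynomial.degreeLT F (N + 1) : Set F[X])).subset ?_
  rintro f ⟨hf, hN⟩
  rw [polyAbs, if_neg hf.ne_zero,
    pow_le_pow_iff_right₀ (by exact_mod_cast Fintype.one_lt_card)] at hN
  rw [SetLike.mem_coe, Polynomial.mem_degreeLT]
  exact (Polynomial.natDegree_lt_iff_degree_lt hf.ne_zero).1 (Nat.lt_succ_of_le hN)

/-- The finite set of monic polynomials `f` with `|f| ≤ q ^ N`. -/
def monicUpTo (F : Type*) [Field F] [Fintype F] (N : ℕ) : Finset F[X] :=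
  (finite_monic_polyAbs_le F N).toFinset

/-- The zeta function of `F[t]`: the sum of `|f| ^ (-s)` over monic `f`. -/
def zeta (F : Type*) [Field F] [Fintype F] (s : ℝ) : ℝ :=
  ∑' f : {f : F[X] // f.Monic}, polyAbs f.1 ^ (-s)

/-- `Φ_r(f) = |f| ^ r * ∏ (1 - |π| ^ (-r))`, the product over the monic irreducible `π ∣ f`. -/
def Phi {F : Type*} [Field F] [Fintype F] (r : ℕ) (f : F[X]) : ℝ :=
  open Classical in
  polyAbs f ^ r *
    ∏ p ∈ (UniqueFactorizationMonoid.normalizedFactors f).toFinset, (1 - 1 / polyAbs p ^ r)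

/-- The general term `μ(f)² Φ_r(f) ^ (1 - k)` of the singular series. -/
def singularTerm {F : Type*} [Field F] [Fintype F] (r : ℕ) (k : ℝ) (f : F[X]) : ℝ :=
  open Classical in if Squarefree f then Phi r f ^ (1 - k) else 0

/-- The singular series, a sum over all monic polynomials. -/
def singularSeries (F : Type*) [Field F] [Fintype F] (r : ℕ) (k : ℝ) : ℝ :=
  ∑' f : {f : F[X] // f.Monic}, singularTerm r k f.1

/-! ### The additive character and the torus -/

/-- The absolute trace from a finite field to its prime field. -/
def absTrace {F : Type*} [Field F] (c : F) : ZMod (ringChar F) :=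
  letI : Algebra (ZMod (ringChar F)) F := ZMod.algebra F (ringChar F)
  Algebra.trace (ZMod (ringChar F)) F c

/-- The additive character `c ↦ exp (2 π i tr(c) / p)` of a finite field of characteristic `p`. -/
def charFq {F : Type*} [Field F] (c : F) : ℂ :=
  Complex.exp (2 * Real.pi * Complex.I * ((absTrace c).val : ℂ) / (ringChar F : ℂ))

/-- The field `F((1/t))`, realized as the Laurent series in the variable `1/t`: the coefficient of
`t ^ n` is the Laurent series coefficient of index `-n`. It carries the `1/t`-adic topology. -/
abbrev KInf (F : Type*) [Field F] : Type _ := LaurentSeries F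

/-- The embedding of `F[t]` into `F((1/t))`, which sends `t` to the inverse of the variable. -/
def ofPoly {F : Type*} [Field F] (f : F[X]) : KInf F :=
  Polynomial.aeval (HahnSeries.single (-1 : ℤ) (1 : F) : KInf F) f

/-- The additive character `α ↦ e_q(α₋₁)` of `F((1/t))`, where `α₋₁` is the coefficient of
`t ^ (-1)`. -/
def e {F : Type*} [Field F] (α : KInf F) : ℂ :=
  charFq (α.coeff 1)

/-- The torus, that is the set of all `α` with `|α| < 1`. -/
def torus (F : Type*) [Field F] : Set (KInf F) :=
  {α | Valued.v α < 1}

instance instMeasurableSpaceKInf (F : Type*) [Field F] : MeasurableSpace (KInf F) := borel _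

instance instBorelSpaceKInf (F : Type*) [Field F] : BorelSpace (KInf F) := ⟨rfl⟩

theorem isOpen_torus (F : Type*) [Field F] : IsOpen (torus F) := by
  simpa only [torus, Valuation.restrict_lt_one_iff] using Valued.isOpen_ball (KInf F) 1

theorem isCompact_torus (F : Type*) [Field F] [Finite F] : IsCompact (torus F) := by
  let _ : TopologicalSpace F := ⊥
  have _ : DiscreteTopology F := ⟨rfl⟩
  let φ : (ℕ → F) → KInf F := fun a => HahnSeries.ofPowerSeries ℤ F (PowerSeries.mk a)
  have hφ : Continuous φ := by
    rw [continuous_iff_continuousAt]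
    intro a s hs
    rw [Valued.mem_nhds] at hs
    obtain ⟨γ, hγ⟩ := hs
    set δ := MonoidWithZeroHom.ValueGroup₀.embedding γ.1 with hδ
    have hδ0 : δ ≠ 0 := (map_ne_zero _).2 γ.ne_zero
    have hev : ∀ᶠ b in nhds a, ∀ i ∈ Finset.range (1 - WithZero.log δ).toNat, b i = a i := by
      rw [Filter.eventually_all_finset]
      intro i _
      exact (continuous_apply i).continuousAt.eventually_mem
        (show {a i} ∈ nhds (a i) from (isOpen_discrete _).mem_nhds rfl)
    refine Filter.mem_map.2 (Filter.mem_of_superset hev fun b hb => hγ ?_)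
    change Valued.v.restrict (φ b - φ a) < γ.1
    rw [Valuation.restrict_lt_iff_lt_embedding, ← hδ, ← WithZero.exp_log hδ0]
    refine lt_of_le_of_lt ((LaurentSeries.valuation_le_iff_coeff_lt_eq_zero F
      (D := 1 - WithZero.log δ)).2 ?_) (WithZero.exp_lt_exp.2 (by lia))
    intro n hn
    simp only [φ, ← map_sub]
    rcases lt_or_ge n 0 with h0 | h0
    · rw [HahnSeries.ofPowerSeries_apply]
      refine HahnSeries.embDomain_of_notMem_range ?_
      rintro ⟨m, hm⟩
      simp at hm
      lia
    · lift n to ℕ using h0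
      rw [HahnSeries.ofPowerSeries_apply_coeff, map_sub, PowerSeries.coeff_mk,
        PowerSeries.coeff_mk, hb n (Finset.mem_range.2 (by lia)), sub_self]
  have hc : IsClosed (torus F) := by
    simpa only [torus, Valuation.restrict_lt_one_iff] using Valued.isClosed_ball (KInf F) 1
  refine (isCompact_range hφ).of_isClosed_subset hc ?_
  intro α hα
  obtain ⟨f, rfl⟩ := (LaurentSeries.val_le_one_iff_eq_coe F α).1 (le_of_lt hα)
  exact ⟨fun n => PowerSeries.coeff n f, by simp only [φ]; congr 1; ext n; simp⟩

/-- The Haar measure on `F((1/t))`, normalized so that the torus has measure `1`. -/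
def haar (F : Type*) [Field F] [Finite F] : Measure (KInf F) :=
  Measure.addHaarMeasure
    { carrier := torus F
      isCompact' := isCompact_torus F
      interior_nonempty' := by
        rw [(isOpen_torus F).interior_eq]
        exact ⟨0, by simp [torus]⟩ }

theorem haar_torus (F : Type*) [Field F] [Finite F] : haar F (torus F) = 1 :=
  Measure.addHaarMeasure_self

/-! ### The exponential sum, its moments, and the constants of the asymptotic formula -/

/-- The exponential sum `G(α) = ∑ a_r(f) e(f α)` over the monic `f` with `|f| ≤ q ^ N`. -/
def G {F : Type*} [Field F] [Fintype F] (r N : ℕ) (α : KInf F) : ℂ :=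
  ∑ f ∈ monicUpTo F N, rFreeInd r f * e (ofPoly f * α)

/-- The moment `∫ |G(α)| ^ k dα` over the torus. -/
def moment (F : Type*) [Field F] [Fintype F] (r : ℕ) (k : ℝ) (N : ℕ) : ℝ :=
  ∫ α in torus F, ‖G r N α‖ ^ k ∂(haar F)

/-- The constant `B(k)` of the singular integral. -/
def B (F : Type*) [Field F] [Fintype F] (k : ℝ) : ℝ :=
  let q : ℝ := Fintype.card F
  q ^ (k - 1) / (q ^ (k - 1) - 1) *
    (1 / q * (∑ a : F, ‖charFq a + 1 / ((q : ℂ) - 1)‖ ^ k) - 1 / (q - 1) ^ k)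

/-- The leading constant `C = ζ_q(r) ^ (-k) 𝔖_r(k) B(k)`. -/
def leadingConstant (F : Type*) [Field F] [Fintype F] (r : ℕ) (k : ℝ) : ℝ :=
  (1 / zeta F r) ^ k * singularSeries F r k * B F k

/-- The exponent `θ` of the power saving, in terms of `r`, `k` and `ε`. -/
def theta (r : ℕ) (k ε : ℝ) : ℝ :=
  if 3 + 1 / (r : ℝ) < k then
    1 - 1 / (r : ℝ)
  else if 2 + 1 / (r : ℝ) < k then
    1 / 2 * (1 - 1 / (r : ℝ)) * (k - 1 - 1 / (r : ℝ)) - ε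
  else
    (1 - 1 / (r : ℝ)) ^ 2 * (k - 1 - 1 / (r : ℝ)) /
      ((1 - 1 / (r : ℝ)) * (k - 1 - 1 / (r : ℝ)) + (3 - k)) - ε

end

end RFreeMoments

/-!
# Moments of the exponential sum over `r`-free polynomials

Write `q` for the number of elements of `F`, `u = k - 1 - 1 / r` and `c = 1 - 1 / r`.

**Exact expansion.** Since `a_r(n)` is the sum of `μ(g)` over `g ^ r ∣ n`, the sum `G(α)` is a sum
of geometric sums over the multiples of `g ^ r`. Over `F[t]` these are explicit: up to a bounded
term, the geometric sum for `g` is `|g| ^ (-r) T(α - b / g ^ r)`, where `b / g ^ r` is the fraction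
nearest to `α` and the modulus of `T(γ)` is comparable to `min (q ^ N) (1 / |γ|)` (`G_eq`,
`compSum_eq`).

**Approximation.** Those `g` whose nearest fraction is the same fraction, in lowest terms
`a / f ^ r` with `f` squarefree and `a` primitive, are multiples of `f`. Their coefficients add up
to `∑ μ(g) |g| ^ (-r)` over `f ∣ g`, which is `μ(f) / (ζ_q(r) Φ_r(f))` (`coefC_mul_Phi`). This
suggests approximating `G` by `approx`, which equals `μ(f) / (ζ_q(r) Φ_r(f)) T(α - a / f ^ r)` on
the disjoint major arcs `|α - a / f ^ r| < q ^ (x - N) |f| ^ (-r)` with `|f| ^ r ≤ q ^ x`, and `0`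
elsewhere. Different fractions over `s` and `t` have distance at least `1 / |s t|`. As long as
`2 x ≤ c N`, it follows that `|G - approx| ≤ 14 q ^ (N - x)` everywhere (`norm_G_sub_approx_le`).

**Moments of the approximation.** As `Φ_r(f)` is the number of primitive residues modulo `f ^ r`
(`card_primNum`), the `k`-th moment of `approx` is a truncation of the singular series times the
explicit moment of `T` (`ballMoment_eq`). This gives the leading term with an error of relative size
`q ^ (-x u)` (`exists_abs_integral_approx_sub_le`).

**The error.** Parseval and a first moment bound for the `g` of a fixed degree, interpolated, give
`∫ |G| ^ (1 + 1 / r) ≪ (N + 1) ^ 3 q ^ (N / r)` (`integral_rpow_G_le`), and `approx` satisfies the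
same bound. With the uniform bound for `G - approx`, the `k`-th moment of `G - approx` has relative
size `(N + 1) ^ 3 q ^ (-x u)` (`exists_integral_error_le`). By the mean value theorem it remains to
bound the integral of `|approx| ^ (k - 1) |G - approx|`. On a major arc the error comes from the
fractions other than `a / f ^ r`, and the repulsion of fractions shows that these are rarely close
to `α` (`integral_separated_le`). The resulting relative error is at most `(N + 1) ^ 3 q ^ (-x u)`
for `k ≤ 3 + 1 / r`, and at most a constant times `q ^ (-c N)` for `k > 3 + 1 / r`.

With `x` as large as allowed, about `c N / 2`, the saving is `q ^ (-c u N / 2)` up to the factor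
`(N + 1) ^ 3`. For `k ≤ 3 + 1 / r` the exponent `c u / 2` is at least `θ_0`, and `ε` absorbs the
polynomial factor. For `k > 3 + 1 / r` it exceeds `c`, so that the mixed term decides.
-/

namespace RFreeMoments

open MeasureTheory

noncomputable section

open Polynomial

/-! ### Counting monic polynomials -/

section Counting

variable {F : Type*} [Field F] [Fintype F]

theorem two_le_card : (2 : ℝ) ≤ Fintype.card F := by
  exact_mod_cast Fintype.one_lt_card (α := F)

theorem mem_monicUpTo {N : ℕ} {f : F[X]} :
    f ∈ monicUpTo F N ↔ f.Monic ∧ f.natDegree ≤ N := by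
  rw [monicUpTo, Set.Finite.mem_toFinset, Set.mem_ofPred_eq]
  refine and_congr_right fun hf => ?_
  rw [polyAbs, if_neg hf.ne_zero,
    pow_le_pow_iff_right₀ (by exact_mod_cast Fintype.one_lt_card)]

/-- The finite set of polynomials of degree less than `n`. -/
def polysLT (F : Type*) [Field F] [Fintype F] (n : ℕ) : Finset F[X] :=
  (show Set.Finite (degreeLT F n : Set F[X]) from
    @Set.toFinite _ _ (Finite.of_equiv _ (degreeLTEquiv F n).toEquiv.symm)).toFinset

theorem mem_polysLT {n : ℕ} {f : F[X]} : f ∈ polysLT F n ↔ f.degree < n := by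
  simp [polysLT, mem_degreeLT]

theorem card_polysLT (n : ℕ) : (polysLT F n).card = Fintype.card F ^ n := by
  have h := Nat.card_congr (degreeLTEquiv F n).toEquiv
  rw [Nat.card_fun, Nat.card_eq_fintype_card (α := F), Nat.card_fin] at h
  rw [← h, polysLT, ← Set.ncard_eq_toFinset_card (hs := _), ← Nat.card_coe_set_eq]
  rfl

/-- The finite set of monic polynomials of degree exactly `j`. -/
def monicDeg (F : Type*) [Field F] [Fintype F] (j : ℕ) : Finset F[X] :=
  open Classical in (monicUpTo F j).filter fun f => f.natDegree = j

theorem mem_monicDeg {j : ℕ} {f : F[X]} :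
    f ∈ monicDeg F j ↔ f.Monic ∧ f.natDegree = j := by
  rw [monicDeg, Finset.mem_filter, mem_monicUpTo]
  constructor
  · rintro ⟨⟨h, -⟩, h'⟩
    exact ⟨h, h'⟩
  · rintro ⟨h, h'⟩
    exact ⟨⟨h, h'.le⟩, h'⟩

theorem monicDeg_eq_image (j : ℕ) :
    monicDeg F j = open Classical in (polysLT F j).image fun h => X ^ j + h := by
  classical
  ext f
  rw [mem_monicDeg, Finset.mem_image]
  constructor
  · rintro ⟨hf, rfl⟩
    refine ⟨f - X ^ f.natDegree, mem_polysLT.2 ?_, by ring⟩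
    have := degree_sub_lt_left (p := f) (q := X ^ f.natDegree) (by
      rw [degree_X_pow, degree_eq_natDegree hf.ne_zero]) hf.ne_zero (by
      rw [hf.leadingCoeff, leadingCoeff_X_pow])
    rwa [degree_eq_natDegree hf.ne_zero] at this
  · rintro ⟨h, hh, rfl⟩
    have hh' := mem_polysLT.1 hh
    refine ⟨monic_X_pow_add hh', ?_⟩
    rw [natDegree_add_eq_left_of_degree_lt (by rwa [degree_X_pow]), natDegree_X_pow]

theorem card_monicDeg (j : ℕ) : (monicDeg F j).card = Fintype.card F ^ j := by
  classical
  rw [monicDeg_eq_image, Finset.card_image_of_injective _ fun _ _ h => by simpa using h,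
    card_polysLT]

theorem sum_monicUpTo {M : Type*} [AddCommMonoid M] (N : ℕ) (h : F[X] → M) :
    ∑ f ∈ monicUpTo F N, h f = ∑ j ∈ Finset.range (N + 1), ∑ f ∈ monicDeg F j, h f := by
  classical
  rw [← Finset.sum_fiberwise_of_maps_to (s := monicUpTo F N) (t := Finset.range (N + 1))
    (g := natDegree) fun f hf => Finset.mem_range.2 (Nat.lt_succ_of_le (mem_monicUpTo.1 hf).2)]
  refine Finset.sum_congr rfl fun j hj => Finset.sum_congr ?_ fun _ _ => rfl
  ext f
  rw [Finset.mem_filter, mem_monicDeg, mem_monicUpTo]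
  have := Finset.mem_range.1 hj
  constructor
  · rintro ⟨⟨h, -⟩, h'⟩
    exact ⟨h, h'⟩
  · rintro ⟨h, h'⟩
    exact ⟨⟨h, by omega⟩, h'⟩

/-- A sum over monic polynomials of a nonnegative function of the degree is at most the sum over
the degrees, with the number `q ^ j` of monic polynomials of degree `j` as weight. -/
theorem sum_natDegree_le {φ : ℕ → ℝ} (hφ : ∀ j, 0 ≤ φ j) {s : Finset F[X]} {t : Finset ℕ}
    (hs : ∀ f ∈ s, f.Monic ∧ f.natDegree ∈ t) :
    ∑ f ∈ s, φ f.natDegree ≤ ∑ j ∈ t, (Fintype.card F : ℝ) ^ j * φ j := by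
  classical
  rw [← Finset.sum_fiberwise_of_maps_to (s := s) (t := t) (g := natDegree) fun f hf => (hs f hf).2]
  refine Finset.sum_le_sum fun j _ => ?_
  calc ∑ f ∈ s with f.natDegree = j, φ f.natDegree = ∑ f ∈ s with f.natDegree = j, φ j :=
        Finset.sum_congr rfl fun f hf => by rw [(Finset.mem_filter.1 hf).2]
    _ ≤ ∑ f ∈ monicDeg F j, φ j := by
        refine Finset.sum_le_sum_of_subset_of_nonneg (fun f hf => ?_) fun _ _ _ => hφ j
        rw [Finset.mem_filter] at hf
        exact mem_monicDeg.2 ⟨(hs f hf.1).1, hf.2⟩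
    _ = _ := by rw [Finset.sum_const, card_monicDeg, nsmul_eq_mul]; push_cast; rfl

theorem sum_monicUpTo_natDegree (φ : ℕ → ℝ) (N : ℕ) :
    ∑ f ∈ monicUpTo F N, φ f.natDegree =
      ∑ j ∈ Finset.range (N + 1), (Fintype.card F : ℝ) ^ j * φ j := by
  rw [sum_monicUpTo]
  refine Finset.sum_congr rfl fun j _ => ?_
  rw [Finset.sum_congr rfl fun f hf => by rw [(mem_monicDeg.1 hf).2], Finset.sum_const,
    card_monicDeg, nsmul_eq_mul]
  push_cast
  rfl

theorem sum_pow_le_two_mul {a : ℝ} (ha : 2 ≤ a) (n : ℕ) :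
    ∑ j ∈ Finset.range (n + 1), a ^ j ≤ 2 * a ^ n := by
  induction n with
  | zero => simp
  | succ n ih =>
    rw [Finset.sum_range_succ]
    have : 0 < a ^ n := by positivity
    rw [pow_succ]
    nlinarith

theorem sum_inv_pow_le {a : ℝ} (ha : 1 < a) (m : ℕ) (t : Finset ℕ) (ht : ∀ j ∈ t, m ≤ j) :
    ∑ j ∈ t, (a ^ j)⁻¹ ≤ (1 - a⁻¹)⁻¹ * (a ^ m)⁻¹ := by
  have h0 : (0 : ℝ) < a := by linarith
  have hs : HasSum (fun j : ℕ => (a ^ m)⁻¹ * a⁻¹ ^ j) ((a ^ m)⁻¹ * (1 - a⁻¹)⁻¹) :=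
    (hasSum_geometric_of_lt_one (by positivity) (inv_lt_one_of_one_lt₀ ha)).mul_left _
  calc ∑ j ∈ t, (a ^ j)⁻¹ = ∑ j ∈ t.image (fun j => j - m), (a ^ m)⁻¹ * a⁻¹ ^ j := by
        rw [Finset.sum_image]
        · refine Finset.sum_congr rfl fun j hj => ?_
          rw [inv_pow, ← mul_inv, ← pow_add, Nat.add_sub_cancel' (ht j hj)]
        · intro i hi j hj h
          have := ht i hi
          have := ht j hj
          simp only at h
          omega
    _ ≤ _ := hs.summable.sum_le_tsum _ fun _ _ => by positivity
    _ = _ := by rw [hs.tsum_eq, mul_comm]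

theorem sum_inv_pow_le_two_mul {a : ℝ} (ha : 2 ≤ a) (m : ℕ) (t : Finset ℕ) (ht : ∀ j ∈ t, m ≤ j) :
    ∑ j ∈ t, (a ^ j)⁻¹ ≤ 2 * (a ^ m)⁻¹ := by
  have hle : (1 - a⁻¹)⁻¹ ≤ 2 := by
    have h1 : a⁻¹ ≤ 2⁻¹ := inv_anti₀ (by norm_num) ha
    rw [inv_le_comm₀ (by linarith) (by norm_num)]
    linarith
  exact (sum_inv_pow_le (by linarith) m t ht).trans (mul_le_mul_of_nonneg_right hle (by positivity))

/-- The number of monic polynomials of degree at most `N`. -/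
theorem card_monicUpTo_le (N : ℕ) :
    ((monicUpTo F N).card : ℝ) ≤ 2 * (Fintype.card F : ℝ) ^ N := by
  have h := sum_monicUpTo_natDegree (F := F) (fun _ => 1) N
  rw [Finset.sum_const, nsmul_eq_mul, mul_one] at h
  rw [h]
  simpa using sum_pow_le_two_mul (two_le_card (F := F)) N

/-- The weight `|f| ^ (-r)` of a nonzero polynomial. -/
def wt (r : ℕ) (f : F[X]) : ℝ := ((Fintype.card F : ℝ) ^ (r * f.natDegree))⁻¹

theorem wt_pos (r : ℕ) (f : F[X]) : 0 < wt r f := by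
  have := two_le_card (F := F)
  unfold wt
  positivity

theorem wt_mul (r : ℕ) {f g : F[X]} (hf : f ≠ 0) (hg : g ≠ 0) :
    wt r (f * g) = wt r f * wt r g := by
  unfold wt
  rw [natDegree_mul hf hg, mul_add, pow_add, mul_inv]

theorem sum_wt_le {r : ℕ} (hr : 2 ≤ r) {Q : ℕ} {s : Finset F[X]}
    (hs : ∀ f ∈ s, f.Monic ∧ Q ≤ f.natDegree) :
    ∑ f ∈ s, wt r f ≤ 2 * ((Fintype.card F : ℝ) ^ ((r - 1) * Q))⁻¹ := by
  have hq := two_le_card (F := F)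
  have h := sum_natDegree_le (F := F) (φ := fun j => ((Fintype.card F : ℝ) ^ (r * j))⁻¹)
    (fun _ => by positivity) (s := s) (t := s.image natDegree)
    fun f hf => ⟨(hs f hf).1, Finset.mem_image_of_mem _ hf⟩
  refine (h.trans ?_)
  have ha : (2 : ℝ) ≤ (Fintype.card F : ℝ) ^ (r - 1) :=
    hq.trans (le_self_pow₀ (by linarith) (by omega))
  have := sum_inv_pow_le_two_mul ha Q (s.image natDegree) (by
    intro j hj
    obtain ⟨f, hf, rfl⟩ := Finset.mem_image.1 hj
    exact (hs f hf).2)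
  refine le_of_eq_of_le ?_ (this.trans (by rw [pow_mul]))
  refine Finset.sum_congr rfl fun j _ => ?_
  obtain ⟨m, rfl⟩ : ∃ m, r = m + 1 := ⟨r - 1, by omega⟩
  rw [Nat.add_sub_cancel, ← pow_mul, add_mul, one_mul, pow_add, mul_inv]
  field_simp

theorem sum_wt_le_of_dvd {r : ℕ} (hr : 2 ≤ r) {f : F[X]} (hf : f.Monic) {s : Finset F[X]}
    (hs : ∀ g ∈ s, g.Monic ∧ f ∣ g) : ∑ g ∈ s, wt r g ≤ 2 * wt r f := by
  classical
  have h := sum_wt_le (F := F) hr (Q := 0) (s := s.image fun g => g /ₘ f) (by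
    intro h hh
    obtain ⟨g, hg, rfl⟩ := Finset.mem_image.1 hh
    obtain ⟨hg1, c, rfl⟩ := hs g hg
    rw [mul_divByMonic_cancel_left _ hf]
    exact ⟨hf.of_mul_monic_left hg1, Nat.zero_le _⟩)
  rw [Finset.sum_image] at h
  · calc ∑ g ∈ s, wt r g = ∑ g ∈ s, wt r f * wt r (g /ₘ f) := by
          refine Finset.sum_congr rfl fun g hg => ?_
          obtain ⟨hg1, c, rfl⟩ := hs g hg
          rw [mul_divByMonic_cancel_left _ hf,
            wt_mul r hf.ne_zero (hf.of_mul_monic_left hg1).ne_zero]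
      _ ≤ _ := by
          rw [← Finset.mul_sum]
          simp only [mul_zero, pow_zero, inv_one, mul_one] at h
          nlinarith [wt_pos r f]
  · intro g hg g' hg' he
    obtain ⟨hg1, c, rfl⟩ := hs g hg
    obtain ⟨hg1', c', rfl⟩ := hs g' hg'
    simp only [mul_divByMonic_cancel_left _ hf] at he
    rw [he]

/-- The monic polynomials, over which the infinite series run. -/
abbrev Mon (F : Type*) [Field F] : Type _ := {f : F[X] // f.Monic}

theorem summable_natDegree {φ : ℕ → ℝ} (hφ : ∀ j, 0 ≤ φ j)
    (h : Summable fun j => (Fintype.card F : ℝ) ^ j * φ j) :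
    Summable fun f : Mon F => φ f.1.natDegree := by
  classical
  refine summable_of_sum_le (c := ∑' j, (Fintype.card F : ℝ) ^ j * φ j) (fun _ => hφ _) fun u => ?_
  have := sum_natDegree_le hφ (s := u.map (Function.Embedding.subtype _))
    (t := (u.map (Function.Embedding.subtype _)).image natDegree) (by
      intro f hf
      refine ⟨?_, Finset.mem_image_of_mem _ hf⟩
      obtain ⟨g, _, rfl⟩ := Finset.mem_map.1 hf
      exact g.2)
  rw [Finset.sum_map] at this
  exact this.trans (h.sum_le_tsum _ fun _ _ => mul_nonneg (by positivity) (hφ _))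

theorem summable_wt {r : ℕ} (hr : 2 ≤ r) : Summable fun f : Mon F => wt r f.1 := by
  classical
  refine summable_of_sum_le (c := 2) (fun _ => (wt_pos _ _).le) fun u => ?_
  have := sum_wt_le (F := F) hr (Q := 0) (s := u.map (Function.Embedding.subtype _)) (by
      intro f hf
      obtain ⟨g, _, rfl⟩ := Finset.mem_map.1 hf
      exact ⟨g.2, Nat.zero_le _⟩)
  rw [Finset.sum_map] at this
  simpa using this

theorem tendsto_sum_monicUpTo {h : F[X] → ℝ} (hs : Summable fun f : Mon F => h f.1) :
    Filter.Tendsto (fun J => ∑ f ∈ monicUpTo F J, h f) Filter.atTop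
      (nhds (∑' f : Mon F, h f.1)) := by
  classical
  have h1 : Filter.Tendsto (fun J => (monicUpTo F J).subtype Monic) Filter.atTop
      Filter.atTop := by
    refine Filter.tendsto_atTop_finset_of_monotone (fun i j hij f hf => ?_)
      fun f => ⟨f.1.natDegree, ?_⟩
    · rw [Finset.mem_subtype, mem_monicUpTo] at hf ⊢
      exact ⟨hf.1, hf.2.trans hij⟩
    · rw [Finset.mem_subtype, mem_monicUpTo]
      exact ⟨f.2, le_rfl⟩
  refine (hs.hasSum.comp h1).congr fun J => ?_
  rw [Function.comp_apply, Finset.sum_subtype_eq_sum_filter, Finset.filter_true_of_mem]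
  exact fun f hf => (mem_monicUpTo.1 hf).1

/-- The difference between a series over the monic polynomials and a finite partial sum is bounded
by any bound for the finite sums of the absolute values of the remaining terms. -/
theorem abs_tsum_sub_sum_le {h : F[X] → ℝ} (hs : Summable fun f : Mon F => h f.1)
    {s : Finset F[X]} (hm : ∀ f ∈ s, f.Monic) {c : ℝ}
    (hc : ∀ u : Finset F[X], (∀ f ∈ u, f.Monic ∧ f ∉ s) → ∑ f ∈ u, |h f| ≤ c) :
    |∑' f : Mon F, h f.1 - ∑ f ∈ s, h f| ≤ c := by
  classical
  have h1 := (tendsto_sum_monicUpTo hs).sub_const (∑ f ∈ s, h f)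
  refine le_of_tendsto h1.abs ?_
  filter_upwards [Filter.eventually_ge_atTop (s.sup natDegree)] with J hJ
  have hsub : s ⊆ monicUpTo F J := fun f hf =>
    mem_monicUpTo.2 ⟨hm f hf, (Finset.le_sup (f := natDegree) hf).trans hJ⟩
  rw [← Finset.sum_sdiff hsub, add_sub_cancel_right]
  refine (Finset.abs_sum_le_sum_abs _ _).trans (hc _ fun f hf => ?_)
  rw [Finset.mem_sdiff] at hf
  exact ⟨(mem_monicUpTo.1 hf.1).1, hf.2⟩

end Counting

/-! ### The Möbius function -/

section Moebius

variable {F : Type*} [Field F]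

/-- The Möbius function of `F[t]`. -/
def mu (g : F[X]) : ℝ :=
  open Classical in
  if Squarefree g then (-1) ^ (UniqueFactorizationMonoid.normalizedFactors g).card else 0

theorem mu_one : mu (1 : F[X]) = 1 := by
  simp [mu]

theorem abs_mu_le_one (g : F[X]) : |mu g| ≤ 1 := by
  unfold mu
  split_ifs <;> simp

theorem abs_mu {g : F[X]} (hg : Squarefree g) : |mu g| = 1 := by
  simp [mu, hg]

theorem mu_of_not_squarefree {g : F[X]} (hg : ¬ Squarefree g) : mu g = 0 := by
  simp [mu, hg]

theorem squarefree_mul_irreducible {g p : F[X]} (hg : Squarefree g) (hp : Irreducible p)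
    (hpg : ¬ p ∣ g) : Squarefree (g * p) :=
  squarefree_mul_iff.2 ⟨((hp.coprime_iff_not_dvd).2 hpg).symm.isRelPrime, hg, hp.squarefree⟩

theorem mu_mul_irreducible {g p : F[X]} (hg : Squarefree g) (hp : Irreducible p)
    (hpg : ¬ p ∣ g) : mu (g * p) = -mu g := by
  classical
  rw [mu, mu, if_pos hg, if_pos (squarefree_mul_irreducible hg hp hpg),
    UniqueFactorizationMonoid.normalizedFactors_mul hg.ne_zero hp.ne_zero,
    UniqueFactorizationMonoid.normalizedFactors_irreducible hp, Multiset.card_add,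
    Multiset.card_singleton, pow_succ]
  ring

theorem squarefree_induction {P : F[X] → Prop} (h1 : P 1)
    (h : ∀ f p : F[X], f.Monic → Squarefree f → p.Monic → Irreducible p → ¬ p ∣ f → P f →
      P (f * p)) {f : F[X]} (hf : f.Monic) (hs : Squarefree f) : P f := by
  induction hn : f.natDegree using Nat.strong_induction_on generalizing f with
  | _ n ih =>
    by_cases hu : IsUnit f
    · rwa [hf.eq_one_of_isUnit hu]
    · obtain ⟨p, hpm, hp, g, rfl⟩ := exists_monic_irreducible_factor f hu
      have hg : g.Monic := hpm.of_mul_monic_left hf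
      have hpg : ¬ p ∣ g := fun ⟨c, hc⟩ => hp.not_isUnit (hs p ⟨c, by rw [hc]; ring⟩)
      rw [mul_comm]
      refine h g p hg hs.of_mul_right hpm hp hpg (ih g.natDegree ?_ hg hs.of_mul_right rfl)
      rw [← hn, hpm.natDegree_mul hg]
      have := hp.natDegree_pos
      omega

/-- The sum of `μ(g)` over all monic `g` with `g ^ r ∣ n` detects the `r`-free `n`: if `p ^ r ∣ n`,
the squarefree `g` with and without the factor `p` cancel in pairs. -/
theorem sum_mu_of_pow_dvd {r : ℕ} {n : F[X]}
    {s : Finset F[X]} (hs : ∀ g, g ∈ s ↔ g.Monic ∧ g ^ r ∣ n) :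
    (∑ g ∈ s, mu g : ℝ) = open Classical in if IsRFree r n then 1 else 0 := by
  classical
  have hsub : ∑ g ∈ s, mu g = ∑ g ∈ s.filter Squarefree, mu g :=
    (Finset.sum_filter_of_ne fun g _ hg => by
      by_contra h
      exact hg (mu_of_not_squarefree h)).symm
  rw [hsub]
  split_ifs with h
  · rw [Finset.sum_eq_single_of_mem 1, mu_one]
    · simp [hs]
    · intro g hg hg1
      rw [Finset.mem_filter, hs] at hg
      have : ¬ IsUnit g := fun hu => hg1 (hg.1.1.eq_one_of_isUnit hu)
      obtain ⟨p, -, hp, hpg⟩ := exists_monic_irreducible_factor g this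
      exact absurd ((pow_dvd_pow_of_dvd hpg r).trans hg.1.2) (h p hp)
  · obtain ⟨p, hp, hpn⟩ : ∃ p : F[X], Irreducible p ∧ p ^ r ∣ n := by
      simpa [IsRFree] using h
    obtain ⟨p', hpm, hp', c, hc⟩ := exists_monic_irreducible_factor p hp.not_isUnit
    have hpn' : p' ^ r ∣ n := (pow_dvd_pow_of_dvd ⟨c, hc⟩ r).trans hpn
    clear hc hpn hp
    refine Finset.sum_involution (fun g _ => if p' ∣ g then g /ₘ p' else g * p') ?_ ?_ ?_ ?_
    · intro g hg
      rw [Finset.mem_filter] at hg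
      split_ifs with hd
      · obtain ⟨c, rfl⟩ := hd
        rw [mul_divByMonic_cancel_left _ hpm, mul_comm, mu_mul_irreducible hg.2.of_mul_right hp']
        · ring
        · exact fun ⟨d, hd⟩ => hp'.not_isUnit (hg.2 p' ⟨d, by rw [hd]; ring⟩)
      · rw [mu_mul_irreducible hg.2 hp' hd]
        ring
    · intro g hg _ he
      rw [Finset.mem_filter, hs] at hg
      split_ifs at he with hd
      · obtain ⟨c, rfl⟩ := hd
        rw [mul_divByMonic_cancel_left _ hpm] at he
        have hc : c ≠ 0 := by
          rintro rfl
          simp at hg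
        exact hp'.ne_one (mul_right_cancel₀ hc (by rw [← he, one_mul]))
      · exact hd ⟨g, by rw [mul_comm]; exact he.symm⟩
    · intro g hg
      rw [Finset.mem_filter, hs] at hg ⊢
      split_ifs with hd
      · obtain ⟨c, rfl⟩ := hd
        rw [mul_divByMonic_cancel_left _ hpm]
        refine ⟨⟨hpm.of_mul_monic_left hg.1.1, ?_⟩, hg.2.of_mul_right⟩
        exact (pow_dvd_pow_of_dvd (Dvd.intro_left _ rfl) r).trans hg.1.2
      · refine ⟨⟨hg.1.1.mul hpm, ?_⟩, squarefree_mul_irreducible hg.2 hp' hd⟩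
        rw [mul_pow]
        exact (IsCoprime.pow ((hp'.coprime_iff_not_dvd).2 hd).symm).mul_dvd hg.1.2 hpn'
    · intro g hg
      rw [Finset.mem_filter] at hg
      split_ifs with hd hd' hd'
      · obtain ⟨c, rfl⟩ := hd
        rw [mul_divByMonic_cancel_left _ hpm] at hd'
        obtain ⟨d, rfl⟩ := hd'
        exact absurd (hg.2 p' ⟨d, by ring⟩) hp'.not_isUnit
      · obtain ⟨c, rfl⟩ := hd
        rw [mul_divByMonic_cancel_left _ hpm, mul_comm]
      · rw [mul_comm, mul_divByMonic_cancel_left _ hpm]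
      · exact absurd (Dvd.intro_left _ rfl) hd'

end Moebius

/-! ### Primitive residue classes modulo an `r`-th power -/

section Primitive

variable {F : Type*} [Field F]

/-- The numerator `a` is primitive over `f` if no irreducible factor `p` of `f` satisfies
`p ^ r ∣ a`. For squarefree `f` this says that the denominator of `a / f ^ r` in lowest terms is
divisible by every irreducible factor of `f`. -/
def Prim (r : ℕ) (f a : F[X]) : Prop :=
  ∀ p : F[X], Irreducible p → p ∣ f → ¬ p ^ r ∣ a

theorem dvd_of_forall_irreducible_dvd {f g : F[X]} (hf : f.Monic) (hs : Squarefree f) :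
    (∀ p : F[X], Irreducible p → p ∣ f → p ∣ g) → f ∣ g := by
  refine squarefree_induction (P := fun f => (∀ p : F[X], Irreducible p → p ∣ f → p ∣ g) → f ∣ g)
    (fun _ => one_dvd _) ?_ hf hs
  intro f p _ _ _ hp hpf ih h
  exact ((hp.coprime_iff_not_dvd).2 hpf).symm.mul_dvd
    (ih fun t ht htf => h t ht (htf.mul_right _)) (h p hp (dvd_mul_left _ _))

/-- If a fraction with squarefree `f` and primitive numerator over `f ^ r` can be written with
denominator `g ^ r`, then `f ∣ g`. -/
theorem Prim.dvd {r : ℕ} {f a : F[X]} (hf : f.Monic) (hs : Squarefree f) (ha : Prim r f a)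
    {g b : F[X]} (h : a * g ^ r = b * f ^ r) : f ∣ g := by
  refine dvd_of_forall_irreducible_dvd hf hs fun p hp hpf => ?_
  by_contra hpg
  refine ha p hp hpf ((IsCoprime.pow (m := r) (n := r)
    ((hp.coprime_iff_not_dvd).2 hpg)).dvd_of_dvd_mul_right ?_)
  rw [h]
  exact (pow_dvd_pow_of_dvd hpf r).mul_left _

/-- Every fraction with denominator `g ^ r`, for squarefree `g`, is a fraction with denominator
`f ^ r` and primitive numerator for a divisor `f` of `g`. -/
theorem exists_prim {r : ℕ} (g : F[X]) (hg : g.Monic) (hs : Squarefree g) (b : F[X]) :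
    ∃ f a : F[X], f.Monic ∧ Squarefree f ∧ f ∣ g ∧ Prim r f a ∧ a * g ^ r = b * f ^ r := by
  induction hn : g.natDegree using Nat.strong_induction_on generalizing g b with
  | _ n ih =>
    by_cases h : Prim r g b
    · exact ⟨g, b, hg, hs, dvd_rfl, h, rfl⟩
    · obtain ⟨p, hp, hpg, hpb⟩ : ∃ p : F[X], Irreducible p ∧ p ∣ g ∧ p ^ r ∣ b := by
        simpa [Prim] using h
      obtain ⟨p', hpm, hp', hpp⟩ := exists_monic_irreducible_factor p hp.not_isUnit
      obtain ⟨c, rfl⟩ := hpp.trans hpg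
      obtain ⟨d, rfl⟩ := (pow_dvd_pow_of_dvd hpp r).trans hpb
      have hc : c.Monic := hpm.of_mul_monic_left hg
      obtain ⟨f, a, hf, hfs, hfc, hpr, he⟩ := ih c.natDegree (by
        rw [← hn, hpm.natDegree_mul hc]
        have := hp'.natDegree_pos
        omega) c hc hs.of_mul_right d rfl
      refine ⟨f, a, hf, hfs, hfc.trans (Dvd.intro_left _ rfl), hpr, ?_⟩
      rw [mul_pow]
      linear_combination p' ^ r * he

variable [Fintype F]

/-- The primitive numerators of degree less than `r * deg f`, which represent the primitive
residue classes modulo `f ^ r`. -/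
def primNum (r : ℕ) (f : F[X]) : Finset F[X] :=
  open Classical in (polysLT F (r * f.natDegree)).filter (Prim r f)

/-- By the Chinese remainder theorem, the residue classes modulo `(f * p) ^ r` that are primitive
over `f * p` are those that are primitive over `f`, less those divisible by `p ^ r`. -/
theorem card_primNum_mul {r : ℕ} {f p : F[X]} (hf : f.Monic) (hpm : p.Monic)
    (hp : Irreducible p) (hpf : ¬ p ∣ f) :
    ((primNum r (f * p)).card : ℝ) =
      (primNum r f).card * ((Fintype.card F : ℝ) ^ (r * p.natDegree) - 1) := by
  classical
  have hcop : IsCoprime (f ^ r) (p ^ r) := (IsCoprime.pow ((hp.coprime_iff_not_dvd).2 hpf).symm)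
  have hfr : (f ^ r).Monic := hf.pow r
  have hpr : (p ^ r).Monic := hpm.pow r
  have hfd : (f ^ r).natDegree = r * f.natDegree := hf.natDegree_pow r
  have hpd : (p ^ r).natDegree = r * p.natDegree := hpm.natDegree_pow r
  have hd : r * (f * p).natDegree = r * f.natDegree + r * p.natDegree := by
    rw [hf.natDegree_mul hpm, mul_add]
  -- numerators modulo `(f * p) ^ r` that are primitive over `f`
  have hA : ((polysLT F (r * (f * p).natDegree)).filter (Prim r f)) =
      (primNum r f ×ˢ polysLT F (r * p.natDegree)).image fun x => x.1 + f ^ r * x.2 := by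
    ext a
    simp only [Finset.mem_filter, Finset.mem_image, Finset.mem_product, mem_polysLT, primNum,
      Prod.exists]
    constructor
    · rintro ⟨h1, h2⟩
      refine ⟨a %ₘ f ^ r, a /ₘ f ^ r, ⟨⟨?_, ?_⟩, ?_⟩, modByMonic_add_div a (f ^ r)⟩
      · rw [← hfd, ← degree_eq_natDegree hfr.ne_zero]
        exact degree_modByMonic_lt _ hfr
      · intro t ht htf hta
        refine h2 t ht htf ?_
        rw [← modByMonic_add_div a (f ^ r)]
        exact dvd_add hta ((pow_dvd_pow_of_dvd htf r).mul_right _)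
      · by_cases h0 : a /ₘ f ^ r = 0
        · rw [h0, degree_zero]
          exact WithBot.bot_lt_coe _
        · have ha0 : a ≠ 0 := by
            rintro rfl
            simp at h0
          rw [← natDegree_lt_iff_degree_lt h0, natDegree_divByMonic _ hfr]
          rw [← natDegree_lt_iff_degree_lt ha0] at h1
          have : ¬ a.natDegree < (f ^ r).natDegree := fun hlt => h0 <| by
            rw [divByMonic_eq_zero_iff hfr]
            exact degree_lt_degree hlt
          omega
    · rintro ⟨b, c, ⟨⟨hb, hbp⟩, hc⟩, rfl⟩
      refine ⟨?_, ?_⟩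
      · refine (degree_add_le _ _).trans_lt (max_lt (hb.trans_le ?_) ?_)
        · exact_mod_cast (by omega)
        · by_cases h0 : c = 0
          · rw [h0, mul_zero, degree_zero]
            exact WithBot.bot_lt_coe _
          · rw [← natDegree_lt_iff_degree_lt (mul_ne_zero hfr.ne_zero h0),
              natDegree_mul hfr.ne_zero h0]
            rw [← natDegree_lt_iff_degree_lt h0] at hc
            omega
      · intro t ht htf hta
        exact hbp t ht htf ((dvd_add_left ((pow_dvd_pow_of_dvd htf r).mul_right _)).1 hta)
  have hAcard : (((polysLT F (r * (f * p).natDegree)).filter (Prim r f)).card : ℝ) =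
      (primNum r f).card * (Fintype.card F : ℝ) ^ (r * p.natDegree) := by
    rw [hA, Finset.card_image_of_injOn, Finset.card_product, card_polysLT]
    · push_cast; rfl
    · rintro ⟨b, c⟩ hx ⟨b', c'⟩ hx' he
      simp only [Finset.coe_product, Set.mem_prod, Finset.mem_coe, primNum, Finset.mem_filter,
        mem_polysLT] at hx hx' he
      have hlt : ∀ {b : F[X]}, b.degree < ((r * f.natDegree : ℕ) : WithBot ℕ) →
          b.degree < (f ^ r).degree := fun h => by
        rwa [degree_eq_natDegree hfr.ne_zero, hfd]
      have h1 := div_modByMonic_unique c b hfr ⟨rfl, hlt hx.1.1⟩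
      have h2 := div_modByMonic_unique c' b' hfr ⟨rfl, hlt hx'.1.1⟩
      rw [he] at h1
      exact Prod.ext (h1.2.symm.trans h2.2) (h1.1.symm.trans h2.1)
  -- those of them that are not primitive over `p`
  have hB : ((polysLT F (r * (f * p).natDegree)).filter (Prim r f)).filter (fun a => p ^ r ∣ a) =
      (primNum r f).image fun x => p ^ r * x := by
    ext a
    simp only [Finset.mem_filter, Finset.mem_image, mem_polysLT, primNum]
    constructor
    · rintro ⟨⟨h1, h2⟩, c, rfl⟩
      refine ⟨c, ⟨?_, fun t ht htf htc => h2 t ht htf (htc.mul_left _)⟩, rfl⟩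
      by_cases h0 : c = 0
      · rw [h0, degree_zero]
        exact WithBot.bot_lt_coe _
      · rw [← natDegree_lt_iff_degree_lt (mul_ne_zero hpr.ne_zero h0),
          natDegree_mul hpr.ne_zero h0] at h1
        rw [← natDegree_lt_iff_degree_lt h0]
        omega
    · rintro ⟨c, ⟨h1, h2⟩, rfl⟩
      refine ⟨⟨?_, fun t ht htf htc => h2 t ht htf ?_⟩, dvd_mul_right _ _⟩
      · by_cases h0 : c = 0
        · rw [h0, mul_zero, degree_zero]
          exact WithBot.bot_lt_coe _
        · rw [← natDegree_lt_iff_degree_lt (mul_ne_zero hpr.ne_zero h0),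
            natDegree_mul hpr.ne_zero h0]
          rw [← natDegree_lt_iff_degree_lt h0] at h1
          omega
      · exact (hcop.of_isCoprime_of_dvd_left (pow_dvd_pow_of_dvd htf r)).dvd_of_dvd_mul_left htc
  have hC : primNum r (f * p) =
      ((polysLT F (r * (f * p).natDegree)).filter (Prim r f)).filter (fun a => ¬ p ^ r ∣ a) := by
    ext a
    simp only [Finset.mem_filter, primNum, and_assoc]
    refine and_congr_right fun _ => ⟨fun h => ⟨fun t ht htf => h t ht (htf.mul_right _),
      h p hp (dvd_mul_left _ _)⟩, fun h t ht htd hta => ?_⟩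
    rcases ht.prime.dvd_or_dvd htd with h' | h'
    · exact h.1 t ht h' hta
    · exact h.2 ((pow_dvd_pow_of_dvd (ht.associated_of_dvd hp h').symm.dvd r).trans hta)
  have hsum := Finset.card_filter_add_card_filter_not
    (s := (polysLT F (r * (f * p).natDegree)).filter (Prim r f)) (fun a => p ^ r ∣ a)
  rw [hB, ← hC, Finset.card_image_of_injective _ (mul_right_injective₀ hpr.ne_zero)] at hsum
  rw [mul_sub, mul_one, ← hAcard, ← hsum]
  push_cast
  ring

theorem Phi_one (r : ℕ) : Phi r (1 : F[X]) = 1 := by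
  simp [Phi, polyAbs]

theorem Phi_mul {r : ℕ} {f p : F[X]} (hf : f.Monic) (hpm : p.Monic)
    (hp : Irreducible p) (hpf : ¬ p ∣ f) :
    Phi r (f * p) = Phi r f * ((Fintype.card F : ℝ) ^ (r * p.natDegree) - 1) := by
  classical
  have hq := two_le_card (F := F)
  rw [Phi, Phi, UniqueFactorizationMonoid.normalizedFactors_mul hf.ne_zero hpm.ne_zero,
    UniqueFactorizationMonoid.normalizedFactors_irreducible hp, hpm.normalize_eq_self,
    Multiset.toFinset_add, Multiset.toFinset_singleton, Finset.union_comm,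
    ← Finset.insert_eq, Finset.prod_insert]
  · rw [polyAbs, polyAbs, polyAbs, if_neg hf.ne_zero, if_neg hpm.ne_zero,
      if_neg (hf.mul hpm).ne_zero, hf.natDegree_mul hpm, pow_add, mul_pow, ← pow_mul _ p.natDegree,
      mul_comm p.natDegree r]
    have : (Fintype.card F : ℝ) ^ (r * p.natDegree) ≠ 0 := by positivity
    field_simp
  · rw [Multiset.mem_toFinset]
    exact fun h => hpf (UniqueFactorizationMonoid.dvd_of_mem_normalizedFactors h)

/-- The function `Φ_r` counts the primitive residue classes modulo `f ^ r`. -/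
theorem card_primNum {r : ℕ} {f : F[X]} (hf : f.Monic) (hs : Squarefree f) :
    ((primNum r f).card : ℝ) = Phi r f := by
  classical
  refine squarefree_induction (P := fun f => ((primNum r f).card : ℝ) = Phi r f) ?_ ?_ hf hs
  · have : primNum r (1 : F[X]) = {0} := by
      ext a
      simp only [primNum, natDegree_one, mul_zero, Finset.mem_filter, mem_polysLT,
        Finset.mem_singleton, Nat.cast_zero]
      constructor
      · rintro ⟨h, -⟩
        by_contra h0
        exact absurd h (not_lt.2 (zero_le_degree_iff.2 h0))
      · rintro rfl
        exact ⟨by simp, fun p hp hp1 => absurd (isUnit_of_dvd_one hp1) hp.not_isUnit⟩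
    rw [this, Phi_one]
    simp
  · intro f p hf _ hpm hp hpf ih
    rw [card_primNum_mul hf hpm hp hpf, Phi_mul hf hpm hp hpf, ih]

end Primitive

/-! ### The coefficients of the singular series -/

section SingularSeries

variable {F : Type*} [Field F] [Fintype F]

theorem polyAbs_rpow_neg (r : ℕ) {f : F[X]} (hf : f.Monic) :
    polyAbs f ^ (-(r : ℝ)) = wt r f := by
  have hq := two_le_card (F := F)
  rw [polyAbs, if_neg hf.ne_zero, Real.rpow_neg (by positivity), Real.rpow_natCast, ← pow_mul,
    mul_comm, wt]

theorem zeta_eq_tsum_wt (r : ℕ) : zeta F r = ∑' f : Mon F, wt r f.1 :=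
  tsum_congr fun f => polyAbs_rpow_neg r f.2

/-- The number of monic multiples of `g` of degree `j`. -/
theorem card_monicDeg_dvd {g : F[X]} (hg : g.Monic) {j : ℕ} (hj : g.natDegree ≤ j) :
    open Classical in
    ((monicDeg F j).filter (g ∣ ·)).card = Fintype.card F ^ (j - g.natDegree) := by
  classical
  have : (monicDeg F j).filter (g ∣ ·) = (monicDeg F (j - g.natDegree)).image (g * ·) := by
    ext n
    simp only [Finset.mem_filter, Finset.mem_image, mem_monicDeg]
    constructor
    · rintro ⟨⟨h1, h2⟩, c, rfl⟩
      have hc := hg.of_mul_monic_left h1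
      refine ⟨c, ⟨hc, ?_⟩, rfl⟩
      rw [← h2, hg.natDegree_mul hc]
      omega
    · rintro ⟨c, ⟨h1, h2⟩, rfl⟩
      refine ⟨⟨hg.mul h1, ?_⟩, dvd_mul_right _ _⟩
      rw [hg.natDegree_mul h1]
      omega
  rw [this, Finset.card_image_of_injective _ (mul_right_injective₀ hg.ne_zero), card_monicDeg]

/-- The convolution of `μ` with the constant function `1`, summed over the polynomials of degree
`j ≥ 1`, vanishes. -/
theorem sum_mu_convolution {j : ℕ} (hj : 1 ≤ j) :
    ∑ i ∈ Finset.range (j + 1),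
      (∑ g ∈ monicDeg F i, mu g) * (Fintype.card F : ℝ) ^ (j - i) = 0 := by
  classical
  have h0 : ∑ n ∈ monicDeg F j, ∑ g ∈ monicUpTo F j with g ∣ n, mu g = 0 := by
    refine Finset.sum_eq_zero fun n hn => ?_
    rw [mem_monicDeg] at hn
    rw [sum_mu_of_pow_dvd (r := 1) (n := n), if_neg]
    · intro h
      have hu : ¬ IsUnit n := fun hu => by
        rw [hn.1.eq_one_of_isUnit hu, natDegree_one] at hn
        omega
      obtain ⟨p, -, hp, hpn⟩ := exists_monic_irreducible_factor n hu
      exact h p hp (by rwa [pow_one])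
    · intro g
      rw [Finset.mem_filter, mem_monicUpTo, pow_one]
      refine ⟨fun h => ⟨h.1.1, h.2⟩, fun h => ⟨⟨h.1, ?_⟩, h.2⟩⟩
      rw [← hn.2]
      exact natDegree_le_of_dvd h.2 hn.1.ne_zero
  simp only [Finset.sum_filter] at h0
  rw [Finset.sum_comm, sum_monicUpTo] at h0
  rw [← h0]
  refine Finset.sum_congr rfl fun i hi => ?_
  rw [Finset.sum_mul]
  refine Finset.sum_congr rfl fun g hg => ?_
  obtain ⟨hgm, rfl⟩ := mem_monicDeg.1 hg
  rw [← Finset.sum_filter, Finset.sum_const,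
    card_monicDeg_dvd hgm (Nat.lt_succ_iff.1 (Finset.mem_range.1 hi)), nsmul_eq_mul, mul_comm]
  push_cast
  rfl

/-- The coefficients of the polynomial `1 - q T`, the inverse of the zeta function. -/
theorem sum_mu_monicDeg (j : ℕ) :
    ∑ g ∈ monicDeg F j, mu g =
      if j = 0 then 1 else if j = 1 then -(Fintype.card F : ℝ) else 0 := by
  have h0 : ∑ g ∈ monicDeg F 0, mu g = 1 := by
    have : monicDeg F 0 = {1} := by
      ext g
      rw [mem_monicDeg, Finset.mem_singleton]
      exact ⟨fun h => eq_one_of_monic_natDegree_zero h.1 h.2, fun h => by simp [h]⟩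
    rw [this, Finset.sum_singleton, mu_one]
  match j with
  | 0 => rw [h0, if_pos rfl]
  | 1 =>
    have h := sum_mu_convolution (F := F) (j := 1) le_rfl
    rw [Finset.sum_range_succ, Finset.sum_range_one, h0] at h
    simp only [Nat.sub_zero, pow_one, Nat.sub_self, pow_zero, mul_one, one_mul] at h
    simp only [one_ne_zero, if_false, if_true]
    linarith
  | j + 2 =>
    have h1 := sum_mu_convolution (F := F) (j := j + 1) (by omega)
    have h2 := sum_mu_convolution (F := F) (j := j + 2) (by omega)
    rw [Finset.sum_range_succ] at h2
    have h3 : ∑ i ∈ Finset.range (j + 1 + 1),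
        (∑ g ∈ monicDeg F i, mu g) * (Fintype.card F : ℝ) ^ (j + 2 - i) = 0 := by
      rw [← mul_zero (Fintype.card F : ℝ), ← h1, Finset.mul_sum]
      refine Finset.sum_congr rfl fun i hi => ?_
      have := Finset.mem_range.1 hi
      rw [show j + 2 - i = (j + 1 - i) + 1 by omega, pow_succ]
      ring
    have h3' : ∑ i ∈ Finset.range (j + 2),
        (∑ g ∈ monicDeg F i, mu g) * (Fintype.card F : ℝ) ^ (j + 2 - i) = 0 := h3
    rw [h3', zero_add, Nat.sub_self, pow_zero, mul_one] at h2
    rw [h2]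
    simp

/-- The coefficient of the fractions with primitive numerator over `f ^ r` in the expansion of the
exponential sum, that is, the sum of `μ(g) |g| ^ (-r)` over the monic multiples `g` of `f`. -/
def coefC (r : ℕ) (f : F[X]) : ℝ :=
  open Classical in ∑' g : Mon F, if f ∣ g.1 then mu g.1 * wt r g.1 else 0

theorem summable_mu_wt {r : ℕ} (hr : 2 ≤ r) (p : F[X] → Prop) [DecidablePred p] :
    Summable fun g : Mon F => if p g.1 then mu g.1 * wt r g.1 else 0 := by
  refine Summable.of_norm_bounded (summable_wt hr) fun g => ?_
  have := (wt_pos r g.1).le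
  split_ifs
  · rw [norm_mul, Real.norm_eq_abs, Real.norm_eq_abs, abs_of_nonneg this]
    exact mul_le_of_le_one_left this (abs_mu_le_one _)
  · simpa using this

theorem abs_mu_mul_wt_le (r : ℕ) (g : F[X]) : |mu g * wt r g| ≤ wt r g := by
  have := (wt_pos r g).le
  rw [abs_mul, abs_of_nonneg this]
  exact mul_le_of_le_one_left this (abs_mu_le_one _)

theorem abs_coefC_le {r : ℕ} (hr : 2 ≤ r) {f : F[X]} (hf : f.Monic) :
    |coefC r f| ≤ 2 * wt r f := by
  classical
  have := abs_tsum_sub_sum_le (h := fun g => if f ∣ g then mu g * wt r g else 0)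
    (summable_mu_wt (F := F) hr (f ∣ ·)) (s := ∅) (by simp)
    (c := 2 * wt r f) (fun u hu => by
      calc ∑ g ∈ u, |if f ∣ g then mu g * wt r g else 0|
          = ∑ g ∈ u with f ∣ g, |mu g * wt r g| := by
            rw [Finset.sum_filter]
            exact Finset.sum_congr rfl fun g _ => by split_ifs <;> simp
        _ ≤ ∑ g ∈ u with f ∣ g, wt r g := Finset.sum_le_sum fun g _ => abs_mu_mul_wt_le r g
        _ ≤ _ := sum_wt_le_of_dvd hr hf fun g hg => by
            rw [Finset.mem_filter] at hg
            exact ⟨(hu g hg.1).1, hg.2⟩)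
  simpa [coefC] using this

theorem coefC_one_mul_zeta {r : ℕ} (hr : 2 ≤ r) : coefC r (1 : F[X]) * zeta F r = 1 := by
  classical
  have hq := two_le_card (F := F)
  set q : ℝ := (Fintype.card F : ℝ) with hqd
  have hq0 : (0 : ℝ) < q := by linarith
  set z : ℝ := (q ^ (r - 1))⁻¹ with hz
  have hz1 : z < 1 := inv_lt_one_of_one_lt₀ (one_lt_pow₀ (by linarith) (by omega))
  have hz0 : 0 ≤ z := by positivity
  have hqz : ∀ j : ℕ, q ^ j * (q ^ (r * j))⁻¹ = z ^ j := fun j => by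
    obtain ⟨m, rfl⟩ : ∃ m, r = m + 1 := ⟨r - 1, by omega⟩
    rw [hz, Nat.add_sub_cancel, inv_pow, ← pow_mul, add_mul, one_mul, pow_add, mul_inv]
    field_simp
  -- `ζ(r) = 1 / (1 - q ^ (1 - r))`
  have h1 : zeta F r = (1 - z)⁻¹ := by
    rw [zeta_eq_tsum_wt]
    refine tendsto_nhds_unique (tendsto_sum_monicUpTo (summable_wt hr)) ?_
    refine ((hasSum_geometric_of_lt_one hz0 hz1).tendsto_sum_nat.comp
      (Filter.tendsto_add_atTop_nat 1)).congr fun J => ?_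
    have := sum_monicUpTo_natDegree (F := F) (fun j => (q ^ (r * j))⁻¹) J
    rw [Function.comp_apply]
    refine Eq.trans ?_ this.symm
    exact Finset.sum_congr rfl fun j _ => (hqz j).symm
  -- the Möbius series equals `1 - q ^ (1 - r)`, as the Möbius sums vanish from degree `2` on
  have h2 : coefC r (1 : F[X]) = 1 - z := by
    rw [coefC]
    refine tendsto_nhds_unique (tendsto_sum_monicUpTo
      (h := fun g : F[X] => if 1 ∣ g then mu g * wt r g else 0)
      (summable_mu_wt (F := F) hr (1 ∣ ·))) ?_
    refine tendsto_const_nhds.congr' ?_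
    filter_upwards [Filter.eventually_ge_atTop 1] with J hJ
    rw [sum_monicUpTo]
    have : ∀ j, ∑ f ∈ monicDeg F j, (if 1 ∣ f then mu f * wt r f else 0) =
        (if j = 0 then 1 else if j = 1 then -q else 0) * (q ^ (r * j))⁻¹ := fun j => by
      rw [← sum_mu_monicDeg, Finset.sum_mul]
      refine Finset.sum_congr rfl fun g hg => ?_
      rw [if_pos (one_dvd _), wt, (mem_monicDeg.1 hg).2]
    simp only [this]
    obtain ⟨m, rfl⟩ : ∃ m, J = m + 1 := ⟨J - 1, by omega⟩
    rw [Finset.sum_range_succ', Finset.sum_range_succ', Finset.sum_eq_zero (fun j _ => by simp)]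
    have := hqz 1
    rw [pow_one, pow_one] at this
    simp only [zero_add, one_ne_zero, if_false, if_true, neg_mul, this]
    simp
    ring
  rw [h1, h2, mul_inv_cancel₀ (by linarith)]

/-- A multiple `g` of `f` is a multiple of `f * p` or prime to `p`, and only the squarefree ones
matter. So the terms of `coefC r (f * p)` are those of `coefC r f` with `g` prime to `p`, multiplied
by `-|p| ^ (-r)`. -/
theorem coefC_mul {r : ℕ} (hr : 2 ≤ r) {f p : F[X]} (hpm : p.Monic)
    (hp : Irreducible p) (hpf : ¬ p ∣ f) :
    coefC r (f * p) * ((Fintype.card F : ℝ) ^ (r * p.natDegree) - 1) = -coefC r f := by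
  classical
  have hcop : IsCoprime f p := ((hp.coprime_iff_not_dvd).2 hpf).symm
  have hq := two_le_card (F := F)
  have hW : (0 : ℝ) < (Fintype.card F : ℝ) ^ (r * p.natDegree) := by positivity
  set W : ℝ := (Fintype.card F : ℝ) ^ (r * p.natDegree) with hWd
  -- the part of the series over the multiples of `f` prime to `p`
  set D : ℝ := ∑' g : Mon F, if f ∣ g.1 ∧ ¬ p ∣ g.1 then mu g.1 * wt r g.1 else 0 with hD
  have h1 : coefC r f = coefC r (f * p) + D := by
    rw [coefC, coefC, hD, ← (summable_mu_wt (F := F) hr (f * p ∣ ·)).tsum_add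
      (summable_mu_wt (F := F) hr fun g => f ∣ g ∧ ¬ p ∣ g)]
    refine tsum_congr fun g => ?_
    have : f * p ∣ g.1 ↔ f ∣ g.1 ∧ p ∣ g.1 :=
      ⟨fun h => ⟨(dvd_mul_right _ _).trans h, (dvd_mul_left _ _).trans h⟩,
        fun h => hcop.mul_dvd h.1 h.2⟩
    by_cases ha : f ∣ g.1 <;> by_cases hb : p ∣ g.1 <;> simp [this, ha, hb]
  have h2 : coefC r (f * p) = -(W⁻¹ * D) := by
    let φ : Mon F → Mon F := fun g => ⟨g.1 * p, g.2.mul hpm⟩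
    have hφ : Function.Injective φ := fun g g' h => by
      have := congrArg Subtype.val h
      exact Subtype.ext (mul_right_cancel₀ hpm.ne_zero this)
    rw [coefC, ← hφ.tsum_eq, hD, ← tsum_mul_left, ← tsum_neg]
    · refine tsum_congr fun g => ?_
      have hd : f * p ∣ g.1 * p ↔ f ∣ g.1 := mul_dvd_mul_iff_right hpm.ne_zero
      have hmu : mu (g.1 * p) = if p ∣ g.1 then 0 else -mu g.1 := by
        split_ifs with h
        · refine mu_of_not_squarefree fun hs => hp.not_isUnit (hs p ?_)
          exact mul_dvd_mul_right h p
        · by_cases hs : Squarefree g.1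
          · exact mu_mul_irreducible hs hp h
          · rw [mu_of_not_squarefree hs, mu_of_not_squarefree fun h => hs h.of_mul_left, neg_zero]
      simp only [φ, hd, hmu, wt_mul r g.2.ne_zero hpm.ne_zero]
      have : wt r p = W⁻¹ := rfl
      by_cases ha : f ∣ g.1 <;> by_cases hb : p ∣ g.1 <;> simp [ha, hb, this]
      ring
    · intro g hg
      rw [Function.mem_support, ne_eq, ite_eq_right_iff, Classical.not_imp] at hg
      obtain ⟨c, hc⟩ := (dvd_mul_left p f).trans hg.1
      exact ⟨⟨c, hpm.of_mul_monic_left (hc ▸ g.2)⟩, Subtype.ext ((mul_comm c p).trans hc.symm)⟩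
  rw [h1]
  have : D = -(W * coefC r (f * p)) := by
    rw [h2]
    field_simp
  rw [this]
  ring

/-- The Euler product evaluation of the coefficient: for squarefree `f` it equals
`μ(f) / (ζ(r) Φ_r(f))`. -/
theorem coefC_mul_Phi {r : ℕ} (hr : 2 ≤ r) {f : F[X]} (hf : f.Monic) (hs : Squarefree f) :
    coefC r f * Phi r f * zeta F r = mu f := by
  refine squarefree_induction (P := fun f => coefC r f * Phi r f * zeta F r = mu f) ?_ ?_ hf hs
  · rw [Phi_one, mul_one, coefC_one_mul_zeta hr, mu_one]
  · intro f p hf hs hpm hp hpf ih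
    rw [Phi_mul hf hpm hp hpf, mu_mul_irreducible hs hp hpf, ← ih]
    linear_combination Phi r f * zeta F r * coefC_mul hr hpm hp hpf

theorem zeta_pos {r : ℕ} (hr : 2 ≤ r) : 0 < zeta F r := by
  rw [zeta_eq_tsum_wt]
  exact (summable_wt hr).tsum_pos (fun _ => (wt_pos _ _).le) ⟨1, monic_one⟩ (wt_pos _ _)

theorem Phi_pos {r : ℕ} (hr : 2 ≤ r) {f : F[X]} (hf : f.Monic) (hs : Squarefree f) :
    0 < Phi r f := by
  have h1 : (0 : ℝ) ≤ Phi r f := by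
    rw [← card_primNum hf hs]
    positivity
  refine lt_of_le_of_ne h1 fun h => ?_
  have := coefC_mul_Phi hr hf hs
  have hm := abs_mu hs
  rw [← this, ← h] at hm
  simp at hm

theorem abs_coefC {r : ℕ} (hr : 2 ≤ r) {f : F[X]} (hf : f.Monic) (hs : Squarefree f) :
    |coefC r f| = 1 / zeta F r * (Phi r f)⁻¹ := by
  have h1 := Phi_pos hr hf hs
  have h2 := zeta_pos (F := F) hr
  have := coefC_mul_Phi hr hf hs
  have hm := abs_mu hs
  rw [← this, abs_mul, abs_mul, abs_of_pos h1, abs_of_pos h2] at hm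
  field_simp
  linarith

theorem singularTerm_nonneg {r : ℕ} (hr : 2 ≤ r) (k : ℝ) {f : F[X]} (hf : f.Monic) :
    0 ≤ singularTerm r k f := by
  unfold singularTerm
  split_ifs with hs
  · exact Real.rpow_nonneg (Phi_pos hr hf hs).le _
  · exact le_rfl

theorem singularTerm_le {r : ℕ} (hr : 2 ≤ r) {k : ℝ} (hk : 1 ≤ k) {f : F[X]} (hf : f.Monic) :
    singularTerm r k f ≤ (2 * zeta F r) ^ (k - 1) * wt r f ^ (k - 1) := by
  have h2 := zeta_pos (F := F) hr
  unfold singularTerm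
  split_ifs with hs
  · have h1 := Phi_pos hr hf hs
    rw [← Real.mul_rpow (by positivity) (wt_pos r f).le, ← neg_sub k 1, Real.rpow_neg h1.le,
      ← Real.inv_rpow h1.le]
    refine Real.rpow_le_rpow (by positivity) ?_ (by linarith)
    have := abs_coefC_le hr hf
    rw [abs_coefC hr hf hs] at this
    calc (Phi r f)⁻¹ = zeta F r * (1 / zeta F r * (Phi r f)⁻¹) := by field_simp
      _ ≤ zeta F r * (2 * wt r f) := by gcongr
      _ = _ := by ring
  · have := (wt_pos r f).le
    positivity

end SingularSeries

/-! ### Balls in `F((1/t))` and approximation by fractions -/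

section Laurent

variable {F : Type*} [Field F]

theorem ofPoly_add (f g : F[X]) : ofPoly (f + g) = ofPoly f + ofPoly g := map_add _ _ _
theorem ofPoly_sub (f g : F[X]) : ofPoly (f - g) = ofPoly f - ofPoly g := map_sub _ _ _
theorem ofPoly_mul (f g : F[X]) : ofPoly (f * g) = ofPoly f * ofPoly g := map_mul _ _ _

theorem single_neg_one_pow (i : ℕ) :
    (HahnSeries.single (-1 : ℤ) (1 : F) : KInf F) ^ i = HahnSeries.single (-(i : ℤ)) 1 := by
  rw [HahnSeries.single_pow]
  simp

theorem coeff_ofPoly_mul {f : F[X]} {n : ℕ} (hn : f.natDegree < n) (α : KInf F) (j : ℤ) :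
    (ofPoly f * α).coeff j = ∑ i ∈ Finset.range n, f.coeff i * α.coeff (j + i) := by
  rw [ofPoly, aeval_eq_sum_range' hn, Finset.sum_mul, HahnSeries.coeff_sum]
  refine Finset.sum_congr rfl fun i _ => ?_
  rw [single_neg_one_pow, Algebra.smul_def, LaurentSeries.algebraMap_apply, mul_assoc,
    HahnSeries.C_mul_eq_smul, HahnSeries.coeff_smul, smul_eq_mul]
  have := HahnSeries.coeff_single_mul_add (r := (1 : F)) (x := α) (a := j + i) (b := -(i : ℤ))
  rw [show j + i + -(i : ℤ) = j by ring, one_mul] at this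
  rw [this]

theorem coeff_ofPoly_neg (f : F[X]) (n : ℕ) : (ofPoly f).coeff (-(n : ℤ)) = f.coeff n := by
  rw [← mul_one (ofPoly f), coeff_ofPoly_mul (n := max (f.natDegree + 1) (n + 1)) (by simp),
    Finset.sum_eq_single_of_mem n (by simp)]
  · simp
  · intro i _ hi
    rw [HahnSeries.coeff_one, if_neg (by omega), mul_zero]

theorem coeff_ofPoly_pos (f : F[X]) {j : ℤ} (hj : 0 < j) : (ofPoly f).coeff j = 0 := by
  rw [← mul_one (ofPoly f), coeff_ofPoly_mul (Nat.lt_succ_self _)]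
  refine Finset.sum_eq_zero fun i _ => ?_
  rw [HahnSeries.coeff_one, if_neg (by omega), mul_zero]

theorem ofPoly_injective : Function.Injective (ofPoly : F[X] → KInf F) := by
  intro f g h
  ext n
  rw [← coeff_ofPoly_neg, h, coeff_ofPoly_neg]

theorem ofPoly_ne_zero {f : F[X]} (hf : f ≠ 0) : ofPoly f ≠ 0 := by
  intro h
  exact hf (ofPoly_injective (h.trans (map_zero _).symm))

/-- The ball `|α| < q ^ (-m)`, which consists of the series whose coefficients of index at most
`m` vanish. -/
def ball (F : Type*) [Field F] (m : ℤ) : AddSubgroup (KInf F) where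
  carrier := {α | ∀ i ≤ m, α.coeff i = 0}
  add_mem' {a b} ha hb i hi := by rw [HahnSeries.coeff_add, ha i hi, hb i hi, add_zero]
  zero_mem' i _ := rfl
  neg_mem' {a} ha i hi := by rw [HahnSeries.coeff_neg, ha i hi, neg_zero]

theorem mem_ball {m : ℤ} {α : KInf F} : α ∈ ball F m ↔ ∀ i ≤ m, α.coeff i = 0 := Iff.rfl

theorem ball_anti {m n : ℤ} (h : m ≤ n) : ball F n ≤ ball F m := fun _ hα i hi => hα i (hi.trans h)

theorem mem_ball_iff_order {m : ℤ} {α : KInf F} (hα : α ≠ 0) : α ∈ ball F m ↔ m < α.order := by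
  refine ⟨fun h => ?_, fun h i hi => HahnSeries.coeff_eq_zero_of_lt_order (hi.trans_lt h)⟩
  by_contra hle
  exact HahnSeries.coeff_order_eq_zero.not.2 hα (h _ (not_lt.1 hle))

theorem ofPoly_mem_ball_zero {f : F[X]} : ofPoly f ∈ ball F 0 ↔ f = 0 := by
  refine ⟨fun h => ?_, fun h => by rw [h, ofPoly, map_zero]; exact zero_mem _⟩
  ext n
  rw [← coeff_ofPoly_neg, h _ (by omega), coeff_zero]

theorem mem_torus_iff {α : KInf F} : α ∈ torus F ↔ α ∈ ball F 0 := by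
  have h : Valued.v α < 1 ↔ Valued.v α ≤ WithZero.exp (-1 : ℤ) := by
    rw [← WithZero.exp_zero]
    by_cases h0 : Valued.v α = 0
    · simp [h0]
    · rw [← WithZero.exp_log h0, WithZero.exp_lt_exp, WithZero.exp_le_exp]
      omega
  rw [torus, Set.mem_ofPred_eq, h, LaurentSeries.valuation_le_iff_coeff_lt_eq_zero, mem_ball]
  exact forall_congr' fun i => by rw [Int.lt_iff_add_one_le]; simp

theorem coeff_ofPoly_mul_of_mem_ball {s : F[X]} (hs : s.Monic) {m : ℤ} {α : KInf F}
    (hα : α ∈ ball F (m + s.natDegree)) :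
    (ofPoly s * α).coeff (m + 1) = α.coeff (m + s.natDegree + 1) := by
  rw [coeff_ofPoly_mul (Nat.lt_succ_self _), Finset.sum_range_succ, Finset.sum_eq_zero, zero_add,
    hs.coeff_natDegree, one_mul]
  · congr 1
    ring
  · intro i hi
    rw [hα, mul_zero]
    have := Finset.mem_range.1 hi
    omega

theorem ofPoly_mul_mem_ball {s : F[X]} (hs : s.Monic) {m : ℤ} {α : KInf F} :
    ofPoly s * α ∈ ball F m ↔ α ∈ ball F (m + s.natDegree) := by
  constructor
  · intro h
    by_cases h0 : α = 0
    · rw [h0]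
      exact zero_mem _
    rw [mem_ball_iff_order h0]
    by_contra hle
    have h1 : α ∈ ball F (α.order - 1) := (mem_ball_iff_order h0).2 (by omega)
    have h2 := coeff_ofPoly_mul_of_mem_ball hs (m := α.order - s.natDegree - 1) (α := α)
      (by rwa [sub_right_comm, sub_add_cancel])
    rw [h _ (by omega)] at h2
    refine HahnSeries.coeff_order_eq_zero.not.2 h0 ?_
    rw [h2]
    congr 1
    ring
  · intro h j hj
    rw [coeff_ofPoly_mul (Nat.lt_succ_self _)]
    refine Finset.sum_eq_zero fun i hi => ?_
    rw [h, mul_zero]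
    have := Finset.mem_range.1 hi
    omega

/-- The polynomial part of a Laurent series in `1/t`. -/
def polyPart (α : KInf F) : F[X] :=
  ∑ i ∈ Finset.range ((-α.order).toNat + 1), monomial i (α.coeff (-(i : ℤ)))

theorem coeff_polyPart (α : KInf F) (n : ℕ) : (polyPart α).coeff n = α.coeff (-(n : ℤ)) := by
  rw [polyPart, finsetSum_coeff]
  simp only [coeff_monomial]
  rw [Finset.sum_ite_eq' ]
  split_ifs with h
  · rfl
  · rw [Finset.mem_range] at h
    exact (HahnSeries.coeff_eq_zero_of_lt_order (by omega)).symm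

theorem sub_polyPart_mem (α : KInf F) : α - ofPoly (polyPart α) ∈ ball F 0 := by
  intro i hi
  obtain ⟨n, rfl⟩ : ∃ n : ℕ, i = -(n : ℤ) := ⟨i.natAbs, by omega⟩
  rw [HahnSeries.coeff_sub, coeff_ofPoly_neg, coeff_polyPart, sub_self]

theorem polyPart_eq {α : KInf F} {b : F[X]} (h : α - ofPoly b ∈ ball F 0) : polyPart α = b := by
  have h1 := sub_mem h (sub_polyPart_mem α)
  rw [sub_sub_sub_cancel_left, ← ofPoly_sub, ofPoly_mem_ball_zero] at h1
  exact sub_eq_zero.1 h1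

/-- The rational function `a / s` as an element of `F((1/t))`. -/
def rat (a s : F[X]) : KInf F := ofPoly a / ofPoly s

/-- The numerator of the fraction with denominator `s` that is nearest to `α`. -/
def num (s : F[X]) (α : KInf F) : F[X] := polyPart (ofPoly s * α)

/-- The difference of `α` and the nearest fraction with denominator `s`. -/
def res (s : F[X]) (α : KInf F) : KInf F := α - rat (num s α) s

theorem ofPoly_mul_rat {a s : F[X]} (hs : s ≠ 0) : ofPoly s * rat a s = ofPoly a :=
  mul_div_cancel₀ _ (ofPoly_ne_zero hs)

theorem rat_eq_rat {a b s t : F[X]} (hs : s ≠ 0) (ht : t ≠ 0) :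
    rat a s = rat b t ↔ a * t = b * s := by
  rw [rat, rat, div_eq_div_iff (ofPoly_ne_zero hs) (ofPoly_ne_zero ht), ← ofPoly_mul, ← ofPoly_mul,
    ofPoly_injective.eq_iff]

theorem ofPoly_mul_eq {s : F[X]} (hs : s ≠ 0) (α : KInf F) :
    ofPoly s * α = ofPoly (num s α) + ofPoly s * res s α := by
  rw [res, mul_sub, ofPoly_mul_rat hs]
  ring

theorem res_mem {s : F[X]} (hs : s.Monic) (α : KInf F) : res s α ∈ ball F s.natDegree := by
  have : ofPoly s * res s α ∈ ball F 0 := by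
    rw [res, mul_sub, ofPoly_mul_rat hs.ne_zero]
    exact sub_polyPart_mem _
  simpa using (ofPoly_mul_mem_ball hs).1 this

theorem num_eq {s : F[X]} (hs : s.Monic) {a : F[X]} {α : KInf F}
    (h : α - rat a s ∈ ball F s.natDegree) : num s α = a := by
  refine polyPart_eq ?_
  rw [← ofPoly_mul_rat (a := a) hs.ne_zero, ← mul_sub]
  exact (ofPoly_mul_mem_ball hs).2 (by simpa using h)

theorem num_rat_add {s : F[X]} (hs : s.Monic) (a : F[X]) {β : KInf F}
    (h : β ∈ ball F s.natDegree) : num s (rat a s + β) = a :=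
  num_eq hs (by simpa using h)

theorem res_rat_add {s : F[X]} (hs : s.Monic) (a : F[X]) {β : KInf F}
    (h : β ∈ ball F s.natDegree) : res s (rat a s + β) = β := by
  rw [res, num_rat_add hs a h]
  ring

theorem num_add {s : F[X]} (hs : s.Monic) (α : KInf F) {δ : KInf F}
    (h : δ ∈ ball F s.natDegree) : num s (α + δ) = num s α := by
  refine num_eq hs ?_
  have := add_mem (res_mem hs α) h
  rw [res] at this
  convert this using 1
  ring

theorem res_add {s : F[X]} (hs : s.Monic) (α : KInf F) {δ : KInf F}
    (h : δ ∈ ball F s.natDegree) : res s (α + δ) = res s α + δ := by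
  rw [res, num_add hs α h, res]
  ring

/-- Distinct fractions with denominators `s` and `t` have distance at least `1 / |s t|`. -/
theorem rat_eq_of_sub_mem_ball {a b s t : F[X]} (hs : s.Monic) (ht : t.Monic)
    (h : rat a s - rat b t ∈ ball F (s.natDegree + t.natDegree : ℕ)) : rat a s = rat b t := by
  have h1 : ofPoly (s * t) * (rat a s - rat b t) = ofPoly (t * a - s * b) := by
    rw [ofPoly_sub, ofPoly_mul, ofPoly_mul, ofPoly_mul, ← ofPoly_mul_rat (a := a) hs.ne_zero,
      ← ofPoly_mul_rat (a := b) ht.ne_zero]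
    ring
  have h2 : ofPoly (s * t) * (rat a s - rat b t) ∈ ball F 0 :=
    (ofPoly_mul_mem_ball (hs.mul ht)).2 (by rwa [zero_add, hs.natDegree_mul ht])
  rw [h1, ofPoly_mem_ball_zero] at h2
  rw [rat_eq_rat hs.ne_zero ht.ne_zero]
  linear_combination h2

theorem rat_mem_torus {s : F[X]} (hs : s.Monic) {a : F[X]} (ha : a.degree < s.natDegree) :
    rat a s ∈ ball F 0 := by
  by_cases h0 : a = 0
  · rw [h0, rat, ofPoly, map_zero, zero_div]
    exact zero_mem _
  have : ofPoly s * rat a s ∈ ball F (-s.natDegree) := by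
    rw [ofPoly_mul_rat hs.ne_zero]
    intro i hi
    obtain ⟨n, rfl⟩ : ∃ n : ℕ, i = -(n : ℤ) := ⟨i.natAbs, by omega⟩
    rw [coeff_ofPoly_neg]
    refine coeff_eq_zero_of_degree_lt (ha.trans_le ?_)
    exact_mod_cast (by omega)
  simpa using (ofPoly_mul_mem_ball hs).1 this

theorem degree_num_lt {s : F[X]} (hs : s.Monic) {α : KInf F} (hα : α ∈ ball F 0) :
    (num s α).degree < s.natDegree := by
  rw [degree_lt_iff_coeff_zero]
  intro n hn
  rw [num, coeff_polyPart]
  have : ofPoly s * α ∈ ball F (-s.natDegree) := (ofPoly_mul_mem_ball hs).2 (by simpa using hα)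
  exact this _ (by omega)

theorem res_mem_ball_zero {s : F[X]} (hs : s.Monic) (α : KInf F) : res s α ∈ ball F 0 :=
  ball_anti (by omega) (res_mem hs α)

/-- The largest `m ≤ N` with `γ` in the ball of index `m`; so `q ^ depth` is the minimum of
`q ^ N` and (up to a factor `q`) of `1 / |γ|`. -/
def depth (N : ℕ) (γ : KInf F) : ℕ :=
  open Classical in Nat.findGreatest (fun m : ℕ => γ ∈ ball F m) N

theorem depth_le (N : ℕ) (γ : KInf F) : depth N γ ≤ N :=
  @Nat.findGreatest_le _ (_) _

theorem le_depth_iff {N m : ℕ} (hm : m ≤ N) {γ : KInf F} (hγ : γ ∈ ball F 0) :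
    m ≤ depth N γ ↔ γ ∈ ball F m := by
  refine ⟨fun h => ?_, fun h => @Nat.le_findGreatest _ _ (_) _ hm h⟩
  have h0 : γ ∈ ball F ((0 : ℕ) : ℤ) := hγ
  exact ball_anti (by exact_mod_cast h)
    (@Nat.findGreatest_spec _ (fun m : ℕ => γ ∈ ball F m) (_) _ (Nat.zero_le N) h0)

theorem le_depth_res {s : F[X]} (hs : s.Monic) {N : ℕ} (hN : s.natDegree ≤ N) (α : KInf F) :
    s.natDegree ≤ depth N (res s α) :=
  (le_depth_iff hN (res_mem_ball_zero hs α)).2 (res_mem hs α)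

theorem mem_ball_depth (N : ℕ) {γ : KInf F} (hγ : γ ∈ ball F 0) : γ ∈ ball F (depth N γ) :=
  (le_depth_iff (depth_le N γ) hγ).1 le_rfl

end Laurent

/-! ### The additive character -/

section Character

variable {F : Type*} [Field F] [Finite F]

theorem ringChar_ne_zero : ringChar F ≠ 0 := CharP.ringChar_ne_zero_of_finite F

/-- The additive character `charFq` of the finite field, as a bundled character. -/
def psi (F : Type*) [Field F] [Finite F] : AddChar F ℂ :=
  haveI : NeZero (ringChar F) := ⟨ringChar_ne_zero⟩
  letI : Algebra (ZMod (ringChar F)) F := ZMod.algebra F (ringChar F)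
  (ZMod.stdAddChar (N := ringChar F)).compAddMonoidHom
    (Algebra.trace (ZMod (ringChar F)) F).toAddMonoidHom

theorem charFq_eq_psi (c : F) : charFq c = psi F c := by
  have : NeZero (ringChar F) := ⟨ringChar_ne_zero⟩
  rw [charFq, psi, AddChar.compAddMonoidHom_apply, ZMod.stdAddChar_apply, ZMod.toCircle_apply]
  rfl

theorem exists_psi_ne_one : ∃ c : F, psi F c ≠ 1 := by
  have : NeZero (ringChar F) := ⟨ringChar_ne_zero⟩
  have : Fact (ringChar F).Prime := ⟨(CharP.char_is_prime_or_zero F (ringChar F)).resolve_right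
    ringChar_ne_zero⟩
  let : Algebra (ZMod (ringChar F)) F := ZMod.algebra F (ringChar F)
  obtain ⟨c, hc⟩ := Algebra.trace_surjective (ZMod (ringChar F)) F 1
  refine ⟨c, fun h => ?_⟩
  rw [psi, AddChar.compAddMonoidHom_apply] at h
  have h1 : ZMod.stdAddChar (N := ringChar F) 1 = ZMod.stdAddChar (N := ringChar F) 0 := by
    rw [AddChar.map_zero_eq_one, ← h, ← hc]
    rfl
  exact one_ne_zero (ZMod.injective_stdAddChar h1)

theorem norm_psi (c : F) : ‖psi F c‖ = 1 := AddChar.norm_apply _ _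

theorem e_eq (α : KInf F) : e α = psi F (α.coeff 1) := charFq_eq_psi _

theorem e_add (α β : KInf F) : e (α + β) = e α * e β := by
  simp only [e_eq, HahnSeries.coeff_add, AddChar.map_add_eq_mul]

theorem e_ofPoly (f : F[X]) : e (ofPoly f) = 1 := by
  rw [e_eq, coeff_ofPoly_pos f one_pos, AddChar.map_zero_eq_one]

theorem norm_e (α : KInf F) : ‖e α‖ = 1 := by
  rw [e_eq, norm_psi]

theorem e_eq_one_of_mem {α : KInf F} (h : α ∈ ball F 1) : e α = 1 := by
  rw [e_eq, h 1 le_rfl, AddChar.map_zero_eq_one]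

end Character

/-! ### Geometric sums -/

section GeometricSum

variable {F : Type*} [Field F] [Fintype F]

theorem sum_polysLT_e (m : ℕ) {β : KInf F} (hβ : β ∈ ball F 0) :
    ∑ h ∈ polysLT F m, e (ofPoly h * β) =
      open Classical in if β ∈ ball F m then (Fintype.card F : ℂ) ^ m else 0 := by
  classical
  have hco : ∀ h ∈ polysLT F m, (ofPoly h * β).coeff 1 =
      ∑ i ∈ Finset.range m, h.coeff i * β.coeff (1 + i) := fun h hh => by
    by_cases h0 : h = 0
    · rw [h0]
      simp [ofPoly]
    · exact coeff_ofPoly_mul ((natDegree_lt_iff_degree_lt h0).2 (mem_polysLT.1 hh)) _ _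
  split_ifs with hm
  · rw [Finset.sum_congr rfl fun h hh => ?_, Finset.sum_const, card_polysLT, nsmul_eq_mul, mul_one]
    · push_cast; rfl
    · rw [e_eq, hco h hh, Finset.sum_eq_zero, AddChar.map_zero_eq_one]
      intro i hi
      rw [hm _ (by have := Finset.mem_range.1 hi; omega), mul_zero]
  · obtain ⟨j, hj, hj0⟩ : ∃ j ≤ (m : ℤ), β.coeff j ≠ 0 := by
      simpa [mem_ball] using hm
    have hj1 : 0 < j := not_le.1 fun h => hj0 (hβ j h)
    obtain ⟨i, rfl⟩ : ∃ i : ℕ, j = 1 + i := ⟨(j - 1).toNat, by omega⟩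
    obtain ⟨c, hc⟩ := exists_psi_ne_one (F := F)
    set h0 : F[X] := monomial i (c / β.coeff (1 + i)) with hh0
    have hmem : h0 ∈ polysLT F m := by
      rw [mem_polysLT]
      refine (degree_monomial_le _ _).trans_lt ?_
      exact_mod_cast (by omega : i < m)
    have he : e (ofPoly h0 * β) = psi F c := by
      rw [e_eq, hco _ hmem, Finset.sum_eq_single_of_mem i (Finset.mem_range.2 (by omega))]
      · rw [hh0, coeff_monomial, if_pos rfl, div_mul_cancel₀ _ hj0]
      · intro l _ hl
        rw [hh0, coeff_monomial, if_neg (Ne.symm hl), zero_mul]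
    have hshift : ∑ h ∈ polysLT F m, e (ofPoly h * β) =
        psi F c * ∑ h ∈ polysLT F m, e (ofPoly h * β) := by
      rw [Finset.mul_sum]
      refine Finset.sum_equiv (Equiv.subRight h0) (fun h => ?_) fun h _ => ?_
      · rw [Equiv.subRight_apply, mem_polysLT, mem_polysLT]
        rw [mem_polysLT] at hmem
        refine ⟨fun h => (degree_sub_le _ _).trans_lt (max_lt h hmem), fun h => ?_⟩
        have := (degree_add_le (_ - h0) h0).trans_lt (max_lt h hmem)
        rwa [sub_add_cancel] at this
      · rw [Equiv.subRight_apply, ← he, ← e_add, ← add_mul, ← ofPoly_add, add_sub_cancel]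
    have : (1 - psi F c) * ∑ h ∈ polysLT F m, e (ofPoly h * β) = 0 := by
      rw [sub_mul, one_mul, ← hshift, sub_self]
    exact (mul_eq_zero.1 this).resolve_left (sub_ne_zero.2 (Ne.symm hc))

/-- The geometric sum `∑ e(h β)` over the monic `h` of degree at most `M`. -/
def geomSum (M : ℕ) (β : KInf F) : ℂ := ∑ h ∈ monicUpTo F M, e (ofPoly h * β)

theorem geomSum_ofPoly_add (M : ℕ) (b : F[X]) (β : KInf F) :
    geomSum M (ofPoly b + β) = geomSum M β := by
  refine Finset.sum_congr rfl fun h _ => ?_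
  rw [mul_add, ← ofPoly_mul, e_add, e_ofPoly, one_mul]

open Classical in
theorem geomSum_eq (M : ℕ) {β : KInf F} (hβ : β ∈ ball F 0) :
    geomSum M β = ∑ m ∈ Finset.range (M + 1),
      if β ∈ ball F m then (Fintype.card F : ℂ) ^ m * psi F (β.coeff (m + 1)) else 0 := by
  rw [geomSum, sum_monicUpTo]
  refine Finset.sum_congr rfl fun m _ => ?_
  rw [monicDeg_eq_image, Finset.sum_image fun _ _ _ _ h => by simpa using h]
  have : ∀ h ∈ polysLT F m, e (ofPoly (X ^ m + h) * β) =
      psi F (β.coeff (m + 1)) * e (ofPoly h * β) := fun h _ => by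
    rw [ofPoly_add, add_mul, e_add, e_eq (ofPoly (X ^ m) * β),
      coeff_ofPoly_mul (n := m + 1) (by simp), Finset.sum_range_succ, Finset.sum_eq_zero, zero_add,
      coeff_X_pow, if_pos rfl, one_mul, add_comm (1 : ℤ)]
    intro i hi
    rw [coeff_X_pow, if_neg (Finset.mem_range.1 hi).ne, zero_mul]
  rw [Finset.sum_congr rfl this, ← Finset.mul_sum, sum_polysLT_e m hβ]
  split_ifs
  · ring
  · ring

/-- The geometric sum of length `N`, completed by the geometric series over the negative degrees.
The completion makes it homogeneous under multiplication by polynomials. -/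
def compSum (N : ℕ) (γ : KInf F) : ℂ := geomSum N γ + 1 / ((Fintype.card F : ℂ) - 1)

theorem card_sub_one_ne_zero : (Fintype.card F : ℂ) - 1 ≠ 0 := by
  have := Fintype.one_lt_card (α := F)
  rw [sub_ne_zero]
  exact_mod_cast this.ne'

/-- Homogeneity of the completed sum. The first `deg s` terms of the longer geometric sum add up to
`(q ^ deg s - 1) / (q - 1)`, which the completion absorbs. -/
theorem compSum_ofPoly_mul {s : F[X]} (hs : s.Monic) (M : ℕ) {γ : KInf F}
    (hγ : γ ∈ ball F s.natDegree) :
    compSum M (ofPoly s * γ) =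
      ((Fintype.card F : ℂ) ^ s.natDegree)⁻¹ * compSum (M + s.natDegree) γ := by
  classical
  have hq0 : (Fintype.card F : ℂ) ≠ 0 := by exact_mod_cast Fintype.card_ne_zero
  have h0 : γ ∈ ball F 0 := ball_anti (by omega) hγ
  have h1 : ofPoly s * γ ∈ ball F 0 := (ofPoly_mul_mem_ball hs).2 (by simpa using hγ)
  rw [compSum, compSum, geomSum_eq M h1, geomSum_eq _ h0,
    show M + s.natDegree + 1 = s.natDegree + (M + 1) by ring,
    Finset.sum_range_add _ s.natDegree]
  have h2 : ∑ m ∈ Finset.range s.natDegree,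
      (if γ ∈ ball F m then (Fintype.card F : ℂ) ^ m * psi F (γ.coeff (m + 1)) else 0) =
      ∑ m ∈ Finset.range s.natDegree, (Fintype.card F : ℂ) ^ m := by
    refine Finset.sum_congr rfl fun m hm => ?_
    have := Finset.mem_range.1 hm
    rw [if_pos (ball_anti (by omega) hγ), hγ _ (by omega), AddChar.map_zero_eq_one, mul_one]
  have h3 : ∀ m ∈ Finset.range (M + 1),
      (if γ ∈ ball F (s.natDegree + m : ℕ) then (Fintype.card F : ℂ) ^ (s.natDegree + m) *
        psi F (γ.coeff ((s.natDegree + m : ℕ) + 1)) else 0) = (Fintype.card F : ℂ) ^ s.natDegree *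
      (if ofPoly s * γ ∈ ball F m then
        (Fintype.card F : ℂ) ^ m * psi F ((ofPoly s * γ).coeff (m + 1)) else 0) := fun m _ => by
    have : γ ∈ ball F (s.natDegree + m : ℕ) ↔ ofPoly s * γ ∈ ball F m := by
      rw [ofPoly_mul_mem_ball hs]
      push_cast
      rw [add_comm]
    rw [if_congr this rfl rfl]
    split_ifs with h
    · rw [coeff_ofPoly_mul_of_mem_ball hs ((ofPoly_mul_mem_ball hs).1 h), pow_add, mul_assoc]
      push_cast
      rw [add_comm (s.natDegree : ℤ)]
    · rw [mul_zero]
  rw [h2, Finset.sum_congr rfl h3, ← Finset.mul_sum,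
    geom_sum_eq (sub_ne_zero.1 card_sub_one_ne_zero)]
  have := card_sub_one_ne_zero (F := F)
  field_simp
  ring

/-- The value of the completed sum on the sphere `|γ| = q ^ (-m - 1)`, or on the ball of index `N`.
-/
theorem compSum_eq {N m : ℕ} (hm : m ≤ N) {γ : KInf F} (hγ : γ ∈ ball F m)
    (h : m = N ∨ γ.coeff (m + 1) ≠ 0) :
    compSum N γ = (Fintype.card F : ℂ) ^ m *
      (psi F (γ.coeff (m + 1)) + 1 / ((Fintype.card F : ℂ) - 1)) := by
  classical
  rw [compSum, geomSum_eq N (ball_anti (by omega) hγ),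
    show N + 1 = (m + 1) + (N - m) by omega, Finset.sum_range_add,
    Finset.sum_eq_zero (s := Finset.range (N - m)), add_zero, Finset.sum_range_succ, if_pos hγ]
  · have : ∀ l ∈ Finset.range m,
        (if γ ∈ ball F l then (Fintype.card F : ℂ) ^ l * psi F (γ.coeff (l + 1)) else 0) =
        (Fintype.card F : ℂ) ^ l := fun l hl => by
      have := Finset.mem_range.1 hl
      rw [if_pos (ball_anti (by omega) hγ), hγ _ (by omega), AddChar.map_zero_eq_one, mul_one]
    rw [Finset.sum_congr rfl this, geom_sum_eq (sub_ne_zero.1 card_sub_one_ne_zero)]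
    have := card_sub_one_ne_zero (F := F)
    field_simp
    ring
  · intro l hl
    have := Finset.mem_range.1 hl
    rw [if_neg fun h' => ?_]
    rcases h with h | h
    · omega
    · exact h (h' _ (by push_cast; omega))

theorem norm_compSum_le (N : ℕ) {γ : KInf F} (hγ : γ ∈ ball F 0) :
    ‖compSum N γ‖ ≤ 2 * (Fintype.card F : ℝ) ^ depth N γ := by
  have hq := two_le_card (F := F)
  rw [compSum_eq (depth_le N γ) (mem_ball_depth N hγ), norm_mul, norm_pow, Complex.norm_natCast,
    mul_comm]
  · refine mul_le_mul_of_nonneg_right ((norm_add_le _ _).trans ?_) (by positivity)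
    have : ‖1 / ((Fintype.card F : ℂ) - 1)‖ ≤ 1 := by
      have h1 : ((Fintype.card F : ℂ) - 1) = ((Fintype.card F - 1 : ℝ) : ℂ) := by push_cast; rfl
      rw [norm_div, norm_one, h1, Complex.norm_real, Real.norm_eq_abs, abs_of_nonneg (by linarith)]
      exact div_le_one_of_le₀ (by linarith) (by linarith)
    rw [norm_psi]
    linarith
  · by_contra! h
    have h1 : γ ∈ ball F ((depth N γ + 1 : ℕ) : ℤ) := fun i hi => by
      rcases (show i ≤ depth N γ ∨ i = depth N γ + 1 by push_cast at hi; omega) with h' | h'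
      · exact mem_ball_depth N hγ _ h'
      · rw [h']
        exact h.2
    have := (le_depth_iff (Nat.lt_of_le_of_ne (depth_le N γ) h.1) hγ).2 h1
    omega

end GeometricSum

/-! ### Integration of locally constant functions -/

section Measure

variable {F : Type*} [Field F]

/-- Functions on `F((1/t))` that are invariant under translation by the ball of index `L`. They
are locally constant, which settles all questions of measurability and integrability. -/
def BallInvariant {E : Type*} (L : ℕ) (H : KInf F → E) : Prop :=
  ∀ α δ : KInf F, δ ∈ ball F L → H (α + δ) = H α

theorem BallInvariant.mono {E : Type*} {L M : ℕ} {H : KInf F → E} (h : BallInvariant L H)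
    (hLM : L ≤ M) : BallInvariant M H :=
  fun α δ hδ => h α δ (ball_anti (by exact_mod_cast hLM) hδ)

theorem isOpen_ball (m : ℕ) : IsOpen (ball F m : Set (KInf F)) := by
  have : (ball F m : Set (KInf F)) = (fun α => ofPoly (X ^ m) * α) ⁻¹' torus F := by
    ext α
    rw [Set.mem_preimage, mem_torus_iff, ofPoly_mul_mem_ball (monic_X_pow m), natDegree_X_pow,
      zero_add]
    rfl
  rw [this]
  exact (isOpen_torus F).preimage (continuous_const.mul continuous_id)

theorem coe_ball_zero : (ball F (0 : ℕ) : Set (KInf F)) = torus F := by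
  ext α
  rw [mem_torus_iff]
  rfl

theorem BallInvariant.isLocallyConstant {E : Type*} {L : ℕ} {H : KInf F → E}
    (h : BallInvariant L H) : IsLocallyConstant H := by
  rw [IsLocallyConstant.iff_eventually_eq]
  intro α
  have h1 : Filter.Tendsto (fun β => β - α) (nhds α) (nhds 0) := by
    have : Continuous fun β : KInf F => β - α := continuous_id.sub continuous_const
    simpa using this.tendsto α
  filter_upwards [h1 ((isOpen_ball L).mem_nhds (zero_mem _))] with β hβ
  have := h α (β - α) hβ
  rwa [add_sub_cancel] at this

theorem BallInvariant.measurableSet {L : ℕ} {p : KInf F → Prop} (h : BallInvariant L p) :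
    MeasurableSet {α | p α} :=
  (h.isLocallyConstant.isOpen_fiber True |>.measurableSet).congr (by ext; simp)

theorem BallInvariant.setOf {L : ℕ} {p : KInf F → Prop}
    (h : ∀ α δ, δ ∈ ball F L → p α → p (α + δ)) : BallInvariant L p :=
  fun α δ hδ => propext ⟨fun hp => by
    simpa using h _ _ (neg_mem hδ) hp, h α δ hδ⟩

theorem measurableSet_ball (m : ℕ) : MeasurableSet (ball F m : Set (KInf F)) :=
  (isOpen_ball m).measurableSet

theorem pairwiseDisjoint_cells {s : F[X]} (hs : s.Monic) (A : Finset F[X]) :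
    Set.PairwiseDisjoint (A : Set F[X])
      fun a => {α : KInf F | α - rat a s ∈ ball F s.natDegree} := by
  intro a _ b _ hab
  refine Set.disjoint_left.2 fun α h1 h2 => hab ?_
  rw [← num_eq hs h1, ← num_eq hs h2]

theorem measurableSet_cell (c : KInf F) (m : ℕ) : MeasurableSet {α : KInf F | α - c ∈ ball F m} :=
  ((isOpen_ball m).preimage (continuous_id.sub continuous_const)).measurableSet

theorem ballInvariant_res_mem {s : F[X]} (hs : s.Monic) (m : ℕ) :
    BallInvariant (max s.natDegree m) fun α => res s α ∈ ball F m :=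
  BallInvariant.setOf fun α δ hδ h => by
    rw [res_add hs α (ball_anti (by exact_mod_cast le_max_left _ _) hδ)]
    exact add_mem h (ball_anti (by exact_mod_cast le_max_right _ _) hδ)

theorem measurableSet_res_mem {s : F[X]} (hs : s.Monic) (m : ℕ) :
    MeasurableSet {α | res s α ∈ ball F m} :=
  (ballInvariant_res_mem hs m).measurableSet

variable [Finite F]

instance : (haar F).IsAddHaarMeasure := Measure.isAddHaarMeasure_addHaarMeasure _

theorem BallInvariant.integrableOn {E : Type*} [NormedAddCommGroup E] {L : ℕ} {H : KInf F → E}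
    (h : BallInvariant L H) : IntegrableOn H (torus F) (haar F) :=
  h.isLocallyConstant.continuous.continuousOn.integrableOn_compact (isCompact_torus F)

theorem setIntegral_add_ball {E : Type*} [NormedAddCommGroup E] [NormedSpace ℝ E] (c : KInf F)
    (m : ℕ) (H : KInf F → E) :
    ∫ α in {α | α - c ∈ ball F m}, H α ∂(haar F) = ∫ β in ball F m, H (c + β) ∂(haar F) := by
  have := (measurePreserving_add_left (haar F) c).setIntegral_preimage_emb
    (Homeomorph.addLeft c).measurableEmbedding H {α | α - c ∈ ball F m}
  rw [← this]
  congr 2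
  ext β
  simp

theorem measure_add_ball (c : KInf F) (m : ℕ) :
    haar F {α | α - c ∈ ball F m} = haar F (ball F m) := by
  have := (measurePreserving_add_left (haar F) c).measure_preimage_emb
    (Homeomorph.addLeft c).measurableEmbedding {α | α - c ∈ ball F m}
  rw [← this]
  congr 1
  ext β
  simp

theorem real_haar_torus : (haar F).real (torus F) = 1 := by
  rw [Measure.real, haar_torus, ENNReal.toReal_one]

instance : IsFiniteMeasure ((haar F).restrict (torus F)) :=
  ⟨by rw [Measure.restrict_apply_univ, haar_torus]; exact ENNReal.one_lt_top⟩

end Measure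

/-! ### Partition of the torus around the fractions with a given denominator -/

section Partition

variable {F : Type*} [Field F] [Fintype F]

/-- The torus is the disjoint union of the balls of radius `1 / |s|` around the fractions
`a / s`. -/
theorem torus_eq_biUnion {s : F[X]} (hs : s.Monic) :
    torus F = ⋃ a ∈ polysLT F s.natDegree, {α | α - rat a s ∈ ball F s.natDegree} := by
  ext α
  simp only [mem_torus_iff, Set.mem_iUnion, Set.mem_ofPred_eq, exists_prop]
  constructor
  · intro h
    exact ⟨num s α, mem_polysLT.2 (degree_num_lt hs h), res_mem hs α⟩
  · rintro ⟨a, ha, h⟩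
    have := add_mem (ball_anti (by omega) h) (rat_mem_torus hs (mem_polysLT.1 ha))
    rwa [sub_add_cancel] at this

theorem setIntegral_torus_eq_sum {E : Type*} [NormedAddCommGroup E] [NormedSpace ℝ E] {s : F[X]}
    (hs : s.Monic) {L : ℕ} {H : KInf F → E} (hH : BallInvariant L H) :
    ∫ α in torus F, H α ∂(haar F) =
      ∑ a ∈ polysLT F s.natDegree, ∫ β in ball F s.natDegree, H (rat a s + β) ∂(haar F) := by
  have hsub : ∀ a ∈ polysLT F s.natDegree,
      {α | α - rat a s ∈ ball F s.natDegree} ⊆ torus F := fun a ha => by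
    rw [torus_eq_biUnion hs]
    exact Set.subset_biUnion_of_mem (u := fun a => {α | α - rat a s ∈ ball F s.natDegree}) ha
  rw [torus_eq_biUnion hs, integral_biUnion_finset _ (fun a _ => measurableSet_cell _ _)
    (pairwiseDisjoint_cells hs _) fun a ha => hH.integrableOn.mono_set (hsub a ha)]
  exact Finset.sum_congr rfl fun a _ => setIntegral_add_ball _ _ _

theorem real_haar_ball (m : ℕ) : (haar F).real (ball F m) = ((Fintype.card F : ℝ) ^ m)⁻¹ := by
  have h := setIntegral_torus_eq_sum (F := F) (monic_X_pow m) (L := 0) (H := fun _ => (1 : ℝ))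
    fun _ _ _ => rfl
  simp only [natDegree_X_pow, setIntegral_const, smul_eq_mul, mul_one, real_haar_torus,
    Finset.sum_const, card_polysLT, nsmul_eq_mul] at h
  push_cast at h
  exact eq_inv_of_mul_eq_one_right h.symm

theorem real_haar_cell (c : KInf F) (m : ℕ) :
    (haar F).real {α | α - c ∈ ball F m} = ((Fintype.card F : ℝ) ^ m)⁻¹ := by
  rw [Measure.real, measure_add_ball, ← real_haar_ball]
  rfl

theorem integral_le_sum_measure {ι : Type*} {t : Finset ι} {c : ι → ℝ}
    {S : ι → Set (KInf F)} (hS : ∀ i ∈ t, MeasurableSet (S i)) {L : ℕ} {H : KInf F → ℝ}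
    (hH : BallInvariant L H)
    (h : ∀ α ∈ torus F, H α ≤ ∑ i ∈ t, (S i).indicator (fun _ => c i) α) :
    ∫ α in torus F, H α ∂(haar F) ≤ ∑ i ∈ t, c i * (haar F).real (torus F ∩ S i) := by
  have hint : ∀ i ∈ t, Integrable ((S i).indicator fun _ => c i) ((haar F).restrict (torus F)) :=
    fun i hi => (integrable_const (c i)).indicator (hS i hi)
  calc ∫ α in torus F, H α ∂(haar F)
      ≤ ∫ α in torus F, ∑ i ∈ t, (S i).indicator (fun _ => c i) α ∂(haar F) :=
        setIntegral_mono_on hH.integrableOn (integrable_finsetSum _ hint)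
          (isOpen_torus F).measurableSet h
    _ = _ := by
        rw [integral_finsetSum _ hint]
        refine Finset.sum_congr rfl fun i hi => ?_
        rw [integral_indicator (hS i hi), setIntegral_const, smul_eq_mul, mul_comm,
          measureReal_restrict_apply (hS i hi), Set.inter_comm]

/-- Two numerators of fractions over `t` in a ball of index `M` differ by a polynomial of degree
less than `deg t - M`. -/
theorem polysLT_filter_card_le {t : F[X]} (ht : t.Monic) (ξ : KInf F) (M : ℕ) :
    open Classical in ((polysLT F t.natDegree).filter fun b => ξ - rat b t ∈ ball F M).card ≤
      Fintype.card F ^ (t.natDegree - M) := by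
  classical
  set Z := (polysLT F t.natDegree).filter fun b => ξ - rat b t ∈ ball F M with hZ
  rcases Z.eq_empty_or_nonempty with h0 | ⟨b₀, hb₀⟩
  · rw [h0, Finset.card_empty]
    exact Nat.zero_le _
  · rw [← card_polysLT]
    refine Finset.card_le_card_of_injOn (fun b => b₀ - b) (fun b hb => ?_)
      fun b _ b' _ h => sub_right_injective h
    rw [Finset.mem_coe, hZ, Finset.mem_filter] at hb
    rw [hZ, Finset.mem_filter] at hb₀
    have h1 := sub_mem hb.2 hb₀.2
    rw [sub_sub_sub_cancel_left, rat, rat, ← sub_div, ← ofPoly_sub, ← rat] at h1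
    have h2 : ofPoly t * rat (b₀ - b) t ∈ ball F (M - t.natDegree) :=
      (ofPoly_mul_mem_ball ht).2 (by simpa using h1)
    rw [ofPoly_mul_rat ht.ne_zero] at h2
    rw [Finset.mem_coe, mem_polysLT, degree_lt_iff_coeff_zero]
    intro n hn
    rw [← coeff_ofPoly_neg]
    exact h2 _ (by omega)

/-- Pairs of near fractions: the set of `α` that are close to a fraction with denominator `s` and
to a fraction with denominator `t`. The numbers of numerators are estimated one after the other. -/
theorem real_haar_pair_le {s t : F[X]} (hs : s.Monic) (ht : t.Monic) {M M' : ℕ} (hM : M ≤ M') :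
    (haar F).real (torus F ∩ {α | res s α ∈ ball F M ∧ res t α ∈ ball F M'}) ≤
      (Fintype.card F : ℝ) ^ (s.natDegree + (t.natDegree - M)) *
        ((Fintype.card F : ℝ) ^ M')⁻¹ := by
  classical
  have hsub : torus F ∩ {α | res s α ∈ ball F M ∧ res t α ∈ ball F M'} ⊆
      ⋃ x ∈ (polysLT F s.natDegree).sigma fun a =>
        (polysLT F t.natDegree).filter fun b => rat a s - rat b t ∈ ball F M,
        {α | α - rat x.2 t ∈ ball F M'} := by
    rintro α ⟨h1, h2, h3⟩
    rw [mem_torus_iff] at h1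
    simp only [Set.mem_iUnion, exists_prop]
    refine ⟨⟨num s α, num t α⟩, ?_, h3⟩
    rw [Finset.mem_sigma, Finset.mem_filter, mem_polysLT, mem_polysLT]
    refine ⟨degree_num_lt hs h1, degree_num_lt ht h1, ?_⟩
    have := sub_mem (ball_anti (by exact_mod_cast hM) h3) h2
    rwa [res, res, sub_sub_sub_cancel_left] at this
  refine (measureReal_mono hsub ?_).trans ((measureReal_biUnion_finset_le _ _).trans ?_)
  · refine (measure_biUnion_lt_top (Finset.finite_toSet _) fun x _ => ?_).ne
    rw [measure_add_ball]
    refine (measure_mono (show (ball F M' : Set (KInf F)) ⊆ torus F from fun α hα => ?_)).trans_lt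
      ((haar_torus F).trans_lt ENNReal.one_lt_top)
    exact mem_torus_iff.2 (ball_anti (by omega) hα)
  · rw [Finset.sum_congr rfl fun x _ => real_haar_cell _ _, Finset.sum_const, nsmul_eq_mul,
      Finset.card_sigma]
    refine mul_le_mul_of_nonneg_right ?_ (by positivity)
    calc ((∑ a ∈ polysLT F s.natDegree, ((polysLT F t.natDegree).filter
          fun b => rat a s - rat b t ∈ ball F M).card : ℕ) : ℝ)
        ≤ ((∑ a ∈ polysLT F s.natDegree, Fintype.card F ^ (t.natDegree - M) : ℕ) : ℝ) := by
          exact_mod_cast Finset.sum_le_sum fun a _ => polysLT_filter_card_le ht _ _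
      _ = _ := by
          rw [Finset.sum_const, card_polysLT, smul_eq_mul, pow_add]
          push_cast
          rfl

theorem real_haar_res_mem_le {s : F[X]} (hs : s.Monic) (M : ℕ) :
    (haar F).real (torus F ∩ {α | res s α ∈ ball F M}) ≤
      (Fintype.card F : ℝ) ^ s.natDegree * ((Fintype.card F : ℝ) ^ M)⁻¹ := by
  have h := real_haar_pair_le (monic_one (R := F)) hs (Nat.zero_le M)
  rw [natDegree_one, zero_add, Nat.sub_zero] at h
  refine (measureReal_mono (fun α hα => ?_) ?_).trans h
  · have h1 := res_mem (monic_one (R := F)) α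
    rw [natDegree_one] at h1
    exact ⟨hα.1, h1, hα.2⟩
  · exact ((measure_mono Set.inter_subset_left).trans_lt
      ((haar_torus F).trans_lt ENNReal.one_lt_top)).ne

end Partition

/-! ### Orthogonality of characters -/

section Orthogonality

variable {F : Type*} [Field F] [Fintype F]

theorem ballInvariant_e (f : F[X]) :
    BallInvariant (f.natDegree + 1) fun α : KInf F => e (ofPoly f * α) := by
  intro α δ hδ
  have : e (ofPoly f * δ) = 1 := by
    rw [e_eq, coeff_ofPoly_mul (Nat.lt_succ_self _), Finset.sum_eq_zero, AddChar.map_zero_eq_one]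
    intro i hi
    rw [hδ _ (by have := Finset.mem_range.1 hi; push_cast; omega), mul_zero]
  simp only [mul_add, e_add, this, mul_one]

theorem integral_e {f : F[X]} (hf : f ≠ 0) : ∫ α in torus F, e (ofPoly f * α) ∂(haar F) = 0 := by
  obtain ⟨c, hc⟩ := exists_psi_ne_one (F := F)
  have hc0 : c ≠ 0 := by
    rintro rfl
    exact hc (AddChar.map_zero_eq_one _)
  -- a translation that multiplies the integral by a factor different from `1`
  set τ : KInf F := HahnSeries.single 1 c / ofPoly f with hτ
  have hfτ : ofPoly f * τ = HahnSeries.single 1 c := mul_div_cancel₀ _ (ofPoly_ne_zero hf)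
  have hτm : τ ∈ ball F (0 : ℕ) := by
    have hlc : f.leadingCoeff ≠ 0 := leadingCoeff_ne_zero.2 hf
    have hm : (f * C f.leadingCoeff⁻¹).Monic := monic_mul_leadingCoeff_inv hf
    have : ofPoly (f * C f.leadingCoeff⁻¹) * τ ∈ ball F 0 := by
      rw [mul_comm f, ofPoly_mul, mul_assoc, hfτ]
      intro i hi
      rw [coeff_ofPoly_mul (n := 1) (by simp), Finset.sum_range_one,
        HahnSeries.coeff_single_of_ne (by push_cast; omega), mul_zero]
    exact ball_anti (by push_cast; omega) ((ofPoly_mul_mem_ball hm).1 this)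
  have h := setIntegral_add_ball τ 0 fun α : KInf F => e (ofPoly f * α)
  have hset : {α | α - τ ∈ ball F (0 : ℕ)} = torus F := by
    rw [← coe_ball_zero]
    ext α
    refine ⟨fun h => ?_, fun h => sub_mem h hτm⟩
    have := add_mem h hτm
    rwa [sub_add_cancel] at this
  have he : ∀ β : KInf F, e (ofPoly f * (τ + β)) = psi F c * e (ofPoly f * β) := fun β => by
    rw [mul_add, e_add, hfτ, e_eq (HahnSeries.single 1 c), HahnSeries.coeff_single_same]
  rw [hset, coe_ball_zero] at h
  simp only [he] at h
  rw [integral_const_mul] at h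
  have h2 : (1 - psi F c) * ∫ α in torus F, e (ofPoly f * α) ∂(haar F) = 0 := by
    rw [sub_mul, one_mul, ← h, sub_self]
  exact (mul_eq_zero.1 h2).resolve_left (sub_ne_zero.2 (Ne.symm hc))

/-- Parseval's identity for finite exponential sums. -/
theorem integral_norm_sq_sum (s : Finset F[X]) (c : F[X] → ℂ) :
    ∫ α in torus F, ‖∑ n ∈ s, c n * e (ofPoly n * α)‖ ^ 2 ∂(haar F) = ∑ n ∈ s, ‖c n‖ ^ 2 := by
  classical
  have hpt : ∀ α : KInf F, ((‖∑ n ∈ s, c n * e (ofPoly n * α)‖ ^ 2 : ℝ) : ℂ) =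
      ∑ n ∈ s, ∑ m ∈ s, c n * (starRingEnd ℂ) (c m) * e (ofPoly (n - m) * α) := fun α => by
    rw [Complex.ofReal_pow, ← Complex.mul_conj', map_sum, Finset.sum_mul_sum]
    refine Finset.sum_congr rfl fun n _ => Finset.sum_congr rfl fun m _ => ?_
    have h1 : e (ofPoly n * α) = e (ofPoly (n - m) * α) * e (ofPoly m * α) := by
      rw [← e_add, ← add_mul, ← ofPoly_add, sub_add_cancel]
    have h2 : e (ofPoly m * α) * (starRingEnd ℂ) (e (ofPoly m * α)) = 1 := by
      rw [Complex.mul_conj', norm_e]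
      simp
    rw [map_mul, h1]
    linear_combination (c n * (starRingEnd ℂ) (c m) * e (ofPoly (n - m) * α)) * h2
  have hI : ∀ n m : F[X], IntegrableOn
      (fun α : KInf F => c n * (starRingEnd ℂ) (c m) * e (ofPoly (n - m) * α)) (torus F) (haar F) :=
    fun n m => (ballInvariant_e (n - m)).integrableOn.const_mul _
  rw [← Complex.ofReal_inj, ← integral_complex_ofReal, integral_congr_ae (ae_of_all _ hpt),
    integral_finsetSum _ fun n _ => integrable_finsetSum _ fun m _ => hI n m]
  push_cast
  refine Finset.sum_congr rfl fun n hn => ?_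
  rw [integral_finsetSum _ fun m _ => hI n m, Finset.sum_eq_single_of_mem n hn]
  · have : ∀ α : KInf F, e (ofPoly (n - n) * α) = 1 := fun α => by
      rw [sub_self, ofPoly, map_zero, zero_mul]
      exact e_eq_one_of_mem (zero_mem _)
    simp only [this, mul_one, Complex.mul_conj', setIntegral_const, real_haar_torus, one_smul]
  · intro m _ hm
    rw [integral_const_mul, integral_e (sub_ne_zero.2 (Ne.symm hm)), mul_zero]

end Orthogonality

/-! ### Expansion of the exponential sum over fractions -/

section Expansion

variable {F : Type*} [Field F] [Fintype F]

open Classical in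
theorem sum_e_multiples {s : F[X]} (hs : s.Monic) {N : ℕ} (hN : s.natDegree ≤ N) (α : KInf F) :
    ∑ n ∈ monicUpTo F N with s ∣ n, e (ofPoly n * α) =
      geomSum (N - s.natDegree) (ofPoly s * α) := by
  have : (monicUpTo F N).filter (s ∣ ·) = (monicUpTo F (N - s.natDegree)).image (s * ·) := by
    ext n
    simp only [Finset.mem_filter, Finset.mem_image, mem_monicUpTo]
    constructor
    · rintro ⟨⟨h1, h2⟩, c, rfl⟩
      have hc := hs.of_mul_monic_left h1
      rw [hs.natDegree_mul hc] at h2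
      exact ⟨c, ⟨hc, by omega⟩, rfl⟩
    · rintro ⟨c, ⟨h1, h2⟩, rfl⟩
      refine ⟨⟨hs.mul h1, ?_⟩, dvd_mul_right _ _⟩
      rw [hs.natDegree_mul h1]
      omega
  rw [this, Finset.sum_image fun _ _ _ _ h => mul_left_cancel₀ hs.ne_zero h, geomSum]
  refine Finset.sum_congr rfl fun h _ => ?_
  rw [ofPoly_mul, mul_comm (ofPoly s), mul_assoc]

/-- The part of the exponential sum that comes from the `g` of degree `j` in the expansion
`a_r(n) = ∑ μ(g)`, the sum over `g ^ r ∣ n`. -/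
def piece (r N j : ℕ) (α : KInf F) : ℂ :=
  open Classical in
  ∑ n ∈ monicUpTo F N, ((∑ g ∈ monicDeg F j with g ^ r ∣ n, mu g : ℝ) : ℂ) * e (ofPoly n * α)

theorem piece_eq {r N j : ℕ} (hj : r * j ≤ N) (α : KInf F) :
    piece r N j α =
      ∑ g ∈ monicDeg F j, (mu g : ℂ) * geomSum (N - r * j) (ofPoly (g ^ r) * α) := by
  classical
  have h1 : ∀ g ∈ monicDeg F j, (mu g : ℂ) * geomSum (N - r * j) (ofPoly (g ^ r) * α) =
      ∑ n ∈ monicUpTo F N, if g ^ r ∣ n then (mu g : ℂ) * e (ofPoly n * α) else 0 := fun g hg => by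
    obtain ⟨hgm, rfl⟩ := mem_monicDeg.1 hg
    rw [← hgm.natDegree_pow, ← sum_e_multiples (hgm.pow r) (by rwa [hgm.natDegree_pow]),
      Finset.mul_sum, Finset.sum_filter]
  rw [Finset.sum_congr rfl h1, Finset.sum_comm, piece]
  refine Finset.sum_congr rfl fun n _ => ?_
  rw [← Finset.sum_filter, ← Finset.sum_mul]
  push_cast
  rfl

theorem G_eq_sum_piece {r : ℕ} (hr : 2 ≤ r) (N : ℕ) (α : KInf F) :
    G r N α = ∑ j ∈ Finset.range (N / r + 1), piece r N j α := by
  classical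
  unfold piece
  rw [Finset.sum_comm, G]
  refine Finset.sum_congr rfl fun n hn => ?_
  rw [← Finset.sum_mul]
  congr 1
  rw [mem_monicUpTo] at hn
  have h := sum_mu_of_pow_dvd (r := r) (n := n)
    (s := (monicUpTo F (N / r)).filter fun g => g ^ r ∣ n) (by
      intro g
      rw [Finset.mem_filter, mem_monicUpTo]
      refine ⟨fun h => ⟨h.1.1, h.2⟩, fun h => ⟨⟨h.1, ?_⟩, h.2⟩⟩
      rw [Nat.le_div_iff_mul_le (by omega), mul_comm, ← h.1.natDegree_pow]
      exact (natDegree_le_of_dvd h.2 hn.1.ne_zero).trans hn.2)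
  rw [Finset.sum_filter, sum_monicUpTo] at h
  simp only [← Finset.sum_filter] at h
  rw [← Complex.ofReal_sum, h, rFreeInd]
  split_ifs <;> simp

theorem le_of_mem_monicUpTo_div {r : ℕ} (hr : 2 ≤ r) {N : ℕ} {g : F[X]}
    (hg : g ∈ monicUpTo F (N / r)) : r * g.natDegree ≤ N := by
  have := (Nat.le_div_iff_mul_le (by omega)).1 (mem_monicUpTo.1 hg).2
  rwa [mul_comm]

theorem geomSum_eq_compSum {r N : ℕ} {g : F[X]} (hg : g.Monic) (hN : r * g.natDegree ≤ N)
    (α : KInf F) :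
    geomSum (N - r * g.natDegree) (ofPoly (g ^ r) * α) =
      (wt r g : ℂ) * compSum N (res (g ^ r) α) - 1 / ((Fintype.card F : ℂ) - 1) := by
  have hd : (g ^ r).natDegree = r * g.natDegree := hg.natDegree_pow r
  have h := compSum_ofPoly_mul (hg.pow r) (N - r * g.natDegree) (res_mem (hg.pow r) α)
  rw [hd, Nat.sub_add_cancel hN, compSum] at h
  rw [ofPoly_mul_eq (hg.pow r).ne_zero, geomSum_ofPoly_add, eq_sub_iff_add_eq, h, wt]
  push_cast
  rfl

/-- The exact expansion of the exponential sum in terms of the distances of `α` from the fractions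
with denominators `g ^ r`. -/
theorem G_eq {r : ℕ} (hr : 2 ≤ r) (N : ℕ) (α : KInf F) :
    G r N α = ∑ g ∈ monicUpTo F (N / r), (mu g : ℂ) *
      ((wt r g : ℂ) * compSum N (res (g ^ r) α) - 1 / ((Fintype.card F : ℂ) - 1)) := by
  rw [G_eq_sum_piece hr, sum_monicUpTo]
  refine Finset.sum_congr rfl fun j hj => ?_
  have hj' : r * j ≤ N := by
    have := (Nat.le_div_iff_mul_le (by omega)).1 (Nat.lt_succ_iff.1 (Finset.mem_range.1 hj))
    rwa [mul_comm]
  rw [piece_eq hj']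
  refine Finset.sum_congr rfl fun g hg => ?_
  obtain ⟨hgm, rfl⟩ := mem_monicDeg.1 hg
  rw [geomSum_eq_compSum hgm hj']

end Expansion

/-! ### Translation invariance -/

section Invariance

variable {F : Type*} [Field F]

theorem BallInvariant.comp_res {E : Type*} {L : ℕ} {H : KInf F → E} (hH : BallInvariant L H)
    {s : F[X]} (hs : s.Monic) : BallInvariant (max s.natDegree L) fun α => H (res s α) :=
  fun α δ hδ => by
    dsimp only
    rw [res_add hs α (ball_anti (by exact_mod_cast le_max_left _ _) hδ),
      hH _ _ (ball_anti (by exact_mod_cast le_max_right _ _) hδ)]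

theorem BallInvariant.comp {E E' : Type*} {L : ℕ} {H : KInf F → E} (hH : BallInvariant L H)
    (φ : E → E') : BallInvariant L fun α => φ (H α) :=
  fun α δ hδ => congrArg φ (hH α δ hδ)

theorem ballInvariant_depth (N : ℕ) : BallInvariant N (depth (F := F) N) := by
  intro α δ hδ
  classical
  have h : ∀ m : ℕ, m ≤ N → (α + δ ∈ ball F m ↔ α ∈ ball F m) := fun m hm => by
    have h := ball_anti (show (m : ℤ) ≤ N by exact_mod_cast hm) hδ
    exact ⟨fun h' => by simpa using sub_mem h' h, fun h' => add_mem h' h⟩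
  unfold depth
  clear hδ
  induction N with
  | zero => rfl
  | succ N ih =>
    rw [Nat.findGreatest_succ, Nat.findGreatest_succ, if_congr (h _ le_rfl) rfl
      (ih fun m hm => h m (by omega))]

variable [Fintype F]

theorem ballInvariant_sum_e (N : ℕ) (c : F[X] → ℂ) :
    BallInvariant (N + 1) fun α : KInf F => ∑ n ∈ monicUpTo F N, c n * e (ofPoly n * α) := by
  intro α δ hδ
  refine Finset.sum_congr rfl fun n hn => ?_
  exact congrArg (c n * ·)
    (((ballInvariant_e n).mono (Nat.succ_le_succ (mem_monicUpTo.1 hn).2)) α δ hδ)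

theorem ballInvariant_compSum (N : ℕ) : BallInvariant (N + 1) (compSum (F := F) N) := by
  intro α δ hδ
  have := ballInvariant_sum_e N (fun _ => 1) α δ hδ
  simp only [one_mul] at this
  rw [compSum, compSum, geomSum, this, geomSum]

end Invariance

/-! ### First moments -/

section Norms

variable {F : Type*} [Field F] [Fintype F]

/-- A layer-cake estimate for functions of the distance from the nearest fraction with
denominator `s`. -/
theorem integral_depth_le {s : F[X]} (hs : s.Monic) {N : ℕ} (hN : s.natDegree ≤ N) {φ : ℕ → ℝ}
    (hφ : ∀ m, 0 ≤ φ m) :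
    ∫ α in torus F, φ (depth N (res s α)) ∂(haar F) ≤
      ∑ m ∈ Finset.Icc s.natDegree N,
        φ m * ((Fintype.card F : ℝ) ^ s.natDegree * ((Fintype.card F : ℝ) ^ m)⁻¹) := by
  refine (integral_le_sum_measure (t := Finset.Icc s.natDegree N) (c := φ)
    (S := fun m => {α | res s α ∈ ball F m}) (fun m _ => measurableSet_res_mem hs m)
    (((ballInvariant_depth N).comp φ).comp_res hs) fun α _ => ?_).trans
    (Finset.sum_le_sum fun m _ => mul_le_mul_of_nonneg_left (real_haar_res_mem_le hs m) (hφ m))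
  have h0 := res_mem_ball_zero hs α
  have hmem : α ∈ {α | res s α ∈ ball F (depth N (res s α))} := mem_ball_depth N h0
  refine le_trans ?_ (Finset.single_le_sum
    (f := fun m : ℕ => ({α | res s α ∈ ball F m} : Set (KInf F)).indicator (fun _ => φ m) α)
    (fun m _ => Set.indicator_nonneg (fun _ _ => hφ m) _)
    (Finset.mem_Icc.2 ⟨le_depth_res hs hN α, depth_le N (res s α)⟩))
  have : α ∈ {β : KInf F | res s β ∈ ball F (depth N (res s α))} := hmem
  simp only [Set.indicator_of_mem this, le_refl]

theorem ballInvariant_piece (r N j : ℕ) : BallInvariant (N + 1) (piece (F := F) r N j) :=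
  ballInvariant_sum_e N _

theorem ballInvariant_G (r N : ℕ) : BallInvariant (N + 1) (G (F := F) r N) :=
  ballInvariant_sum_e N _

theorem norm_one_div_card_sub_one_le : ‖1 / ((Fintype.card F : ℂ) - 1)‖ ≤ 1 := by
  have hq := two_le_card (F := F)
  have h1 : ((Fintype.card F : ℂ) - 1) = ((Fintype.card F - 1 : ℝ) : ℂ) := by push_cast; rfl
  rw [norm_div, norm_one, h1, Complex.norm_real, Real.norm_eq_abs, abs_of_nonneg (by linarith)]
  exact div_le_one_of_le₀ (by linarith) (by linarith)

theorem norm_wt_mul_compSum_le {r N : ℕ} {g : F[X]} (hg : g.Monic) (α : KInf F) :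
    ‖(wt r g : ℂ) * compSum N (res (g ^ r) α)‖ ≤
      2 * (wt r g * (Fintype.card F : ℝ) ^ depth N (res (g ^ r) α)) := by
  rw [norm_mul, Complex.norm_real, Real.norm_eq_abs, abs_of_pos (wt_pos r g)]
  have := norm_compSum_le N (res_mem_ball_zero (hg.pow r) α)
  nlinarith [wt_pos r g]

theorem wt_eq (r : ℕ) {g : F[X]} (hg : g.Monic) :
    wt r g = ((Fintype.card F : ℝ) ^ (g ^ r).natDegree)⁻¹ := by
  rw [hg.natDegree_pow, wt]

theorem integral_wt_mul_depth_le {r N : ℕ} {g : F[X]} (hg : g.Monic) (hN : r * g.natDegree ≤ N) :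
    ∫ α in torus F, wt r g * (Fintype.card F : ℝ) ^ depth N (res (g ^ r) α) ∂(haar F) ≤ N + 1 := by
  have hq := two_le_card (F := F)
  have hd : (g ^ r).natDegree = r * g.natDegree := hg.natDegree_pow r
  have h := integral_depth_le (hg.pow r) (N := N) (by rwa [hd])
    (φ := fun m => wt r g * (Fintype.card F : ℝ) ^ m) fun m =>
      mul_nonneg (wt_pos r g).le (by positivity)
  refine h.trans ?_
  rw [Finset.sum_congr rfl fun m _ => show _ = (1 : ℝ) by rw [wt_eq r hg]; field_simp,
    Finset.sum_const, nsmul_eq_mul, mul_one, Nat.card_Icc]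
  exact_mod_cast Nat.sub_le _ _

theorem integral_norm_piece_le {r N j : ℕ} (hj : r * j ≤ N) :
    ∫ α in torus F, ‖piece r N j α‖ ∂(haar F) ≤ (Fintype.card F : ℝ) ^ j * (3 * (N + 1)) := by
  have hinv : ∀ g ∈ monicDeg F j, BallInvariant (max (g ^ r).natDegree N) fun α : KInf F =>
      wt r g * (Fintype.card F : ℝ) ^ depth N (res (g ^ r) α) := fun g hg =>
    ((ballInvariant_depth N).comp fun m => wt r g * (Fintype.card F : ℝ) ^ m).comp_res
      ((mem_monicDeg.1 hg).1.pow r)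
  have hi : ∀ g ∈ monicDeg F j, Integrable (fun α : KInf F =>
      2 * (wt r g * (Fintype.card F : ℝ) ^ depth N (res (g ^ r) α)) + 1)
      ((haar F).restrict (torus F)) := fun g hg =>
    ((hinv g hg).integrableOn.const_mul 2).add (integrable_const 1)
  calc ∫ α in torus F, ‖piece r N j α‖ ∂(haar F)
      ≤ ∫ α in torus F, ∑ g ∈ monicDeg F j,
          (2 * (wt r g * (Fintype.card F : ℝ) ^ depth N (res (g ^ r) α)) + 1) ∂(haar F) := by
        refine integral_mono (ballInvariant_piece r N j).integrableOn.norm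
          (integrable_finsetSum _ hi) fun α => ?_
        rw [piece_eq hj]
        refine (norm_sum_le _ _).trans (Finset.sum_le_sum fun g hg => ?_)
        obtain ⟨hgm, rfl⟩ := mem_monicDeg.1 hg
        rw [norm_mul, Complex.norm_real, Real.norm_eq_abs, geomSum_eq_compSum hgm hj]
        refine (mul_le_of_le_one_left (norm_nonneg _) (abs_mu_le_one g)).trans ?_
        refine (norm_sub_le _ _).trans (add_le_add (norm_wt_mul_compSum_le hgm α)
          norm_one_div_card_sub_one_le)
    _ = ∑ g ∈ monicDeg F j, (2 * (∫ α in torus F,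
          wt r g * (Fintype.card F : ℝ) ^ depth N (res (g ^ r) α) ∂(haar F)) + 1) := by
        rw [integral_finsetSum _ hi]
        refine Finset.sum_congr rfl fun g hg => ?_
        rw [integral_add ((hinv g hg).integrableOn.const_mul 2) (integrable_const 1),
          integral_const_mul, setIntegral_const, real_haar_torus, one_smul]
    _ ≤ ∑ g ∈ monicDeg F j, (3 * (N + 1) : ℝ) := by
        refine Finset.sum_le_sum fun g hg => ?_
        obtain ⟨hgm, rfl⟩ := mem_monicDeg.1 hg
        have := integral_wt_mul_depth_le hgm hj
        have : (0 : ℝ) ≤ N := Nat.cast_nonneg N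
        linarith
    _ = _ := by
        rw [Finset.sum_const, card_monicDeg, nsmul_eq_mul]
        push_cast
        rfl

end Norms

/-! ### Second moments -/

section MeanSquare

variable {F : Type*} [Field F]

theorem exists_gcd_decomposition {g : F[X]} (hg : g.Monic) (g' : F[X]) :
    ∃ d h h' : F[X], d.Monic ∧ IsCoprime h h' ∧ g = d * h ∧ g' = d * h' := by
  classical
  set d := EuclideanDomain.gcd g g' with hd
  have h0 : d ≠ 0 := fun h => hg.ne_zero (EuclideanDomain.gcd_eq_zero_iff.1 h).1
  obtain ⟨k, hk⟩ := EuclideanDomain.gcd_dvd_left g g'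
  obtain ⟨k', hk'⟩ := EuclideanDomain.gcd_dvd_right g g'
  rw [← hd] at hk hk'
  have hb := EuclideanDomain.gcd_eq_gcd_ab g g'
  rw [← hd] at hb
  have hc : C d.leadingCoeff⁻¹ * C d.leadingCoeff = 1 := by
    rw [← C_mul, inv_mul_cancel₀ (leadingCoeff_ne_zero.2 h0), C_1]
  refine ⟨d * C d.leadingCoeff⁻¹, C d.leadingCoeff * k, C d.leadingCoeff * k',
    monic_mul_leadingCoeff_inv h0, ⟨C d.leadingCoeff⁻¹ * EuclideanDomain.gcdA g g',
      C d.leadingCoeff⁻¹ * EuclideanDomain.gcdB g g', mul_left_cancel₀ h0 ?_⟩, ?_, ?_⟩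
  · linear_combination (d * (EuclideanDomain.gcdA g g' * k + EuclideanDomain.gcdB g g' * k')) * hc -
      hb - EuclideanDomain.gcdA g g' * hk - EuclideanDomain.gcdB g g' * hk'
  · linear_combination hk - d * k * hc
  · linear_combination hk' - d * k' * hc

variable [Fintype F]

theorem card_multiples_le {s : F[X]} (hs : s.Monic) (N : ℕ) :
    open Classical in (((monicUpTo F N).filter (s ∣ ·)).card : ℝ) ≤
      2 * (Fintype.card F : ℝ) ^ N * ((Fintype.card F : ℝ) ^ s.natDegree)⁻¹ := by
  classical
  have hq := two_le_card (F := F)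
  by_cases hN : s.natDegree ≤ N
  · have : ((monicUpTo F N).filter (s ∣ ·)).card ≤ (monicUpTo F (N - s.natDegree)).card := by
      refine Finset.card_le_card_of_injOn (· /ₘ s) (fun n hn => ?_) fun n hn n' hn' h => ?_
      · rw [Finset.mem_coe, Finset.mem_filter, mem_monicUpTo] at hn
        obtain ⟨⟨h1, h2⟩, c, rfl⟩ := hn
        have hc := hs.of_mul_monic_left h1
        simp only [Finset.mem_coe, mul_divByMonic_cancel_left _ hs, mem_monicUpTo]
        rw [hs.natDegree_mul hc] at h2
        exact ⟨hc, by omega⟩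
      · rw [Finset.mem_coe, Finset.mem_filter] at hn hn'
        obtain ⟨-, c, rfl⟩ := hn
        obtain ⟨-, c', rfl⟩ := hn'
        simp only [mul_divByMonic_cancel_left _ hs] at h
        rw [h]
    calc (((monicUpTo F N).filter (s ∣ ·)).card : ℝ)
        ≤ (monicUpTo F (N - s.natDegree)).card := by exact_mod_cast this
      _ ≤ 2 * (Fintype.card F : ℝ) ^ (N - s.natDegree) := card_monicUpTo_le _
      _ = _ := by rw [pow_sub₀ _ (by positivity) hN, mul_assoc]
  · rw [Finset.filter_false_of_mem fun n hn hsn => hN ?_]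
    · simp only [Finset.card_empty, Nat.cast_zero]
      positivity
    · rw [mem_monicUpTo] at hn
      exact (natDegree_le_of_dvd hsn hn.1.ne_zero).trans hn.2


theorem card_common_multiples_le {r N : ℕ} {d h h' : F[X]} (hd : d.Monic) (hh : h.Monic)
    (hh' : h'.Monic) (hc : IsCoprime h h') :
    open Classical in
    (((monicUpTo F N).filter fun n => (d * h) ^ r ∣ n ∧ (d * h') ^ r ∣ n).card : ℝ) ≤
      2 * (Fintype.card F : ℝ) ^ N * wt r (d * h * h') := by
  classical
  rw [wt_eq r ((hd.mul hh).mul hh')]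
  refine le_trans ?_ (card_multiples_le (((hd.mul hh).mul hh').pow r) N)
  refine Nat.cast_le.2 (Finset.card_le_card fun n hn => ?_)
  rw [Finset.mem_filter] at hn ⊢
  refine ⟨hn.1, ?_⟩
  obtain ⟨⟨m, rfl⟩, h2⟩ := hn.2
  rw [mul_pow, mul_pow, mul_assoc, mul_dvd_mul_iff_left (hd.pow r).ne_zero] at h2
  obtain ⟨c, rfl⟩ := ((IsCoprime.pow hc.symm : IsCoprime (h' ^ r) (h ^ r)).dvd_of_dvd_mul_left h2)
  exact ⟨c, by ring⟩

/-- The mean square of a piece. By orthogonality it is a count of common multiples of two `r`-th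
powers, which are sorted by the degree of the greatest common divisor. -/
theorem integral_norm_sq_piece_le {r : ℕ} (hr : 2 ≤ r) (N j : ℕ) :
    ∫ α in torus F, ‖piece r N j α‖ ^ 2 ∂(haar F) ≤
      4 * (Fintype.card F : ℝ) ^ N * ((Fintype.card F : ℝ) ^ ((r - 1) * j))⁻¹ := by
  classical
  have hq := two_le_card (F := F)
  set q : ℝ := (Fintype.card F : ℝ) with hqd
  have hq0 : 0 < q := by linarith
  unfold piece
  rw [integral_norm_sq_sum]
  -- the decomposition of a pair of polynomials by means of the greatest common divisor
  have hdec : ∀ x : F[X] × F[X], ∃ y : F[X] × F[X] × F[X], x ∈ monicDeg F j ×ˢ monicDeg F j →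
      y.1.Monic ∧ y.2.1.Monic ∧ y.2.2.Monic ∧ IsCoprime y.2.1 y.2.2 ∧
        x.1 = y.1 * y.2.1 ∧ x.2 = y.1 * y.2.2 := fun x => by
    by_cases hx : x ∈ monicDeg F j ×ˢ monicDeg F j
    · rw [Finset.mem_product, mem_monicDeg, mem_monicDeg] at hx
      obtain ⟨d, h, h', hd, hc, e1, e2⟩ := exists_gcd_decomposition hx.1.1 x.2
      exact ⟨⟨d, h, h'⟩, fun _ => ⟨hd, hd.of_mul_monic_left (e1 ▸ hx.1.1),
        hd.of_mul_monic_left (e2 ▸ hx.2.1), hc, e1, e2⟩⟩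
    · exact ⟨0, fun h => absurd h hx⟩
  choose δ hδ using hdec
  have hdeg : ∀ x ∈ monicDeg F j ×ˢ monicDeg F j, ∃ i ≤ j, (δ x).1.natDegree = i ∧
      (δ x).2.1.natDegree = j - i ∧ (δ x).2.2.natDegree = j - i := fun x hx => by
    obtain ⟨h1, h2, h3, -, h4, h5⟩ := hδ x hx
    rw [Finset.mem_product, mem_monicDeg, mem_monicDeg] at hx
    have e1 := hx.1.2
    have e2 := hx.2.2
    rw [h4, h1.natDegree_mul h2] at e1
    rw [h5, h1.natDegree_mul h3] at e2
    exact ⟨_, by omega, rfl, by omega, by omega⟩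
  calc ∑ n ∈ monicUpTo F N, ‖((∑ g ∈ monicDeg F j with g ^ r ∣ n, mu g : ℝ) : ℂ)‖ ^ 2
      ≤ ∑ n ∈ monicUpTo F N, ∑ x ∈ monicDeg F j ×ˢ monicDeg F j,
          (if x.1 ^ r ∣ n ∧ x.2 ^ r ∣ n then 1 else 0 : ℝ) := by
        refine Finset.sum_le_sum fun n _ => ?_
        rw [Complex.norm_real, Real.norm_eq_abs]
        have h1 : |∑ g ∈ monicDeg F j with g ^ r ∣ n, mu g| ≤
            ∑ g ∈ monicDeg F j, (if g ^ r ∣ n then 1 else 0 : ℝ) := by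
          rw [← Finset.sum_filter]
          exact (Finset.abs_sum_le_sum_abs _ _).trans (Finset.sum_le_sum fun g _ => abs_mu_le_one g)
        refine (pow_le_pow_left₀ (abs_nonneg _) h1 2).trans (le_of_eq ?_)
        rw [sq, Finset.sum_mul_sum, Finset.sum_product]
        refine Finset.sum_congr rfl fun g _ => Finset.sum_congr rfl fun g' _ => ?_
        by_cases ha : g ^ r ∣ n <;> by_cases hb : g' ^ r ∣ n <;> simp [ha, hb]
    _ = ∑ x ∈ monicDeg F j ×ˢ monicDeg F j,
          (((monicUpTo F N).filter fun n => x.1 ^ r ∣ n ∧ x.2 ^ r ∣ n).card : ℝ) := by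
        rw [Finset.sum_comm]
        refine Finset.sum_congr rfl fun x _ => ?_
        rw [← Finset.sum_filter, Finset.sum_const, nsmul_eq_mul, mul_one]
    _ ≤ ∑ x ∈ monicDeg F j ×ˢ monicDeg F j,
          2 * q ^ N * (q ^ (r * (2 * j - (δ x).1.natDegree)))⁻¹ := by
        refine Finset.sum_le_sum fun x hx => ?_
        obtain ⟨h1, h2, h3, h4, h5, h6⟩ := hδ x hx
        obtain ⟨i, hi, e1, e2, e3⟩ := hdeg x hx
        have := card_common_multiples_le (r := r) (N := N) h1 h2 h3 h4
        rw [Finset.mem_product, mem_monicDeg] at hx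
        rw [← h5, ← h6, wt, hx.1.1.natDegree_mul h3, hx.1.2, e3] at this
        rwa [e1, show 2 * j - i = j + (j - i) by omega]
    _ = ∑ i ∈ Finset.range (j + 1), ∑ x ∈ monicDeg F j ×ˢ monicDeg F j with
          (δ x).1.natDegree = i, 2 * q ^ N * (q ^ (r * (2 * j - i)))⁻¹ := by
        rw [← Finset.sum_fiberwise_of_maps_to (t := Finset.range (j + 1))
          (g := fun x => (δ x).1.natDegree) fun x hx => ?_]
        · refine Finset.sum_congr rfl fun i _ => Finset.sum_congr rfl fun x hx => ?_
          rw [(Finset.mem_filter.1 hx).2]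
        · obtain ⟨i, hi, e1, -⟩ := hdeg x hx
          rw [e1, Finset.mem_range]
          omega
    _ ≤ ∑ i ∈ Finset.range (j + 1),
          2 * q ^ N * (q ^ ((r - 1) * j))⁻¹ * (q ^ (j - i))⁻¹ := by
        refine Finset.sum_le_sum fun i hi => ?_
        have hi' : i ≤ j := Nat.lt_succ_iff.1 (Finset.mem_range.1 hi)
        have hcard : ((monicDeg F j ×ˢ monicDeg F j).filter fun x => (δ x).1.natDegree = i).card ≤
            (monicDeg F i ×ˢ monicDeg F (j - i) ×ˢ monicDeg F (j - i)).card := by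
          refine Finset.card_le_card_of_injOn δ (fun x hx => ?_) fun x hx x' hx' h => ?_
          · rw [Finset.mem_coe, Finset.mem_filter] at hx
            obtain ⟨h1, h2, h3, -⟩ := hδ x hx.1
            obtain ⟨i', -, e1, e2, e3⟩ := hdeg x hx.1
            rw [hx.2] at e1
            subst e1
            simp only [Finset.mem_coe, Finset.mem_product, mem_monicDeg]
            exact ⟨⟨h1, hx.2⟩, ⟨h2, e2⟩, h3, e3⟩
          · rw [Finset.mem_coe, Finset.mem_filter] at hx hx'
            obtain ⟨-, -, -, -, h5, h6⟩ := hδ x hx.1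
            obtain ⟨-, -, -, -, h5', h6'⟩ := hδ x' hx'.1
            exact Prod.ext (by rw [h5, h5', h]) (by rw [h6, h6', h])
        rw [Finset.card_product, Finset.card_product, card_monicDeg, card_monicDeg, ← pow_add,
          ← pow_add] at hcard
        rw [Finset.sum_const, nsmul_eq_mul]
        calc _ ≤ q ^ (i + (j - i + (j - i))) * (2 * q ^ N * (q ^ (r * (2 * j - i)))⁻¹) := by
              refine mul_le_mul_of_nonneg_right ?_ (by positivity)
              rw [hqd]
              exact_mod_cast hcard
          _ = 2 * q ^ N * (q ^ ((r - 1) * (2 * j - i)))⁻¹ := by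
              have : r * (2 * j - i) = (r - 1) * (2 * j - i) + (i + (j - i + (j - i))) := by
                obtain ⟨m, rfl⟩ : ∃ m, r = m + 1 := ⟨r - 1, by omega⟩
                rw [Nat.add_sub_cancel, add_mul, one_mul]
                omega
              rw [this, pow_add q ((r - 1) * (2 * j - i)), mul_inv]
              field_simp
          _ ≤ _ := by
              rw [mul_assoc (2 * q ^ N), ← mul_inv, ← pow_add]
              refine mul_le_mul_of_nonneg_left (inv_anti₀ (by positivity)
                (pow_le_pow_right₀ (by linarith) ?_)) (by positivity)
              obtain ⟨m, rfl⟩ : ∃ m, r = m + 2 := ⟨r - 2, by omega⟩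
              obtain ⟨l, rfl⟩ : ∃ l, j = i + l := ⟨j - i, by omega⟩
              rw [show m + 2 - 1 = m + 1 by omega, show 2 * (i + l) - i = i + l + l by omega,
                show i + l - i = l by omega]
              nlinarith [Nat.zero_le (m * l)]
    _ ≤ _ := by
        have h1 := Finset.sum_range_reflect (fun i => (q ^ i)⁻¹) (j + 1)
        simp only [Nat.add_sub_cancel] at h1
        have h2 := sum_inv_pow_le_two_mul hq 0 (Finset.range (j + 1)) fun _ _ => Nat.zero_le _
        rw [pow_zero, inv_one, mul_one] at h2
        rw [← Finset.mul_sum, h1]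
        calc _ ≤ 2 * q ^ N * (q ^ ((r - 1) * j))⁻¹ * 2 :=
              mul_le_mul_of_nonneg_left h2 (by positivity)
          _ = _ := by ring

end MeanSquare

/-! ### The moment of order `1 + 1 / r` -/

section LowMoment

variable {F : Type*} [Field F] [Fintype F]

/-- Interpolation between the first and the second moment, with a free parameter. -/
theorem rpow_le_interpolation {κ y l : ℝ} (h1 : 1 ≤ κ) (h2 : κ ≤ 2) (hy : 0 ≤ y) (hl : 0 < l) :
    y ^ κ ≤ l ^ (κ - 1) * y + l ^ (κ - 2) * y ^ 2 := by
  rcases hy.eq_or_lt with rfl | hy0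
  · rw [Real.zero_rpow (by linarith)]
    simp
  rcases le_total y l with h | h
  · have : y ^ κ = y ^ (κ - 1) * y := by
      rw [← Real.rpow_add_one hy0.ne', sub_add_cancel]
    rw [this]
    have := Real.rpow_le_rpow hy h (show 0 ≤ κ - 1 by linarith)
    have h3 : 0 ≤ l ^ (κ - 2) * y ^ 2 := by positivity
    nlinarith
  · have : y ^ κ = y ^ (κ - 2) * y ^ 2 := by
      rw [← Real.rpow_natCast y 2, ← Real.rpow_add hy0]
      norm_num
    rw [this]
    have := Real.rpow_le_rpow_of_nonpos hl h (show κ - 2 ≤ 0 by linarith)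
    have h3 : 0 ≤ l ^ (κ - 1) * y := by positivity
    nlinarith [sq_nonneg y]

/-- The first moment of the piece is at most `(N + 1) q ^ j` and its second moment is at most
`q ^ (N - (r - 1) j)`, up to constants. Interpolation at the scale `q ^ (N - r j)` gives a bound
that does not depend on `j`. -/
theorem integral_rpow_piece_le {r : ℕ} (hr : 2 ≤ r) {N j : ℕ} (hj : r * j ≤ N) :
    ∫ α in torus F, ‖piece r N j α‖ ^ (1 + 1 / (r : ℝ)) ∂(haar F) ≤
      (3 * N + 7) * (Fintype.card F : ℝ) ^ ((N : ℝ) / r) := by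
  have hq := two_le_card (F := F)
  set q : ℝ := (Fintype.card F : ℝ) with hqd
  have hq0 : 0 < q := by linarith
  have hr0 : (0 : ℝ) < r := by exact_mod_cast (by omega : 0 < r)
  set l : ℝ := q ^ (N - r * j) with hl
  have hl0 : 0 < l := by positivity
  have hinv := ballInvariant_piece (F := F) r N j
  have i1 : IntegrableOn (fun α : KInf F => l ^ (1 + 1 / (r : ℝ) - 1) * ‖piece r N j α‖)
      (torus F) (haar F) := (hinv.comp fun z => l ^ (1 + 1 / (r : ℝ) - 1) * ‖z‖).integrableOn
  have i2 : IntegrableOn (fun α : KInf F => l ^ (1 + 1 / (r : ℝ) - 2) * ‖piece r N j α‖ ^ 2)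
      (torus F) (haar F) := (hinv.comp fun z => l ^ (1 + 1 / (r : ℝ) - 2) * ‖z‖ ^ 2).integrableOn
  have hr1 : 1 / (r : ℝ) ≤ 1 := by
    rw [div_le_one hr0]
    exact_mod_cast (by omega : 1 ≤ r)
  have h1 : ∫ α in torus F, ‖piece r N j α‖ ^ (1 + 1 / (r : ℝ)) ∂(haar F) ≤
      l ^ (1 + 1 / (r : ℝ) - 1) * (q ^ j * (3 * (N + 1))) +
      l ^ (1 + 1 / (r : ℝ) - 2) * (4 * q ^ N * (q ^ ((r - 1) * j))⁻¹) := by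
    calc _ ≤ ∫ α in torus F, (l ^ (1 + 1 / (r : ℝ) - 1) * ‖piece r N j α‖ +
          l ^ (1 + 1 / (r : ℝ) - 2) * ‖piece r N j α‖ ^ 2) ∂(haar F) := by
          refine integral_mono (hinv.comp fun z => ‖z‖ ^ (1 + 1 / (r : ℝ))).integrableOn
            (i1.add i2) fun α => ?_
          exact rpow_le_interpolation (by linarith [one_div_pos.2 hr0]) (by linarith)
            (norm_nonneg _) hl0
      _ ≤ _ := by
          rw [integral_add i1 i2, integral_const_mul, integral_const_mul]
          exact add_le_add
            (mul_le_mul_of_nonneg_left (integral_norm_piece_le hj) (by positivity))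
            (mul_le_mul_of_nonneg_left (integral_norm_sq_piece_le hr N j) (by positivity))
  refine h1.trans (le_of_eq ?_)
  have e1 : l ^ (1 + 1 / (r : ℝ) - 1) * q ^ j = q ^ ((N : ℝ) / r) := by
    rw [hl, ← Real.rpow_natCast, ← Real.rpow_natCast, ← Real.rpow_mul hq0.le, ← Real.rpow_add hq0]
    congr 1
    push_cast [Nat.cast_sub hj]
    field_simp
    ring
  have e2 : l ^ (1 + 1 / (r : ℝ) - 2) * (q ^ N * (q ^ ((r - 1) * j))⁻¹) = q ^ ((N : ℝ) / r) := by
    rw [hl, ← Real.rpow_natCast, ← Real.rpow_natCast, ← Real.rpow_natCast, ← Real.rpow_neg hq0.le,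
      ← Real.rpow_mul hq0.le, ← Real.rpow_add hq0, ← Real.rpow_add hq0]
    congr 1
    push_cast [Nat.cast_sub hj, Nat.cast_sub (show 1 ≤ r by omega)]
    field_simp
    ring
  linear_combination (3 * (N + 1) : ℝ) * e1 + 4 * e2

/-- The moment of the critical order `1 + 1 / r` is as small as the number of denominators allows,
up to a polynomial factor. -/
theorem integral_rpow_G_le {r : ℕ} (hr : 2 ≤ r) (N : ℕ) :
    ∫ α in torus F, ‖G r N α‖ ^ (1 + 1 / (r : ℝ)) ∂(haar F) ≤
      7 * (N + 1) ^ 3 * (Fintype.card F : ℝ) ^ ((N : ℝ) / r) := by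
  have hq := two_le_card (F := F)
  set q : ℝ := (Fintype.card F : ℝ) with hqd
  have hq0 : 0 < q := by linarith
  have hr0 : (0 : ℝ) < r := by exact_mod_cast (by omega : 0 < r)
  have hr1 : 1 / (r : ℝ) ≤ 1 := by
    rw [div_le_one hr0]
    exact_mod_cast (by omega : 1 ≤ r)
  have hr2 : 0 < 1 / (r : ℝ) := one_div_pos.2 hr0
  have hNr : ((N / r : ℕ) : ℝ) + 1 ≤ N + 1 := by
    have : N / r ≤ N := Nat.div_le_self _ _
    exact_mod_cast Nat.succ_le_succ this
  have hi : ∀ j ∈ Finset.range (N / r + 1), IntegrableOn (fun α : KInf F =>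
      (N + 1 : ℝ) * ‖piece r N j α‖ ^ (1 + 1 / (r : ℝ))) (torus F) (haar F) := fun j _ =>
    ((ballInvariant_piece r N j).comp fun z => (N + 1 : ℝ) * ‖z‖ ^ (1 + 1 / (r : ℝ))).integrableOn
  calc _ ≤ ∫ α in torus F, ∑ j ∈ Finset.range (N / r + 1),
        (N + 1 : ℝ) * ‖piece r N j α‖ ^ (1 + 1 / (r : ℝ)) ∂(haar F) := by
        refine integral_mono
          ((ballInvariant_G r N).comp fun z => ‖z‖ ^ (1 + 1 / (r : ℝ))).integrableOn
          (integrable_finsetSum _ hi) fun α => ?_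
        simp only
        rw [G_eq_sum_piece hr, ← Finset.mul_sum]
        calc ‖∑ j ∈ Finset.range (N / r + 1), piece r N j α‖ ^ (1 + 1 / (r : ℝ))
            ≤ (∑ j ∈ Finset.range (N / r + 1), |‖piece r N j α‖|) ^ (1 + 1 / (r : ℝ)) := by
              simp only [abs_norm]
              exact Real.rpow_le_rpow (norm_nonneg _) (norm_sum_le _ _) (by linarith)
          _ ≤ _ := Real.rpow_sum_le_const_mul_sum_rpow _ _ (by linarith)
          _ ≤ _ := by
              simp only [abs_norm, Finset.card_range]
              refine mul_le_mul_of_nonneg_right ?_ (Finset.sum_nonneg fun _ _ => by positivity)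
              rw [add_sub_cancel_left]
              push_cast
              calc ((N / r : ℕ) + 1 : ℝ) ^ (1 / (r : ℝ)) ≤ (N + 1 : ℝ) ^ (1 / (r : ℝ)) :=
                    Real.rpow_le_rpow (by positivity) hNr hr2.le
                _ ≤ (N + 1 : ℝ) ^ (1 : ℝ) :=
                    Real.rpow_le_rpow_of_exponent_le (by linarith [Nat.cast_nonneg (α := ℝ) N]) hr1
                _ = _ := Real.rpow_one _
    _ ≤ ∑ j ∈ Finset.range (N / r + 1), (N + 1 : ℝ) * ((3 * N + 7) * q ^ ((N : ℝ) / r)) := by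
        rw [integral_finsetSum _ hi]
        refine Finset.sum_le_sum fun j hj => ?_
        rw [integral_const_mul]
        refine mul_le_mul_of_nonneg_left (integral_rpow_piece_le hr ?_) (by positivity)
        have := (Nat.le_div_iff_mul_le (by omega)).1 (Nat.lt_succ_iff.1 (Finset.mem_range.1 hj))
        rwa [mul_comm]
    _ ≤ _ := by
        rw [Finset.sum_const, Finset.card_range, nsmul_eq_mul]
        push_cast
        have hN : (0 : ℝ) ≤ N := Nat.cast_nonneg N
        have hp : 0 < q ^ ((N : ℝ) / r) := by positivity
        calc ((N / r : ℕ) + 1 : ℝ) * ((N + 1) * ((3 * N + 7) * q ^ ((N : ℝ) / r)))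
            ≤ (N + 1) * ((N + 1) * ((7 * (N + 1)) * q ^ ((N : ℝ) / r))) := by
              gcongr
              linarith
          _ = _ := by ring

end LowMoment

/-! ### Approximation of the exponential sum -/

section Approximation

variable {F : Type*} [Field F]

/-- The fraction with denominator `s` that is nearest to `α`. -/
def near (s : F[X]) (α : KInf F) : KInf F := rat (num s α) s

theorem res_eq_sub_near (s : F[X]) (α : KInf F) : res s α = α - near s α := rfl

/-- Repulsion: two different fractions with denominators `s` and `t` cannot both be closer to `α`
than `1 / |s t|`. -/
theorem lt_of_near_ne {s t : F[X]} (hs : s.Monic) (ht : t.Monic) {α : KInf F}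
    (hne : near s α ≠ near t α) {m : ℕ} (h1 : res s α ∈ ball F m) (h2 : res t α ∈ ball F m) :
    m < s.natDegree + t.natDegree := by
  by_contra hm
  refine hne (rat_eq_of_sub_mem_ball hs ht ?_)
  have := sub_mem h2 h1
  rw [res, res, sub_sub_sub_cancel_left] at this
  exact ball_anti (by exact_mod_cast not_lt.1 hm) this

/-- The fractions with denominator `g ^ r` meet a fraction with primitive numerator over `f ^ r`
only for multiples `g` of `f`. -/
theorem dvd_of_rat_eq {r : ℕ} {f g a b : F[X]} (hf : f.Monic) (hs : Squarefree f) (ha : Prim r f a)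
    (hg : g.Monic) (h : rat b (g ^ r) = rat a (f ^ r)) : f ∣ g := by
  rw [rat_eq_rat (hg.pow r).ne_zero (hf.pow r).ne_zero] at h
  exact ha.dvd hf hs h.symm

/-- A fraction over `f ^ r` that is very close to `α` is also the nearest fraction over `g ^ r` for
the multiples `g` of `f`. -/
theorem near_eq_of_dvd {r : ℕ} {f g a : F[X]} (hg : g.Monic) (hfg : f ∣ g) {α : KInf F}
    (h : α - rat a (f ^ r) ∈ ball F (r * g.natDegree : ℕ)) :
    near (g ^ r) α = rat a (f ^ r) := by
  obtain ⟨c, rfl⟩ := hfg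
  have hf0 : f ≠ 0 := left_ne_zero_of_mul hg.ne_zero
  have he : rat a (f ^ r) = rat (a * c ^ r) ((f * c) ^ r) := by
    rw [rat_eq_rat (pow_ne_zero r hf0) (hg.pow r).ne_zero, mul_pow]
    ring
  rw [he] at h ⊢
  rw [near, num_eq (hg.pow r) (by rwa [hg.natDegree_pow])]

/-- The major arcs. The point `α` is active for `f` if the nearest fraction with denominator
`f ^ r` has a primitive numerator and a distance of less than `q ^ (x - N) |f| ^ (-r)`. -/
def Active (r N x : ℕ) (f : F[X]) (α : KInf F) : Prop :=
  Prim r f (num (f ^ r) α) ∧ res (f ^ r) α ∈ ball F (N - x + r * f.natDegree : ℕ)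

theorem eq_of_near_eq {r : ℕ} {f f' a a' : F[X]} (hf : f.Monic) (hs : Squarefree f)
    (hf' : f'.Monic) (hs' : Squarefree f') (ha : Prim r f a) (ha' : Prim r f' a')
    (h : rat a (f ^ r) = rat a' (f' ^ r)) : f = f' :=
  eq_of_monic_of_associated hf hf'
    (associated_of_dvd_dvd (dvd_of_rat_eq hf hs ha hf' h.symm) (dvd_of_rat_eq hf' hs' ha' hf h))

/-- The major arcs of different `f` are disjoint. -/
theorem Active.unique {r N x : ℕ} (hx : 2 * x ≤ N) {f f' : F[X]} (hf : f.Monic)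
    (hs : Squarefree f) (hf' : f'.Monic) (hs' : Squarefree f') (hfx : r * f.natDegree ≤ x)
    (hfx' : r * f'.natDegree ≤ x) {α : KInf F} (h : Active r N x f α) (h' : Active r N x f' α) :
    f = f' := by
  refine eq_of_near_eq hf hs hf' hs' h.1 h'.1 ?_
  by_contra hne
  have h1 := lt_of_near_ne (hf.pow r) (hf'.pow r) (α := α) hne
    (m := N - x + min (r * f.natDegree) (r * f'.natDegree))
    (ball_anti (by exact_mod_cast (by omega)) h.2) (ball_anti (by exact_mod_cast (by omega)) h'.2)
  rw [hf.natDegree_pow, hf'.natDegree_pow] at h1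
  omega

variable [Fintype F]

/-- The squarefree monic polynomials `f` with `|f| ^ r ≤ q ^ x`. -/
def majorIndex (F : Type*) [Field F] [Fintype F] (r x : ℕ) : Finset F[X] :=
  open Classical in (monicUpTo F (x / r)).filter Squarefree

theorem mem_majorIndex {r x : ℕ} (hr : 2 ≤ r) {f : F[X]} :
    f ∈ majorIndex F r x ↔ f.Monic ∧ Squarefree f ∧ r * f.natDegree ≤ x := by
  classical
  rw [majorIndex, Finset.mem_filter, mem_monicUpTo, Nat.le_div_iff_mul_le (by omega), mul_comm r]
  tauto

/-- The main term: near the fractions with primitive numerator over `f ^ r`, the exponential sum is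
approximated by `coefC r f` times the completed geometric sum. -/
def approx (r N x : ℕ) (α : KInf F) : ℂ :=
  open Classical in ∑ f ∈ majorIndex F r x,
    if Active r N x f α then (coefC r f : ℂ) * compSum N (res (f ^ r) α) else 0

theorem approx_eq {r N x : ℕ} (hr : 2 ≤ r) (hx : 2 * x ≤ N) {f : F[X]}
    (hf : f ∈ majorIndex F r x) {α : KInf F} (h : Active r N x f α) :
    approx r N x α = (coefC r f : ℂ) * compSum N (res (f ^ r) α) := by
  rw [approx, Finset.sum_eq_single_of_mem f hf, if_pos h]
  intro f' hf' hne
  rw [mem_majorIndex hr] at hf hf'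
  exact if_neg fun h' => hne (Active.unique hx hf'.1 hf'.2.1 hf.1 hf.2.1 hf'.2.2 hf.2.2 h' h)

theorem approx_eq_zero {r N x : ℕ} {α : KInf F}
    (h : ∀ f ∈ majorIndex F r x, ¬ Active r N x f α) : approx r N x α = 0 :=
  Finset.sum_eq_zero fun f hf => if_neg (h f hf)

theorem abs_coefC_sub_le {r : ℕ} (hr : 2 ≤ r) {f : F[X]} {s : Finset F[X]} {Q : ℕ}
    (hs : ∀ g ∈ s, g.Monic ∧ f ∣ g) (hQ : ∀ g : F[X], g.Monic → f ∣ g → g ∉ s → Q ≤ g.natDegree) :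
    |coefC r f - ∑ g ∈ s, mu g * wt r g| ≤ 2 * ((Fintype.card F : ℝ) ^ ((r - 1) * Q))⁻¹ := by
  classical
  have := abs_tsum_sub_sum_le (h := fun g => if f ∣ g then mu g * wt r g else 0)
    (summable_mu_wt (F := F) hr (f ∣ ·)) (s := s) (fun g hg => (hs g hg).1)
    (c := 2 * ((Fintype.card F : ℝ) ^ ((r - 1) * Q))⁻¹) (fun u hu => by
      calc ∑ g ∈ u, |if f ∣ g then mu g * wt r g else 0|
          = ∑ g ∈ u with f ∣ g, |mu g * wt r g| := by
            rw [Finset.sum_filter]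
            exact Finset.sum_congr rfl fun g _ => by split_ifs <;> simp
        _ ≤ ∑ g ∈ u with f ∣ g, wt r g := Finset.sum_le_sum fun g _ => abs_mu_mul_wt_le r g
        _ ≤ _ := sum_wt_le hr fun g hg => by
            rw [Finset.mem_filter] at hg
            exact ⟨(hu g hg.1).1, hQ g (hu g hg.1).1 hg.2 (hu g hg.1).2⟩)
  rw [Finset.sum_congr rfl fun g hg => if_pos (hs g hg).2] at this
  exact this

/-- The terms of the expansion that belong to the same fraction `ξ` share the factor
`compSum N (α - ξ)`. -/
theorem sum_near_eq {r N : ℕ} (s : Finset F[X]) {ξ : KInf F} {α : KInf F}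
    (hs : ∀ g ∈ s, near (g ^ r) α = ξ) :
    ∑ g ∈ s, (mu g : ℂ) * ((wt r g : ℂ) * compSum N (res (g ^ r) α)) =
      ((∑ g ∈ s, mu g * wt r g : ℝ) : ℂ) * compSum N (α - ξ) := by
  push_cast
  rw [Finset.sum_mul]
  refine Finset.sum_congr rfl fun g hg => ?_
  rw [res_eq_sub_near, hs g hg]
  ring

theorem norm_term_le {r N : ℕ} {g : F[X]} (hg : g.Monic) (α : KInf F) :
    ‖(mu g : ℂ) * ((wt r g : ℂ) * compSum N (res (g ^ r) α))‖ ≤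
      2 * (wt r g * (Fintype.card F : ℝ) ^ depth N (res (g ^ r) α)) := by
  rw [norm_mul, Complex.norm_real, Real.norm_eq_abs]
  exact (mul_le_of_le_one_left (norm_nonneg _) (abs_mu_le_one g)).trans
    (norm_wt_mul_compSum_le hg α)

/-- The expansion of the exponential sum up to the contribution of the completing terms. -/
theorem norm_G_sub_le {r : ℕ} (hr : 2 ≤ r) (N : ℕ) (α : KInf F) :
    ‖G r N α - ∑ g ∈ monicUpTo F (N / r),
      (mu g : ℂ) * ((wt r g : ℂ) * compSum N (res (g ^ r) α))‖ ≤
        2 * (Fintype.card F : ℝ) ^ (N / r) := by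
  rw [G_eq hr, ← Finset.sum_sub_distrib]
  refine (norm_sum_le _ _).trans ?_
  calc ∑ g ∈ monicUpTo F (N / r), ‖(mu g : ℂ) * ((wt r g : ℂ) * compSum N (res (g ^ r) α) -
        1 / ((Fintype.card F : ℂ) - 1)) - (mu g : ℂ) * ((wt r g : ℂ) * compSum N (res (g ^ r) α))‖
      ≤ ∑ g ∈ monicUpTo F (N / r), (1 : ℝ) := by
        refine Finset.sum_le_sum fun g _ => ?_
        rw [mul_sub, sub_sub_cancel_left, norm_neg, norm_mul, Complex.norm_real, Real.norm_eq_abs]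
        exact mul_le_one₀ (abs_mu_le_one g) (norm_nonneg _) norm_one_div_card_sub_one_le
    _ ≤ _ := by
        rw [Finset.sum_const, nsmul_eq_mul, mul_one]
        exact card_monicUpTo_le _

/-- The error of the approximation on a major arc, in terms of the other fractions. -/
theorem norm_G_sub_approx_le_of_active {r N x : ℕ} (hr : 2 ≤ r) (hx : 2 * x ≤ N) {f : F[X]}
    (hf : f ∈ majorIndex F r x) {α : KInf F} (h : Active r N x f α) :
    open Classical in
    ‖G r N α - approx r N x α‖ ≤ 6 * (Fintype.card F : ℝ) ^ (N / r) +
      ∑ g ∈ monicUpTo F (N / r) with near (g ^ r) α ≠ near (f ^ r) α,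
        2 * (wt r g * (Fintype.card F : ℝ) ^ depth N (res (g ^ r) α)) := by
  classical
  have hq := two_le_card (F := F)
  set q : ℝ := (Fintype.card F : ℝ) with hqd
  have hq0 : 0 < q := by linarith
  obtain ⟨hfm, hfs, hfx⟩ := (mem_majorIndex hr).1 hf
  set S := (monicUpTo F (N / r)).filter fun g => near (g ^ r) α = near (f ^ r) α with hS
  set β := res (f ^ r) α with hβ
  have hβ0 : β ∈ ball F 0 := res_mem_ball_zero (hfm.pow r) α
  set d := depth N β with hd
  have hdN : d ≤ N := depth_le N β
  have hSd : ∀ g ∈ S, g.Monic ∧ f ∣ g := fun g hg => by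
    rw [hS, Finset.mem_filter, mem_monicUpTo] at hg
    exact ⟨hg.1.1, dvd_of_rat_eq hfm hfs h.1 hg.1.1 hg.2⟩
  have htail := abs_coefC_sub_le hr (f := f) hSd (Q := d / r + 1) (fun g hg hfg hgS => by
    by_contra hlt
    have h1 : g.natDegree ≤ d / r := by omega
    have h2 : r * g.natDegree ≤ d := by
      rw [mul_comm]
      exact (Nat.le_div_iff_mul_le (by omega)).1 h1
    refine hgS (Finset.mem_filter.2 ⟨mem_monicUpTo.2 ⟨hg, h1.trans (Nat.div_le_div_right hdN)⟩, ?_⟩)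
    exact near_eq_of_dvd hg hfg (ball_anti (by exact_mod_cast h2) (mem_ball_depth N hβ0)))
  have hsplit := Finset.sum_filter_add_sum_filter_not (monicUpTo F (N / r))
    (fun g => near (g ^ r) α = near (f ^ r) α)
    fun g => (mu g : ℂ) * ((wt r g : ℂ) * compSum N (res (g ^ r) α))
  rw [← hS, sum_near_eq S fun g hg => (Finset.mem_filter.1 hg).2, ← res_eq_sub_near, ← hβ] at hsplit
  set R := ∑ g ∈ monicUpTo F (N / r) with ¬ near (g ^ r) α = near (f ^ r) α,
    (mu g : ℂ) * ((wt r g : ℂ) * compSum N (res (g ^ r) α)) with hR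
  have hRle : ‖R‖ ≤ ∑ g ∈ monicUpTo F (N / r) with near (g ^ r) α ≠ near (f ^ r) α,
        2 * (wt r g * q ^ depth N (res (g ^ r) α)) := by
    refine (norm_sum_le _ _).trans (Finset.sum_le_sum fun g hg => ?_)
    rw [Finset.mem_filter, mem_monicUpTo] at hg
    exact norm_term_le hg.1.1 α
  rw [approx_eq hr hx hf h]
  have hmain : ‖((coefC r f - ∑ g ∈ S, mu g * wt r g : ℝ) : ℂ) * compSum N β‖ ≤
      4 * q ^ (N / r) := by
    rw [norm_mul, Complex.norm_real, Real.norm_eq_abs]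
    calc _ ≤ 2 * (q ^ ((r - 1) * (d / r + 1)))⁻¹ * (2 * q ^ d) :=
          mul_le_mul htail (norm_compSum_le N hβ0) (norm_nonneg _) (by positivity)
      _ = 4 * (q ^ d * (q ^ ((r - 1) * (d / r + 1)))⁻¹) := by ring
      _ ≤ 4 * q ^ (N / r) := by
          refine mul_le_mul_of_nonneg_left ?_ (by norm_num)
          rw [mul_inv_le_iff₀ (by positivity), ← pow_add]
          refine pow_le_pow_right₀ (by linarith) ?_
          have h1 := Nat.div_add_mod d r
          have h2 := Nat.mod_lt d (show 0 < r by omega)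
          have h3 : d / r ≤ N / r := Nat.div_le_div_right hdN
          obtain ⟨m, rfl⟩ : ∃ m, r = m + 1 := ⟨r - 1, by omega⟩
          rw [Nat.add_sub_cancel]
          nlinarith
  have hG := norm_G_sub_le hr N α
  rw [← hsplit] at hG
  set V := ((∑ g ∈ S, mu g * wt r g : ℝ) : ℂ) with hV
  calc ‖G r N α - (coefC r f : ℂ) * compSum N β‖
      = ‖(G r N α - (V * compSum N β + R)) +
          (R - ((coefC r f - ∑ g ∈ S, mu g * wt r g : ℝ) : ℂ) * compSum N β)‖ := by
        congr 1
        rw [Complex.ofReal_sub, ← hV]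
        ring
    _ ≤ 2 * q ^ (N / r) + (‖R‖ + 4 * q ^ (N / r)) :=
        (norm_add_le _ _).trans (add_le_add hG ((norm_sub_le _ _).trans (by gcongr)))
    _ ≤ _ := by linarith

theorem two_mul_le_of_le {r N x : ℕ} (hr : 2 ≤ r) (hx : 2 * r * x ≤ (r - 1) * N) : 2 * x ≤ N := by
  refine le_of_mul_le_mul_left ?_ (show 0 < r by omega)
  calc r * (2 * x) = 2 * r * x := by ring
    _ ≤ (r - 1) * N := hx
    _ ≤ r * N := Nat.mul_le_mul_right N (Nat.sub_le _ _)

/-- The approximation is uniformly good. For the denominators `g ^ r` with `|g| ^ r ≤ q ^ (N / 2)`,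
the nearest fractions are well separated from each other, so that only those terms matter that
share the best fraction. -/
theorem norm_G_sub_approx_le {r N x : ℕ} (hr : 2 ≤ r) (hx : 2 * r * x ≤ (r - 1) * N)
    (α : KInf F) :
    ‖G r N α - approx r N x α‖ ≤ 14 * (Fintype.card F : ℝ) ^ (N - x) := by
  classical
  have hq := two_le_card (F := F)
  set q : ℝ := (Fintype.card F : ℝ) with hqd
  have hq0 : 0 < q := by linarith
  obtain ⟨m, hm⟩ : ∃ m, r = m + 1 := ⟨r - 1, by omega⟩
  have hrm : r - 1 = m := by omega
  have hx2 := two_mul_le_of_le hr hx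
  rw [hrm] at hx
  set Q := N / (2 * r) with hQ
  have hQN : Q * (2 * r) ≤ N := Nat.div_mul_le_self _ _
  have hQN' : N < (Q + 1) * (2 * r) := by
    rw [mul_comm]
    exact Nat.lt_mul_div_succ N (by omega)
  have hrQ : 2 * (r * Q) ≤ N := by nlinarith
  have hQP : Q ≤ N / r := Nat.div_le_div_left (by omega) (by omega)
  -- the exponents of the four error terms
  have e1 : N / r ≤ N - x := by
    have : N / r ≤ N / 2 := Nat.div_le_div_left hr (by omega)
    omega
  have e2 : x ≤ m * (Q + 1) := by
    by_contra hlt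
    have h1 : 2 * r * (m * (Q + 1)) < 2 * r * x := Nat.mul_lt_mul_of_pos_left (by omega) (by omega)
    have h2 : m * N ≤ m * ((Q + 1) * (2 * r)) := Nat.mul_le_mul_left _ hQN'.le
    nlinarith
  have e3 : r * Q + Q ≤ N - x := by
    by_contra hlt
    have h1 : N < r * Q + Q + x := by omega
    have h2 : 2 * r * N < 2 * r * (r * Q + Q + x) := Nat.mul_lt_mul_of_pos_left h1 (by omega)
    have h3 : (m + 2) * (Q * (2 * r)) ≤ (m + 2) * N := Nat.mul_le_mul_left _ hQN
    subst hm
    nlinarith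
  have hpow : q ^ N * (q ^ (m * (Q + 1)))⁻¹ ≤ q ^ (N - x) := by
    rw [pow_sub₀ q hq0.ne' (by omega)]
    exact mul_le_mul_of_nonneg_left (inv_anti₀ (by positivity)
      (pow_le_pow_right₀ (by linarith) e2)) (by positivity)
  set T : F[X] → ℂ := fun g => (mu g : ℂ) * ((wt r g : ℂ) * compSum N (res (g ^ r) α)) with hT
  have hdepthN : ∀ g : F[X], q ^ depth N (res (g ^ r) α) ≤ q ^ N := fun g =>
    pow_le_pow_right₀ (by linarith) (depth_le _ _)
  -- the large denominators
  have hlarge : ‖∑ g ∈ monicUpTo F (N / r) with ¬ g.natDegree ≤ Q, T g‖ ≤ 4 * q ^ (N - x) := by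
    calc _ ≤ ∑ g ∈ monicUpTo F (N / r) with ¬ g.natDegree ≤ Q, 2 * q ^ N * wt r g := by
          refine (norm_sum_le _ _).trans (Finset.sum_le_sum fun g hg => ?_)
          rw [Finset.mem_filter, mem_monicUpTo] at hg
          refine (norm_term_le hg.1.1 α).trans ?_
          have := mul_le_mul_of_nonneg_left (hdepthN g) (wt_pos r g).le
          linarith
      _ ≤ 2 * q ^ N * (2 * (q ^ (m * (Q + 1)))⁻¹) := by
          rw [← Finset.mul_sum, ← hrm]
          refine mul_le_mul_of_nonneg_left (sum_wt_le hr fun g hg => ?_) (by positivity)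
          rw [Finset.mem_filter, mem_monicUpTo] at hg
          exact ⟨hg.1.1, by omega⟩
      _ ≤ _ := by linarith
  -- the best fraction with a small denominator
  obtain ⟨g₀, hg₀, hmax⟩ := Finset.exists_max_image ((monicUpTo F Q).filter Squarefree)
    (fun g => depth N (res (g ^ r) α)) ⟨1, Finset.mem_filter.2
      ⟨mem_monicUpTo.2 ⟨monic_one, by simp⟩, squarefree_one⟩⟩
  rw [Finset.mem_filter, mem_monicUpTo] at hg₀
  obtain ⟨⟨hg₀m, hg₀Q⟩, hg₀s⟩ := hg₀
  obtain ⟨f, a, hfm, hfs, hfg₀, hfa, hae⟩ := exists_prim (r := r) g₀ hg₀m hg₀s (num (g₀ ^ r) α)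
  set ξ := rat a (f ^ r) with hξ
  have hξ₀ : near (g₀ ^ r) α = ξ := by
    rw [near, hξ, rat_eq_rat (hg₀m.pow r).ne_zero (hfm.pow r).ne_zero, hae]
  set β := α - ξ with hβ
  have hβres : res (g₀ ^ r) α = β := by rw [res_eq_sub_near, hξ₀]
  have hβ0 : β ∈ ball F 0 := hβres ▸ res_mem_ball_zero (hg₀m.pow r) α
  have hsep : ∀ g ∈ monicUpTo F Q, Squarefree g → near (g ^ r) α ≠ ξ →
      depth N (res (g ^ r) α) < r * g.natDegree + r * Q := fun g hg hgs hne => by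
    rw [mem_monicUpTo] at hg
    have hle := hmax g (Finset.mem_filter.2 ⟨mem_monicUpTo.2 hg, hgs⟩)
    rw [← hξ₀] at hne
    have h1 := mem_ball_depth N (res_mem_ball_zero (hg.1.pow r) α)
    have h2 := mem_ball_depth N (res_mem_ball_zero (hg₀m.pow r) α)
    have := lt_of_near_ne (hg.1.pow r) (hg₀m.pow r) hne h1 (ball_anti (by exact_mod_cast hle) h2)
    rw [hg.1.natDegree_pow, hg₀m.natDegree_pow] at this
    have : r * g₀.natDegree ≤ r * Q := Nat.mul_le_mul_left _ hg₀Q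
    omega
  have hsmall : ‖∑ g ∈ monicUpTo F Q with ¬ near (g ^ r) α = ξ, T g‖ ≤ 4 * q ^ (N - x) := by
    calc _ ≤ ∑ g ∈ monicUpTo F Q with ¬ near (g ^ r) α = ξ, 2 * q ^ (r * Q) := by
          refine (norm_sum_le _ _).trans (Finset.sum_le_sum fun g hg => ?_)
          rw [Finset.mem_filter] at hg
          by_cases hgs : Squarefree g
          · refine (norm_term_le (mem_monicUpTo.1 hg.1).1 α).trans ?_
            have h1 := hsep g hg.1 hgs hg.2
            have h2 : wt r g * q ^ depth N (res (g ^ r) α) ≤ q ^ (r * Q) := by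
              rw [wt, inv_mul_le_iff₀ (by positivity), ← pow_add]
              exact pow_le_pow_right₀ (by linarith) h1.le
            linarith
          · rw [hT]
            simp only [mu_of_not_squarefree hgs, Complex.ofReal_zero, zero_mul, norm_zero]
            positivity
      _ ≤ ∑ g ∈ monicUpTo F Q, 2 * q ^ (r * Q) :=
          Finset.sum_le_sum_of_subset_of_nonneg (Finset.filter_subset _ _)
            fun _ _ _ => by positivity
      _ ≤ 2 * q ^ Q * (2 * q ^ (r * Q)) := by
          rw [Finset.sum_const, nsmul_eq_mul]
          exact mul_le_mul_of_nonneg_right (card_monicUpTo_le Q) (by positivity)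
      _ = 4 * q ^ (r * Q + Q) := by ring
      _ ≤ _ := by
          gcongr
          linarith
  -- the terms that share the best fraction
  set S := (monicUpTo F Q).filter fun g => near (g ^ r) α = ξ with hS
  have hSd : ∀ g ∈ S, g.Monic ∧ f ∣ g := fun g hg => by
    rw [hS, Finset.mem_filter, mem_monicUpTo] at hg
    exact ⟨hg.1.1, dvd_of_rat_eq hfm hfs hfa hg.1.1 hg.2⟩
  have hshared : ‖((∑ g ∈ S, mu g * wt r g : ℝ) : ℂ) * compSum N β - approx r N x α‖ ≤
      4 * q ^ (N - x) := by
    by_cases hmajor : r * f.natDegree ≤ x ∧ β ∈ ball F (N - x + r * f.natDegree : ℕ)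
    · have hnear : near (f ^ r) α = ξ :=
        near_eq_of_dvd hfm dvd_rfl (ball_anti (by exact_mod_cast Nat.le_add_left _ _) hmajor.2)
      have hnum : num (f ^ r) α = a := num_eq (hfm.pow r) (by
        rw [hfm.natDegree_pow]
        exact ball_anti (by exact_mod_cast Nat.le_add_left _ _) hmajor.2)
      have hres : res (f ^ r) α = β := by rw [res_eq_sub_near, hnear]
      have hact : Active r N x f α := ⟨by rwa [hnum], by rw [hres]; exact hmajor.2⟩
      rw [approx_eq hr hx2 ((mem_majorIndex hr).2 ⟨hfm, hfs, hmajor.1⟩) hact, hres, ← sub_mul,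
        ← Complex.ofReal_sub, norm_mul, Complex.norm_real, Real.norm_eq_abs, abs_sub_comm]
      have htail := abs_coefC_sub_le hr (f := f) hSd (Q := Q + 1) (fun g hg hfg hgS => by
        by_contra hlt
        refine hgS (Finset.mem_filter.2 ⟨mem_monicUpTo.2 ⟨hg, by omega⟩, ?_⟩)
        refine near_eq_of_dvd hg hfg (ball_anti ?_ hmajor.2)
        have : r * g.natDegree ≤ r * Q := Nat.mul_le_mul_left _ (by omega)
        exact_mod_cast (by omega))
      rw [hrm] at htail
      calc _ ≤ 2 * (q ^ (m * (Q + 1)))⁻¹ * (2 * q ^ N) := by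
            refine mul_le_mul htail ((norm_compSum_le N hβ0).trans ?_) (norm_nonneg _)
              (by positivity)
            gcongr
            · linarith
            · exact depth_le _ _
        _ ≤ _ := by linarith
    · rw [approx_eq_zero, sub_zero, norm_mul, Complex.norm_real, Real.norm_eq_abs]
      · have h1 : |∑ g ∈ S, mu g * wt r g| ≤ 2 * wt r f :=
          (Finset.abs_sum_le_sum_abs _ _).trans
            ((Finset.sum_le_sum fun g _ => abs_mu_mul_wt_le r g).trans
              (sum_wt_le_of_dvd hr hfm hSd))
        have h2 : wt r f * q ^ depth N β ≤ q ^ (N - x) := by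
          rw [wt, inv_mul_le_iff₀ (by positivity), ← pow_add]
          refine pow_le_pow_right₀ (by linarith) ?_
          by_contra hlt
          have hdN := depth_le N β
          refine hmajor ⟨by omega, (le_depth_iff (N := N) (m := N - x + r * f.natDegree)
            (by omega) hβ0).1 (by omega)⟩
        calc _ ≤ 2 * wt r f * (2 * q ^ depth N β) :=
              mul_le_mul h1 (norm_compSum_le N hβ0) (norm_nonneg _)
                (mul_nonneg (by norm_num) (wt_pos r f).le)
          _ ≤ _ := by linarith
      · -- an active polynomial would have to belong to the best fraction
        intro f' hf' hact
        obtain ⟨hfm', hfs', hfx'⟩ := (mem_majorIndex hr).1 hf'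
        have hfQ' : f'.natDegree ≤ Q := by
          rw [hQ, Nat.le_div_iff_mul_le (by omega)]
          nlinarith
        have hfQ'' : f' ∈ monicUpTo F Q := mem_monicUpTo.2 ⟨hfm', hfQ'⟩
        have hd : N - x + r * f'.natDegree ≤ depth N (res (f' ^ r) α) :=
          (le_depth_iff (by omega) (res_mem_ball_zero (hfm'.pow r) α)).2 hact.2
        have hξ' : near (f' ^ r) α = ξ := by
          by_contra hne
          have := hsep f' hfQ'' hfs' hne
          omega
        have hff : f' = f := eq_of_near_eq hfm' hfs' hfm hfs hact.1 hfa hξ'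
        subst hff
        refine hmajor ⟨hfx', ?_⟩
        have := hact.2
        rwa [res_eq_sub_near, hξ'] at this
  have hG := norm_G_sub_le hr N α
  have hs1 := Finset.sum_filter_add_sum_filter_not (monicUpTo F (N / r))
    (fun g => g.natDegree ≤ Q) T
  have hfil : (monicUpTo F (N / r)).filter (fun g => g.natDegree ≤ Q) = monicUpTo F Q := by
    ext g
    rw [Finset.mem_filter, mem_monicUpTo, mem_monicUpTo]
    exact ⟨fun h => ⟨h.1.1, h.2⟩, fun h => ⟨⟨h.1, h.2.trans hQP⟩, h.2⟩⟩
  have hs2 := Finset.sum_filter_add_sum_filter_not (monicUpTo F Q)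
    (fun g => near (g ^ r) α = ξ) T
  rw [← hS, sum_near_eq S fun g hg => (Finset.mem_filter.1 hg).2, ← hβ] at hs2
  rw [hfil, ← hs2] at hs1
  rw [← hs1] at hG
  have hP : 2 * q ^ (N / r) ≤ 2 * q ^ (N - x) := by
    gcongr
    linarith
  set A1 := ((∑ g ∈ S, mu g * wt r g : ℝ) : ℂ) * compSum N β
  set A2 := ∑ g ∈ monicUpTo F Q with ¬ near (g ^ r) α = ξ, T g
  set A3 := ∑ g ∈ monicUpTo F (N / r) with ¬ g.natDegree ≤ Q, T g
  calc ‖G r N α - approx r N x α‖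
      = ‖(G r N α - (A1 + A2 + A3)) + ((A1 - approx r N x α) + (A2 + A3))‖ := by
        congr 1
        ring
    _ ≤ ‖G r N α - (A1 + A2 + A3)‖ + (‖A1 - approx r N x α‖ + (‖A2‖ + ‖A3‖)) :=
        (norm_add_le _ _).trans (add_le_add le_rfl ((norm_add_le _ _).trans
          (add_le_add le_rfl (norm_add_le _ _))))
    _ ≤ _ := by linarith

end Approximation

/-! ### The singular integral -/

section BallMoment

variable {F : Type*} [Field F]

/-- The cells that divide the ball of index `m` according to the leading coefficient. -/
theorem mem_cell_iff {m : ℕ} {c : F} {α : KInf F} :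
    α - HahnSeries.single ((m : ℤ) + 1) c ∈ ball F (m + 1 : ℕ) ↔
      α ∈ ball F m ∧ α.coeff (m + 1) = c := by
  simp only [mem_ball, HahnSeries.coeff_sub, HahnSeries.coeff_single]
  push_cast
  constructor
  · refine fun h => ⟨fun i hi => ?_, ?_⟩
    · simpa [show i ≠ (m : ℤ) + 1 by omega] using h i (by omega)
    · simpa [sub_eq_zero] using h (m + 1) le_rfl
  · rintro ⟨h, rfl⟩ i hi
    rcases hi.eq_or_lt with rfl | hi
    · simp
    · simpa [show i ≠ (m : ℤ) + 1 by omega] using h i (by omega)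

theorem cell_zero (m : ℕ) :
    {α : KInf F | α - HahnSeries.single ((m : ℤ) + 1) (0 : F) ∈ ball F (m + 1 : ℕ)} =
      ball F (m + 1 : ℕ) := by
  simp

variable [Fintype F]

/-- The contribution of the ball of index `m` to the moment of the completed geometric sum. -/
def ballMoment (F : Type*) [Field F] [Fintype F] (k : ℝ) (N m : ℕ) : ℝ :=
  ∫ β in ball F m, ‖compSum N β‖ ^ k ∂(haar F)

theorem setIntegral_ball_eq_sum (m : ℕ) {L : ℕ} {H : KInf F → ℝ} (hH : BallInvariant L H) :
    ∫ β in ball F m, H β ∂(haar F) = ∑ c : F,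
      ∫ β in {α | α - HahnSeries.single ((m : ℤ) + 1) c ∈ ball F (m + 1 : ℕ)}, H β ∂(haar F) := by
  have hU : (ball F m : Set (KInf F)) = ⋃ c ∈ (Finset.univ : Finset F),
      {α | α - HahnSeries.single ((m : ℤ) + 1) c ∈ ball F (m + 1 : ℕ)} := by
    ext α
    simp only [Set.mem_iUnion, Finset.mem_univ, exists_prop, true_and, Set.mem_ofPred_eq,
      mem_cell_iff, SetLike.mem_coe, exists_and_left, exists_eq', and_true]
  rw [hU, integral_biUnion_finset _ (fun c _ => measurableSet_cell _ _)]
  · intro c _ c' _ hne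
    refine Set.disjoint_left.2 fun α h h' => hne ?_
    rw [Set.mem_ofPred_eq, mem_cell_iff] at h h'
    rw [← h.2, h'.2]
  · intro c _
    refine hH.integrableOn.mono_set fun α h => ?_
    rw [Set.mem_ofPred_eq, mem_cell_iff] at h
    exact mem_torus_iff.2 (ball_anti (by omega) h.1)

theorem setIntegral_cell_compSum (k : ℝ) {N m : ℕ} (hm : m ≤ N) {c : F} (h : m = N ∨ c ≠ 0) :
    ∫ β in {α | α - HahnSeries.single ((m : ℤ) + 1) c ∈ ball F (m + 1 : ℕ)},
        ‖compSum N β‖ ^ k ∂(haar F) =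
      ((Fintype.card F : ℝ) ^ (k - 1)) ^ m *
        ((Fintype.card F : ℝ)⁻¹ * ‖psi F c + 1 / ((Fintype.card F : ℂ) - 1)‖ ^ k) := by
  have hq := two_le_card (F := F)
  have hq0 : (0 : ℝ) < Fintype.card F := by linarith
  rw [setIntegral_congr_fun (g := fun _ => ((Fintype.card F : ℝ) ^ m *
      ‖psi F c + 1 / ((Fintype.card F : ℂ) - 1)‖) ^ k) (measurableSet_cell _ _),
    setIntegral_const, real_haar_cell, smul_eq_mul, Real.mul_rpow (by positivity) (norm_nonneg _),
    ← Real.rpow_natCast, ← Real.rpow_natCast, ← Real.rpow_mul hq0.le,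
    ← Real.rpow_neg hq0.le, ← mul_assoc, ← Real.rpow_add hq0, ← mul_assoc, ← Real.rpow_natCast,
    ← Real.rpow_mul hq0.le, ← Real.rpow_neg_one, ← Real.rpow_add hq0]
  · congr 2
    push_cast
    ring
  · intro β hβ
    rw [Set.mem_ofPred_eq, mem_cell_iff] at hβ
    dsimp only
    rw [compSum_eq hm hβ.1 (by rwa [hβ.2]), hβ.2, norm_mul, norm_pow, Complex.norm_natCast]

theorem norm_psi_zero_add :
    ‖psi F 0 + 1 / ((Fintype.card F : ℂ) - 1)‖ =
      (Fintype.card F : ℝ) / ((Fintype.card F : ℝ) - 1) := by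
  have hq := two_le_card (F := F)
  have h1 : ((Fintype.card F : ℂ) - 1) ≠ 0 := card_sub_one_ne_zero
  rw [AddChar.map_zero_eq_one, show (1 : ℂ) + 1 / ((Fintype.card F : ℂ) - 1) =
    (((Fintype.card F : ℝ) / ((Fintype.card F : ℝ) - 1) : ℝ) : ℂ) by
      push_cast
      field_simp
      ring, Complex.norm_real, Real.norm_eq_abs,
    abs_of_nonneg (div_nonneg (by linarith) (by linarith))]

/-- The sum of `|ψ(c) + 1 / (q - 1)| ^ k` over `c ≠ 0`. -/
def unitSum (F : Type*) [Field F] [Fintype F] (k : ℝ) : ℝ :=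
  open Classical in ∑ c ∈ Finset.univ.erase (0 : F), ‖psi F c + 1 / ((Fintype.card F : ℂ) - 1)‖ ^ k

theorem unitSum_nonneg (k : ℝ) : 0 ≤ unitSum F k :=
  Finset.sum_nonneg fun _ _ => Real.rpow_nonneg (norm_nonneg _) _

/-- The coefficient of the second term in the formula for `ballMoment`. -/
def ballCorrection (F : Type*) [Field F] [Fintype F] (k : ℝ) : ℝ :=
  unitSum F k / ((Fintype.card F : ℝ) * ((Fintype.card F : ℝ) ^ (k - 1) - 1))

theorem one_lt_card_rpow {u : ℝ} (hu : 0 < u) : 1 < (Fintype.card F : ℝ) ^ u :=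
  Real.one_lt_rpow (by have := two_le_card (F := F); linarith) hu

theorem ballCorrection_nonneg {k : ℝ} (hk : 1 < k) : 0 ≤ ballCorrection F k :=
  div_nonneg (unitSum_nonneg k) (mul_nonneg (Nat.cast_nonneg _)
    (by have := one_lt_card_rpow (F := F) (u := k - 1) (by linarith); linarith))

/-- The constant `B` of the singular integral, split into the contributions of the zero and the
nonzero leading coefficients. -/
theorem B_sub_ballCorrection {k : ℝ} (hk : 1 < k) :
    B F k - ballCorrection F k = (Fintype.card F : ℝ)⁻¹ * (unitSum F k +
      ((Fintype.card F : ℝ) / ((Fintype.card F : ℝ) - 1)) ^ k) := by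
  classical
  have hq := two_le_card (F := F)
  have hQ := one_lt_card_rpow (F := F) (u := k - 1) (by linarith)
  have hs : ∑ a : F, ‖charFq a + 1 / ((Fintype.card F : ℂ) - 1)‖ ^ k =
      unitSum F k + ((Fintype.card F : ℝ) / ((Fintype.card F : ℝ) - 1)) ^ k := by
    rw [← norm_psi_zero_add, unitSum, Finset.sum_erase_add _ _ (Finset.mem_univ _)]
    simp only [charFq_eq_psi]
  have hp : ((Fintype.card F : ℝ) / ((Fintype.card F : ℝ) - 1)) ^ k =
      (Fintype.card F : ℝ) * (Fintype.card F : ℝ) ^ (k - 1) /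
        ((Fintype.card F : ℝ) - 1) ^ k := by
    rw [Real.div_rpow (by linarith) (by linarith), ← Real.rpow_one_add' (by linarith) (by linarith)]
    congr 2
    ring
  have hd : 0 < ((Fintype.card F : ℝ) - 1) ^ k := Real.rpow_pos_of_pos (by linarith) _
  simp only [B, Complex.ofReal_natCast, hs, ballCorrection, hp]
  have h1 : (Fintype.card F : ℝ) ^ (k - 1) - 1 ≠ 0 := by linarith
  have h2 : (Fintype.card F : ℝ) ≠ 0 := by linarith
  field_simp
  ring

/-- The moment of the completed sum over a ball. The ball is the disjoint union of spheres and of a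
ball of index `N`, and on each of them the sum depends on the leading coefficient only. So the
moment is the sum of a geometric series. -/
theorem ballMoment_eq {k : ℝ} (hk : 1 < k) {N m : ℕ} (hm : m ≤ N) :
    ballMoment F k N m = B F k * ((Fintype.card F : ℝ) ^ (k - 1)) ^ N -
      ballCorrection F k * ((Fintype.card F : ℝ) ^ (k - 1)) ^ m := by
  classical
  have hq := two_le_card (F := F)
  have hQ := one_lt_card_rpow (F := F) (u := k - 1) (by linarith)
  have hH : BallInvariant (N + 1) fun β : KInf F => ‖compSum N β‖ ^ k :=
    (ballInvariant_compSum N).comp fun z => ‖z‖ ^ k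
  induction hm using Nat.decreasingInduction with
  | self =>
    rw [ballMoment, setIntegral_ball_eq_sum N hH,
      Finset.sum_congr rfl fun c _ => setIntegral_cell_compSum k le_rfl (Or.inl rfl),
      ← Finset.mul_sum, ← Finset.mul_sum, ← sub_mul, B_sub_ballCorrection hk,
      ← Finset.sum_erase_add _ _ (Finset.mem_univ (0 : F)), norm_psi_zero_add, unitSum]
    ring
  | of_succ m hm ih =>
    have h1 : (Fintype.card F : ℝ) ^ (k - 1) - 1 ≠ 0 := by linarith
    have h2 : (Fintype.card F : ℝ) ≠ 0 := by linarith
    rw [ballMoment, setIntegral_ball_eq_sum m hH,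
      ← Finset.sum_erase_add _ _ (Finset.mem_univ (0 : F)), cell_zero,
      Finset.sum_congr rfl fun c hc => setIntegral_cell_compSum k (by omega)
        (Or.inr (Finset.ne_of_mem_erase hc)), ← ballMoment, ih, ← Finset.mul_sum, ← Finset.mul_sum,
      ← unitSum, ballCorrection, pow_succ]
    field_simp
    ring

end BallMoment

/-! ### The moments of the approximation -/

section ApproxMoment

variable {F : Type*} [Field F]

theorem ballInvariant_active {r N x : ℕ} {f : F[X]} (hf : f.Monic) (hfx : r * f.natDegree ≤ x)
    (hx : x ≤ N) : BallInvariant (N + 1) (Active r N x f) :=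
  BallInvariant.setOf fun α δ hδ h => by
    have hd : (f ^ r).natDegree = r * f.natDegree := hf.natDegree_pow r
    have hδ' : δ ∈ ball F (f ^ r).natDegree := ball_anti (by rw [hd]; exact_mod_cast (by omega)) hδ
    rw [Active, num_add (hf.pow r) _ hδ', res_add (hf.pow r) _ hδ']
    exact ⟨h.1, add_mem h.2 (ball_anti (by exact_mod_cast (by omega)) hδ)⟩

variable [Fintype F]

theorem ballInvariant_compSum_res {r N : ℕ} {f : F[X]} (hf : f.Monic) (hfN : r * f.natDegree ≤ N) :
    BallInvariant (N + 1) fun α : KInf F => compSum N (res (f ^ r) α) :=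
  ((ballInvariant_compSum N).comp_res (hf.pow r)).mono (by rw [hf.natDegree_pow]; omega)

theorem ballInvariant_approx {r N x : ℕ} (hr : 2 ≤ r) (hx : x ≤ N) :
    BallInvariant (N + 1) (approx (F := F) r N x) := by
  classical
  intro α δ hδ
  refine Finset.sum_congr rfl fun f hf => ?_
  obtain ⟨hfm, -, hfx⟩ := (mem_majorIndex hr).1 hf
  have h : compSum N (res (f ^ r) (α + δ)) = compSum N (res (f ^ r) α) :=
    ballInvariant_compSum_res hfm (hfx.trans hx) α δ hδ
  exact if_congr (Iff.of_eq (ballInvariant_active hfm hfx hx α δ hδ)) (by rw [h]) rfl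

/-- On the major arc of `f`, a function of the distance is integrated over one ball for each
primitive numerator. -/
theorem setIntegral_active {r N x : ℕ} {f : F[X]} (hf : f.Monic) (hfx : r * f.natDegree ≤ x)
    (hx : x ≤ N) {H : KInf F → ℝ} (hH : BallInvariant (N + 1) H) :
    open Classical in
    ∫ α in torus F, (if Active r N x f α then H (res (f ^ r) α) else 0) ∂(haar F) =
      (primNum r f).card *
        ∫ β in ball F (N - x + r * f.natDegree : ℕ), H β ∂(haar F) := by
  classical
  have hd : (f ^ r).natDegree = r * f.natDegree := hf.natDegree_pow r
  have hsub : (ball F (N - x + r * f.natDegree : ℕ) : Set (KInf F)) ⊆ ball F (f ^ r).natDegree :=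
    ball_anti (by rw [hd]; exact_mod_cast (by omega))
  have hinv : BallInvariant (N + 1) fun α =>
      if Active r N x f α then H (res (f ^ r) α) else 0 := by
    intro α δ hδ
    have h := (hH.comp_res (hf.pow r)).mono (M := N + 1) (by rw [hd]; omega) α δ hδ
    dsimp only at h ⊢
    simp only [ballInvariant_active hf hfx hx α δ hδ, h]
  have hp : primNum r f = (polysLT F (f ^ r).natDegree).filter (Prim r f) := by
    rw [hd]
    rfl
  rw [setIntegral_torus_eq_sum (hf.pow r) hinv, hp, Finset.card_filter, Nat.cast_sum,
    Finset.sum_mul]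
  refine Finset.sum_congr rfl fun a _ => ?_
  rw [setIntegral_congr_fun (g := fun β => if Prim r f a then
    (ball F (N - x + r * f.natDegree : ℕ) : Set (KInf F)).indicator H β else 0)
    (measurableSet_ball _)]
  · split_ifs with ha
    · rw [setIntegral_indicator (measurableSet_ball _), Set.inter_eq_right.2 hsub, Nat.cast_one,
        one_mul]
    · simp
  · intro β hβ
    dsimp only
    rw [Active, num_rat_add (hf.pow r) a hβ, res_rat_add (hf.pow r) a hβ]
    by_cases ha : Prim r f a <;> simp [ha, Set.indicator_apply]

theorem norm_approx_rpow {r N x : ℕ} (hr : 2 ≤ r) (hx : 2 * x ≤ N) {k : ℝ} (hk : 0 < k)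
    (α : KInf F) : open Classical in
    ‖approx r N x α‖ ^ k = ∑ f ∈ majorIndex F r x,
      |coefC r f| ^ k * (if Active r N x f α then ‖compSum N (res (f ^ r) α)‖ ^ k else 0) := by
  classical
  by_cases h : ∃ f ∈ majorIndex F r x, Active r N x f α
  · obtain ⟨f, hf, ha⟩ := h
    rw [approx_eq hr hx hf ha, Finset.sum_eq_single_of_mem f hf, if_pos ha, norm_mul,
      Complex.norm_real, Real.norm_eq_abs, Real.mul_rpow (abs_nonneg _) (norm_nonneg _)]
    intro f' hf' hne
    rw [mem_majorIndex hr] at hf hf'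
    rw [if_neg fun h' => hne
      (Active.unique hx hf'.1 hf'.2.1 hf.1 hf.2.1 hf'.2.2 hf.2.2 h' ha), mul_zero]
  · push Not at h
    rw [approx_eq_zero h, norm_zero, Real.zero_rpow hk.ne', Finset.sum_eq_zero]
    intro f hf
    rw [if_neg (h f hf), mul_zero]

/-- The moment of the approximation is a truncated singular series, with truncated singular
integrals as coefficients. -/
theorem integral_norm_approx_rpow {r N x : ℕ} (hr : 2 ≤ r) (hx : 2 * x ≤ N) {k : ℝ} (hk : 0 < k) :
    ∫ α in torus F, ‖approx r N x α‖ ^ k ∂(haar F) = (1 / zeta F r) ^ k *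
      ∑ f ∈ majorIndex F r x, singularTerm r k f * ballMoment F k N (N - x + r * f.natDegree) := by
  classical
  have hH : BallInvariant (N + 1) fun β : KInf F => ‖compSum N β‖ ^ k :=
    (ballInvariant_compSum N).comp fun z => ‖z‖ ^ k
  have hinv : ∀ f ∈ majorIndex F r x, BallInvariant (N + 1) fun α : KInf F => |coefC r f| ^ k *
      (if Active r N x f α then ‖compSum N (res (f ^ r) α)‖ ^ k else 0) := fun f hf α δ hδ => by
    obtain ⟨hfm, -, hfx⟩ := (mem_majorIndex hr).1 hf
    have h : compSum N (res (f ^ r) (α + δ)) = compSum N (res (f ^ r) α) :=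
      ballInvariant_compSum_res hfm (by omega) α δ hδ
    simp only [ballInvariant_active hfm hfx (by omega : x ≤ N) α δ hδ, h]
  simp only [norm_approx_rpow hr hx hk]
  rw [integral_finsetSum _ fun f hf => (hinv f hf).integrableOn, Finset.mul_sum]
  refine Finset.sum_congr rfl fun f hf => ?_
  obtain ⟨hfm, hfs, hfx⟩ := (mem_majorIndex hr).1 hf
  have hP := Phi_pos hr hfm hfs
  have hz := zeta_pos (F := F) hr
  rw [integral_const_mul, setIntegral_active hfm hfx (by omega) hH, ← ballMoment,
    card_primNum hfm hfs, abs_coefC hr hfm hfs, Real.mul_rpow (by positivity) (by positivity),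
    singularTerm, if_pos hfs, Real.inv_rpow hP.le, Real.rpow_sub hP, Real.rpow_one]
  ring

end ApproxMoment

/-! ### The leading constant -/

section MainTerm

variable {F : Type*} [Field F] [Fintype F]

/-- The sum of `|f| ^ (-r (k - 1))` over the `q ^ j` monic `f` of degree `j` saves `q ^ (-r j u)`,
with `u = k - 1 - 1 / r`. -/
theorem card_rpow_pow_mul {r : ℕ} (hr : r ≠ 0) (k : ℝ) (j : ℕ) :
    ((Fintype.card F : ℝ) ^ (k - 1)) ^ (r * j) =
      (Fintype.card F : ℝ) ^ j * ((Fintype.card F : ℝ) ^ (k - 1 - 1 / (r : ℝ))) ^ (r * j) := by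
  have hq : (0 : ℝ) < Fintype.card F := by have := two_le_card (F := F); linarith
  have hr' : (r : ℝ) ≠ 0 := by exact_mod_cast hr
  rw [← Real.rpow_mul_natCast hq.le, ← Real.rpow_mul_natCast hq.le, ← Real.rpow_natCast _ j,
    ← Real.rpow_add hq]
  congr 1
  push_cast
  field_simp
  ring

theorem card_pow_div_mul_le {r : ℕ} (hr : r ≠ 0) (k : ℝ) (x : ℕ) :
    (Fintype.card F : ℝ) ^ (x / r) * ((Fintype.card F : ℝ) ^ (k - 1 - 1 / (r : ℝ))) ^ x ≤
      ((Fintype.card F : ℝ) ^ (k - 1)) ^ x := by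
  have hq2 := two_le_card (F := F)
  have hq : (0 : ℝ) < Fintype.card F := by linarith
  have hr' : (0 : ℝ) < r := by exact_mod_cast Nat.pos_of_ne_zero hr
  have h1 : ((x / r : ℕ) : ℝ) * r ≤ x := by exact_mod_cast Nat.div_mul_le_self x r
  rw [← Real.rpow_mul_natCast hq.le, ← Real.rpow_mul_natCast hq.le, ← Real.rpow_natCast _ (x / r),
    ← Real.rpow_add hq]
  refine Real.rpow_le_rpow_of_exponent_le (by linarith) ?_
  have h2 : ((x / r : ℕ) : ℝ) ≤ x / r := (le_div_iff₀ hr').2 h1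
  have h3 : (k - 1 - 1 / (r : ℝ)) * x = (k - 1) * x - x / r := by ring
  linarith

theorem singularTerm_le_inv_pow {r : ℕ} (hr : 2 ≤ r) {k : ℝ} (hk : 1 ≤ k) {f : F[X]}
    (hf : f.Monic) : singularTerm r k f ≤ (2 * zeta F r) ^ (k - 1) *
      (((Fintype.card F : ℝ) ^ (k - 1)) ^ (r * f.natDegree))⁻¹ := by
  have hq : (0 : ℝ) < Fintype.card F := by have := two_le_card (F := F); linarith
  refine (singularTerm_le hr hk hf).trans_eq ?_
  rw [wt, Real.inv_rpow (by positivity), ← Real.rpow_natCast, ← Real.rpow_mul hq.le,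
    ← Real.rpow_mul_natCast hq.le, mul_comm (k - 1)]

theorem summable_singularTerm {r : ℕ} (hr : 2 ≤ r) {k : ℝ} (hk : 1 + 1 / (r : ℝ) < k) :
    Summable fun f : Mon F => singularTerm r k f.1 := by
  have hr0 : (0 : ℝ) ≤ 1 / (r : ℝ) := by positivity
  have hU := one_lt_card_rpow (F := F) (u := k - 1 - 1 / (r : ℝ)) (by linarith)
  refine Summable.of_nonneg_of_le (fun f => singularTerm_nonneg hr k f.2)
    (fun f => singularTerm_le_inv_pow hr (by linarith) f.2) (Summable.mul_left _ ?_)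
  refine summable_natDegree (φ := fun j => (((Fintype.card F : ℝ) ^ (k - 1)) ^ (r * j))⁻¹)
    (fun j => by positivity) ?_
  have hq : (0 : ℝ) < Fintype.card F := by have := two_le_card (F := F); linarith
  have : (((Fintype.card F : ℝ) ^ (k - 1 - 1 / (r : ℝ))) ^ r)⁻¹ < 1 :=
    inv_lt_one_of_one_lt₀ (one_lt_pow₀ hU (by omega))
  refine (summable_geometric_of_lt_one (by positivity) this).congr fun j => ?_
  rw [card_rpow_pow_mul (by omega), pow_mul _ r j, inv_pow]
  field_simp

/-- The approximation has the predicted moment, with an error from the truncation of the singular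
series and of the singular integral. -/
theorem exists_abs_integral_approx_sub_le {r : ℕ} (hr : 2 ≤ r) {k : ℝ} (hk : 1 + 1 / (r : ℝ) < k) :
    ∃ K : ℝ, 0 ≤ K ∧ ∀ N x : ℕ, 2 * x ≤ N →
      |∫ α in torus F, ‖approx r N x α‖ ^ k ∂(haar F) -
        leadingConstant F r k * ((Fintype.card F : ℝ) ^ (k - 1)) ^ N| ≤
      K * (((Fintype.card F : ℝ) ^ (k - 1)) ^ N *
        (((Fintype.card F : ℝ) ^ (k - 1 - 1 / (r : ℝ))) ^ x)⁻¹) := by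
  have hr0 : (0 : ℝ) ≤ 1 / (r : ℝ) := by positivity
  have hU := one_lt_card_rpow (F := F) (u := k - 1 - 1 / (r : ℝ)) (by linarith)
  have hQ := one_lt_card_rpow (F := F) (u := k - 1) (by linarith)
  have hrel := card_rpow_pow_mul (F := F) (r := r) (by omega) k
  have hdiv := card_pow_div_mul_le (F := F) (r := r) (by omega) k
  have hsT := fun f hf => singularTerm_le_inv_pow (F := F) hr (k := k) (by linarith) (f := f) hf
  set q : ℝ := (Fintype.card F : ℝ) with hqdef
  set Q : ℝ := q ^ (k - 1) with hQdef
  set U : ℝ := q ^ (k - 1 - 1 / (r : ℝ)) with hUdef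
  have hq : 2 ≤ q := two_le_card (F := F)
  have hz := zeta_pos (F := F) hr
  set A : ℝ := (2 * zeta F r) ^ (k - 1) with hA
  have hA0 : 0 ≤ A := Real.rpow_nonneg (by linarith) _
  have hbc := ballCorrection_nonneg (F := F) (k := k) (by linarith)
  set g : ℝ := (1 - (U ^ r)⁻¹)⁻¹ with hg
  have hUr : 1 < U ^ r := one_lt_pow₀ hU (by omega)
  have hg0 : 0 ≤ g := inv_nonneg.2 (sub_nonneg.2 (inv_le_one_of_one_le₀ hUr.le))
  have hz' : 0 ≤ (1 / zeta F r) ^ k := by positivity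
  refine ⟨(1 / zeta F r) ^ k * (|B F k| * (A * g) + ballCorrection F k * (A * 2)),
    by positivity, fun N x hx => ?_⟩
  have hXpos : 0 < Q ^ N * (U ^ x)⁻¹ := by positivity
  have htail : |singularSeries F r k - ∑ f ∈ majorIndex F r x, singularTerm r k f| ≤
      A * g * (U ^ x)⁻¹ := by
    refine abs_tsum_sub_sum_le (summable_singularTerm hr hk)
      (fun f hf => ((mem_majorIndex hr).1 hf).1) fun u hu => ?_
    classical
    calc ∑ f ∈ u, |singularTerm r k f|
        = ∑ f ∈ u with x / r + 1 ≤ f.natDegree, |singularTerm r k f| := by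
          rw [Finset.sum_filter_of_ne]
          intro f hf hne
          by_contra hlt
          refine (hu f hf).2 ((mem_majorIndex hr).2 ⟨(hu f hf).1, ?_, ?_⟩)
          · by_contra hns
            exact hne (by rw [singularTerm, if_neg hns, abs_zero])
          · rw [mul_comm, ← Nat.le_div_iff_mul_le (by omega)]
            omega
      _ ≤ ∑ f ∈ u with x / r + 1 ≤ f.natDegree, A * (Q ^ (r * f.natDegree))⁻¹ := by
          refine Finset.sum_le_sum fun f hf => ?_
          have hfm := (hu f (Finset.mem_filter.1 hf).1).1
          rw [abs_of_nonneg (singularTerm_nonneg hr k hfm)]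
          exact hsT f hfm
      _ ≤ ∑ j ∈ (u.filter fun f => x / r + 1 ≤ f.natDegree).image natDegree,
            q ^ j * (A * (Q ^ (r * j))⁻¹) :=
          sum_natDegree_le (φ := fun j => A * (Q ^ (r * j))⁻¹) (fun j => by positivity)
            fun f hf => ⟨(hu f (Finset.mem_filter.1 hf).1).1, Finset.mem_image_of_mem _ hf⟩
      _ = A * ∑ j ∈ (u.filter fun f => x / r + 1 ≤ f.natDegree).image natDegree,
            ((U ^ r) ^ j)⁻¹ := by
          rw [Finset.mul_sum]
          refine Finset.sum_congr rfl fun j _ => ?_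
          rw [hrel, ← pow_mul]
          field_simp
      _ ≤ A * (g * ((U ^ r) ^ (x / r + 1))⁻¹) := by
          refine mul_le_mul_of_nonneg_left (sum_inv_pow_le hUr _ _ fun j hj => ?_) hA0
          obtain ⟨f, hf, rfl⟩ := Finset.mem_image.1 hj
          exact (Finset.mem_filter.1 hf).2
      _ ≤ A * (g * (U ^ x)⁻¹) := by
          gcongr
          rw [← pow_mul]
          refine pow_le_pow_right₀ hU.le ?_
          have := Nat.lt_mul_div_succ x (show 0 < r by omega)
          omega
      _ = _ := by ring
  have hsum : ∑ f ∈ majorIndex F r x, singularTerm r k f * Q ^ (N - x + r * f.natDegree) ≤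
      A * 2 * (Q ^ N * (U ^ x)⁻¹) := by
    calc ∑ f ∈ majorIndex F r x, singularTerm r k f * Q ^ (N - x + r * f.natDegree)
        ≤ ∑ f ∈ majorIndex F r x, A * Q ^ (N - x) := by
          refine Finset.sum_le_sum fun f hf => ?_
          refine (mul_le_mul_of_nonneg_right (hsT f ((mem_majorIndex hr).1 hf).1)
            (by positivity)).trans_eq ?_
          rw [pow_add]
          field_simp
      _ ≤ (2 * q ^ (x / r)) * (A * Q ^ (N - x)) := by
          rw [Finset.sum_const, nsmul_eq_mul]
          refine mul_le_mul_of_nonneg_right ?_ (by positivity)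
          refine le_trans ?_ (card_monicUpTo_le (x / r))
          exact_mod_cast Finset.card_le_card (@Finset.filter_subset _ _ (_) _)
      _ = A * 2 * ((q ^ (x / r) * U ^ x) * (Q ^ (N - x) * (U ^ x)⁻¹)) := by
          field_simp
      _ ≤ A * 2 * (Q ^ x * (Q ^ (N - x) * (U ^ x)⁻¹)) := by
          gcongr
          exact hdiv x
      _ = _ := by
          rw [← mul_assoc (Q ^ x), ← pow_add, Nat.add_sub_cancel' (by omega)]
  have hsum0 : 0 ≤ ∑ f ∈ majorIndex F r x, singularTerm r k f * Q ^ (N - x + r * f.natDegree) :=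
    Finset.sum_nonneg fun f hf => mul_nonneg (singularTerm_nonneg hr k ((mem_majorIndex hr).1 hf).1)
      (by positivity)
  have hmain : ∫ α in torus F, ‖approx r N x α‖ ^ k ∂(haar F) - leadingConstant F r k * Q ^ N =
      -((1 / zeta F r) ^ k * (B F k * Q ^ N *
        (singularSeries F r k - ∑ f ∈ majorIndex F r x, singularTerm r k f) +
        ballCorrection F k *
          ∑ f ∈ majorIndex F r x, singularTerm r k f * Q ^ (N - x + r * f.natDegree))) := by
    rw [integral_norm_approx_rpow hr hx (by linarith), Finset.sum_congr rfl fun f hf => by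
      rw [ballMoment_eq (by linarith : 1 < k)
        (show N - x + r * f.natDegree ≤ N by
          have := ((mem_majorIndex hr).1 hf).2.2
          omega), mul_sub, mul_left_comm _ (ballCorrection F k)],
      Finset.sum_sub_distrib, ← Finset.sum_mul, ← Finset.mul_sum, leadingConstant]
    ring
  rw [hmain, abs_neg, abs_mul, abs_of_nonneg hz', mul_assoc ((1 / zeta F r) ^ k)]
  refine mul_le_mul_of_nonneg_left ((abs_add_le _ _).trans ?_) hz'
  rw [add_mul, abs_mul, abs_mul, abs_mul (ballCorrection F k), abs_of_nonneg hbc,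
    abs_of_nonneg hsum0, abs_of_nonneg (show (0 : ℝ) ≤ Q ^ N by positivity)]
  refine add_le_add ?_ ?_
  · calc |B F k| * Q ^ N * |singularSeries F r k - ∑ f ∈ majorIndex F r x, singularTerm r k f|
        ≤ |B F k| * Q ^ N * (A * g * (U ^ x)⁻¹) := by gcongr
      _ = _ := by ring
  · rw [mul_assoc (ballCorrection F k)]
    exact mul_le_mul_of_nonneg_left hsum hbc

/-- The moment of the approximation of the critical order `1 + 1 / r`. -/
theorem exists_integral_approx_critical_le {r : ℕ} (hr : 2 ≤ r) :
    ∃ K : ℝ, 0 ≤ K ∧ ∀ N x : ℕ, 2 * x ≤ N →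
      ∫ α in torus F, ‖approx r N x α‖ ^ (1 + 1 / (r : ℝ)) ∂(haar F) ≤
        K * ((N + 1) * (Fintype.card F : ℝ) ^ ((N : ℝ) / r)) := by
  have hr0 : (0 : ℝ) < 1 / (r : ℝ) := by positivity
  set k : ℝ := 1 + 1 / (r : ℝ) with hk
  have hrel := card_rpow_pow_mul (F := F) (r := r) (by omega) k
  have hsT := fun f hf => singularTerm_le_inv_pow (F := F) hr (k := k) (by linarith) (f := f) hf
  set q : ℝ := (Fintype.card F : ℝ) with hqdef
  have hq : 2 ≤ q := two_le_card (F := F)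
  have hz := zeta_pos (F := F) hr
  set A : ℝ := (2 * zeta F r) ^ (k - 1) with hA
  have hA0 : 0 ≤ A := Real.rpow_nonneg (by linarith) _
  have hbc := ballCorrection_nonneg (F := F) (k := k) (by linarith)
  have hz' : 0 ≤ (1 / zeta F r) ^ k := by positivity
  simp only [show k - 1 - 1 / (r : ℝ) = 0 by rw [hk]; ring, Real.rpow_zero, one_pow,
    mul_one] at hrel
  refine ⟨(1 / zeta F r) ^ k * (A * |B F k|), by positivity, fun N x hx => ?_⟩
  have hQN : (q ^ (k - 1)) ^ N = q ^ ((N : ℝ) / r) := by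
    rw [← Real.rpow_mul_natCast (by linarith)]
    congr 1
    rw [hk]
    ring
  rw [integral_norm_approx_rpow hr hx (by linarith), mul_assoc]
  refine mul_le_mul_of_nonneg_left ?_ hz'
  calc ∑ f ∈ majorIndex F r x, singularTerm r k f * ballMoment F k N (N - x + r * f.natDegree)
      ≤ ∑ f ∈ majorIndex F r x, A * (q ^ f.natDegree)⁻¹ * (|B F k| * q ^ ((N : ℝ) / r)) := by
        refine Finset.sum_le_sum fun f hf => ?_
        obtain ⟨hfm, hfs, hfx⟩ := (mem_majorIndex hr).1 hf
        have h1 := hsT f hfm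
        rw [hrel] at h1
        refine mul_le_mul_of_nonneg h1 ?_ (singularTerm_nonneg hr k hfm) (by positivity)
        rw [ballMoment_eq (by linarith : 1 < k) (by omega), hQN]
        refine (sub_le_self _ (by positivity)).trans ?_
        gcongr
        exact le_abs_self _
    _ = (A * |B F k|) * q ^ ((N : ℝ) / r) * ∑ f ∈ majorIndex F r x, (q ^ f.natDegree)⁻¹ := by
        rw [Finset.mul_sum]
        exact Finset.sum_congr rfl fun f _ => by ring
    _ ≤ (A * |B F k|) * q ^ ((N : ℝ) / r) * (N + 1) := by
        gcongr
        refine (sum_natDegree_le (φ := fun j => (q ^ j)⁻¹) (fun j => by positivity)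
          (t := Finset.range (N + 1)) fun f hf => ?_).trans ?_
        · obtain ⟨hfm, -, hfx⟩ := (mem_majorIndex hr).1 hf
          have : f.natDegree ≤ r * f.natDegree := Nat.le_mul_of_pos_left _ (by omega)
          exact ⟨hfm, Finset.mem_range.2 (by omega)⟩
        · rw [Finset.sum_congr rfl fun j _ => mul_inv_cancel₀ (show q ^ j ≠ 0 by positivity)]
          simp
    _ = _ := by ring

end MainTerm

/-! ### The mixed moment of the approximation and its error -/

section Cross

variable {F : Type*} [Field F]

theorem ballInvariant_near {s : F[X]} (hs : s.Monic) : BallInvariant s.natDegree (near s) := by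
  intro α δ hδ
  rw [near, near, num_add hs α hδ]

variable [Fintype F]

/-- The function `q ^ depth N (res t α)`, which is essentially `min (q ^ N) (1 / |res t α|)`, on the
set of those `α` whose distance from the nearest fraction with denominator `s` is less than
`q ^ (-M)`, but whose nearest fraction with denominator `t` is a different one. -/
def separated (N M : ℕ) (s t : F[X]) (α : KInf F) : ℝ :=
  open Classical in if res s α ∈ ball F M ∧ near t α ≠ near s α then
    (Fintype.card F : ℝ) ^ depth N (res t α) else 0

theorem separated_nonneg (N M : ℕ) (s t : F[X]) (α : KInf F) : 0 ≤ separated N M s t α := by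
  unfold separated
  split_ifs <;> positivity

theorem ballInvariant_separated {N M : ℕ} {s t : F[X]} (hs : s.Monic) (ht : t.Monic)
    (hsN : s.natDegree ≤ N) (htN : t.natDegree ≤ N) (hM : M ≤ N) :
    BallInvariant N (separated N M s t) := by
  classical
  intro α δ hδ
  have h1 := (ballInvariant_near hs).mono hsN α δ hδ
  have h2 := (ballInvariant_near ht).mono htN α δ hδ
  have h3 : (res s (α + δ) ∈ ball F M) = (res s α ∈ ball F M) :=
    (ballInvariant_res_mem hs M).mono (max_le hsN hM) α δ hδ
  have h4 : depth N (res t (α + δ)) = depth N (res t α) :=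
    ((ballInvariant_depth N).comp_res ht).mono (max_le htN le_rfl) α δ hδ
  unfold separated
  rw [h1, h2, h3, h4]

/-- Distinct fractions with denominators `s` and `t` repel each other. If `α` is close to a
fraction over `s`, then its distance from a different fraction over `t` is either at least
`1 / |s t|`, or it is much smaller than the distance from the fraction over `s`, which happens on
a small set. -/
theorem integral_separated_le {N M : ℕ} {s t : F[X]} (hs : s.Monic) (ht : t.Monic)
    (hsN : s.natDegree ≤ N) (htN : t.natDegree ≤ N) (hM : M ≤ N) :
    ∫ α in torus F, separated N M s t α ∂(haar F) ≤ (N + 1 - M : ℕ) *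
      ((Fintype.card F : ℝ) ^ (2 * s.natDegree + t.natDegree) *
        ((Fintype.card F : ℝ) ^ M)⁻¹) := by
  classical
  have hq := two_le_card (F := F)
  set q : ℝ := (Fintype.card F : ℝ) with hqd
  have hq0 : 0 < q := by linarith
  have hq1 : 1 ≤ q := by linarith
  set S : ℕ → Set (KInf F) := fun i => if i = M then {α | res s α ∈ ball F M} else
    {α | res s α ∈ ball F M ∧ res t α ∈ ball F i} with hS
  set c : ℕ → ℝ := fun i => if i = M then q ^ (s.natDegree + t.natDegree) else
    if M < s.natDegree + t.natDegree then q ^ i else 0 with hc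
  have hc0 : ∀ i, 0 ≤ c i := fun i => by
    simp only [hc]
    split_ifs <;> positivity
  have hSm : ∀ i ∈ Finset.Icc M N, MeasurableSet (S i) := fun i _ => by
    simp only [hS]
    split_ifs
    · exact measurableSet_res_mem hs M
    · exact (measurableSet_res_mem hs M).inter (measurableSet_res_mem ht i)
  have hpt : ∀ α ∈ torus F, separated N M s t α ≤
      ∑ i ∈ Finset.Icc M N, (S i).indicator (fun _ => c i) α := by
    intro α _
    have hsum : ∀ i ∈ Finset.Icc M N, α ∈ S i →
        c i ≤ ∑ i ∈ Finset.Icc M N, (S i).indicator (fun _ => c i) α := fun i hi h => by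
      have := Finset.single_le_sum (f := fun i => (S i).indicator (fun _ => c i) α)
        (fun i _ => Set.indicator_nonneg (fun _ _ => hc0 i) _) hi
      simpa only [Set.indicator_of_mem h] using this
    unfold separated
    split_ifs with h
    · have hres := res_mem_ball_zero ht α
      by_cases hd : depth N (res t α) ≤ s.natDegree + t.natDegree
      · refine le_trans ?_ (hsum M (Finset.mem_Icc.2 ⟨le_rfl, hM⟩) (by simpa [hS] using h.1))
        simp only [hc, if_true]
        exact pow_le_pow_right₀ hq1 hd
      · have hlt : M < s.natDegree + t.natDegree := by
          by_contra hge
          have := lt_of_near_ne hs ht (Ne.symm h.2) (m := min M (depth N (res t α)))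
            (ball_anti (by exact_mod_cast min_le_left _ _) h.1)
            (ball_anti (by exact_mod_cast min_le_right _ _) (mem_ball_depth N hres))
          omega
        refine le_trans ?_ (hsum (depth N (res t α))
          (Finset.mem_Icc.2 ⟨by omega, depth_le _ _⟩) ?_)
        · simp only [hc]
          rw [if_neg (by omega), if_pos hlt]
        · simp only [hS]
          rw [if_neg (by omega)]
          exact ⟨h.1, mem_ball_depth N hres⟩
    · exact Finset.sum_nonneg fun i _ => Set.indicator_nonneg (fun _ _ => hc0 i) _
  refine (integral_le_sum_measure hSm (ballInvariant_separated hs ht hsN htN hM) hpt).trans ?_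
  rw [← Nat.card_Icc, ← nsmul_eq_mul]
  refine Finset.sum_le_card_nsmul _ _ _ fun i hi => ?_
  rw [Finset.mem_Icc] at hi
  simp only [hc, hS]
  split_ifs with h1 h2
  · refine (mul_le_mul_of_nonneg_left (real_haar_res_mem_le hs M) (by positivity)).trans_eq ?_
    rw [← hqd]
    ring
  · refine (mul_le_mul_of_nonneg_left (real_haar_pair_le hs ht hi.1) (by positivity)).trans ?_
    rw [← hqd, mul_left_comm, mul_inv_cancel₀ (by positivity), mul_one,
      ← div_eq_mul_inv, le_div_iff₀ (by positivity), ← pow_add]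
    exact pow_le_pow_right₀ hq1 (by omega)
  · rw [zero_mul]
    positivity

/-- A function that vanishes unless the distance of `α` from the nearest fraction with denominator
`f ^ r` is less than `q ^ (-M)`. At such points of the major arc of `f` it bounds the error of the
approximation. -/
def errorMajorant (r N M : ℕ) (f : F[X]) (α : KInf F) : ℝ :=
  open Classical in
  6 * (Fintype.card F : ℝ) ^ (N / r) * (if res (f ^ r) α ∈ ball F M then 1 else 0) +
    ∑ g ∈ monicUpTo F (N / r), 2 * wt r g * separated N M (f ^ r) (g ^ r) α

theorem errorMajorant_nonneg (r N M : ℕ) (f : F[X]) (α : KInf F) : 0 ≤ errorMajorant r N M f α :=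
  add_nonneg (mul_nonneg (by positivity) (by split_ifs <;> norm_num))
    (Finset.sum_nonneg fun g _ => mul_nonneg (mul_nonneg (by norm_num) (wt_pos r g).le)
      (separated_nonneg _ _ _ _ _))

theorem ballInvariant_errorMajorant {r N M : ℕ} (hr : 2 ≤ r) {f : F[X]} (hf : f.Monic)
    (hfN : r * f.natDegree ≤ N) (hM : M ≤ N) : BallInvariant N (errorMajorant r N M f) := by
  classical
  intro α δ hδ
  have h3 : (res (f ^ r) (α + δ) ∈ ball F M) = (res (f ^ r) α ∈ ball F M) :=
    (ballInvariant_res_mem (hf.pow r) M).mono (max_le (by rwa [hf.natDegree_pow]) hM) α δ hδ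
  unfold errorMajorant
  rw [Finset.sum_congr rfl fun g hg => by
    rw [ballInvariant_separated (hf.pow r) ((mem_monicUpTo.1 hg).1.pow r)
      (by rwa [hf.natDegree_pow])
      (by
        rw [(mem_monicUpTo.1 hg).1.natDegree_pow]
        exact le_of_mem_monicUpTo_div hr hg) hM α δ hδ]]
  simp only [h3]

/-- The weight `|g| ^ (-r)` cancels the number of numerators over `g ^ r`, so that only the number
of the `g` remains. -/
theorem integral_errorMajorant_le {r N M : ℕ} (hr : 2 ≤ r) {f : F[X]} (hf : f.Monic)
    (hfN : r * f.natDegree ≤ N) (hM : M ≤ N) :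
    ∫ α in torus F, errorMajorant r N M f α ∂(haar F) ≤ 10 * (Fintype.card F : ℝ) ^ (N / r) *
      ((N + 1 - M : ℕ) * ((Fintype.card F : ℝ) ^ (2 * (r * f.natDegree)) *
        ((Fintype.card F : ℝ) ^ M)⁻¹)) := by
  classical
  have hq := two_le_card (F := F)
  have hd : (f ^ r).natDegree = r * f.natDegree := hf.natDegree_pow r
  have hdg : ∀ g ∈ monicUpTo F (N / r), (g ^ r).natDegree ≤ N := fun g hg => by
    rw [(mem_monicUpTo.1 hg).1.natDegree_pow]
    exact le_of_mem_monicUpTo_div hr hg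
  have hind : (fun α : KInf F => if res (f ^ r) α ∈ ball F M then (1 : ℝ) else 0) =
      ({α | res (f ^ r) α ∈ ball F M} : Set (KInf F)).indicator 1 := by
    ext α
    simp [Set.indicator_apply]
  have hms := measurableSet_res_mem (hf.pow r) M
  have hi1 : Integrable (fun α : KInf F => if res (f ^ r) α ∈ ball F M then (1 : ℝ) else 0)
      ((haar F).restrict (torus F)) := by
    rw [hind]
    exact (integrable_const (1 : ℝ)).indicator hms
  have hi2 : ∀ g ∈ monicUpTo F (N / r), Integrable (separated N M (f ^ r) (g ^ r))
      ((haar F).restrict (torus F)) := fun g hg =>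
    (ballInvariant_separated (hf.pow r) ((mem_monicUpTo.1 hg).1.pow r) (by rwa [hd]) (hdg g hg)
      hM).integrableOn
  set q : ℝ := (Fintype.card F : ℝ) with hqd
  have hq0 : 0 < q := by linarith
  have hI1 : ∫ α in torus F, (if res (f ^ r) α ∈ ball F M then (1 : ℝ) else 0) ∂(haar F) ≤
      (N + 1 - M : ℕ) * (q ^ (2 * (r * f.natDegree)) * (q ^ M)⁻¹) := by
    rw [hind, integral_indicator_one hms, measureReal_restrict_apply hms, Set.inter_comm]
    refine (real_haar_res_mem_le (hf.pow r) M).trans ?_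
    rw [hd, ← hqd]
    have h1 : (1 : ℝ) ≤ (N + 1 - M : ℕ) := by exact_mod_cast (by omega)
    refine (mul_le_mul_of_nonneg_right (pow_le_pow_right₀ (by linarith)
      (show r * f.natDegree ≤ 2 * (r * f.natDegree) by omega)) (by positivity)).trans ?_
    exact le_mul_of_one_le_left (by positivity) h1
  unfold errorMajorant
  rw [integral_add (hi1.const_mul _) (integrable_finsetSum _ fun g hg => (hi2 g hg).const_mul _),
    integral_const_mul, integral_finsetSum _ fun g hg => (hi2 g hg).const_mul _, ← hqd]
  set Y : ℝ := (N + 1 - M : ℕ) * (q ^ (2 * (r * f.natDegree)) * (q ^ M)⁻¹) with hY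
  have hY0 : 0 ≤ Y := by positivity
  have hsum : ∑ g ∈ monicUpTo F (N / r),
      ∫ α in torus F, 2 * wt r g * separated N M (f ^ r) (g ^ r) α ∂(haar F) ≤
      4 * q ^ (N / r) * Y := by
    calc _ ≤ ∑ g ∈ monicUpTo F (N / r), 2 * Y := by
          refine Finset.sum_le_sum fun g hg => ?_
          have hgm := (mem_monicUpTo.1 hg).1
          rw [integral_const_mul]
          refine (mul_le_mul_of_nonneg_left (integral_separated_le (hf.pow r) (hgm.pow r)
            (by rwa [hd]) (hdg g hg) hM) (mul_nonneg (by norm_num) (wt_pos r g).le)).trans_eq ?_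
          rw [wt_eq r hgm, hd, ← hqd, hY, pow_add]
          field_simp
      _ ≤ _ := by
          rw [Finset.sum_const, nsmul_eq_mul]
          have := card_monicUpTo_le (F := F) (N / r)
          rw [← hqd] at this
          nlinarith
  have h6 := mul_le_mul_of_nonneg_left hI1 (show 0 ≤ 6 * q ^ (N / r) by positivity)
  linarith

/-- On the major arcs, the product of the approximation with its error is dominated by a sum that
can be integrated term by term. -/
theorem norm_approx_rpow_mul_error_le {r N x : ℕ} (hr : 2 ≤ r) (hx : 2 * x ≤ N) {k : ℝ}
    (hk : 1 < k) (α : KInf F) :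
    ‖approx r N x α‖ ^ (k - 1) * ‖G r N α - approx r N x α‖ ≤
      ∑ f ∈ majorIndex F r x, ∑ M ∈ Finset.Icc (N - x + r * f.natDegree) N,
        4 ^ (k - 1) * ((((Fintype.card F : ℝ) ^ (k - 1)) ^ (r * f.natDegree))⁻¹ *
          ((Fintype.card F : ℝ) ^ (k - 1)) ^ M) * errorMajorant r N M f α := by
  classical
  have hq := two_le_card (F := F)
  have hk0 : 0 < k - 1 := by linarith
  have hnn : ∀ f ∈ majorIndex F r x, ∀ M ∈ Finset.Icc (N - x + r * f.natDegree) N,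
      0 ≤ 4 ^ (k - 1) * ((((Fintype.card F : ℝ) ^ (k - 1)) ^ (r * f.natDegree))⁻¹ *
          ((Fintype.card F : ℝ) ^ (k - 1)) ^ M) * errorMajorant r N M f α := fun f _ M _ =>
    mul_nonneg (by positivity) (errorMajorant_nonneg _ _ _ _ _)
  by_cases h : ∃ f ∈ majorIndex F r x, Active r N x f α
  · obtain ⟨f, hf, ha⟩ := h
    obtain ⟨hfm, hfs, hfx⟩ := (mem_majorIndex hr).1 hf
    have hres := res_mem_ball_zero (hfm.pow r) α
    set M := depth N (res (f ^ r) α) with hM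
    have hMmem : M ∈ Finset.Icc (N - x + r * f.natDegree) N :=
      Finset.mem_Icc.2 ⟨(le_depth_iff (by omega) hres).2 ha.2, depth_le _ _⟩
    refine le_trans ?_ (Finset.single_le_sum (fun f hf => Finset.sum_nonneg (hnn f hf)) hf)
    refine le_trans ?_ (Finset.single_le_sum (hnn f hf) hMmem)
    have hE := norm_G_sub_approx_le_of_active hr hx hf ha
    refine mul_le_mul ?_ (hE.trans_eq ?_) (norm_nonneg _) (by positivity)
    · have h1 : ‖approx r N x α‖ ≤
          4 * (((Fintype.card F : ℝ) ^ (r * f.natDegree))⁻¹ * (Fintype.card F : ℝ) ^ M) := by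
        rw [approx_eq hr hx hf ha, norm_mul, Complex.norm_real, Real.norm_eq_abs]
        refine (mul_le_mul (abs_coefC_le hr hfm) (norm_compSum_le N hres) (norm_nonneg _)
          (mul_nonneg (by norm_num) (wt_pos r f).le)).trans_eq ?_
        rw [wt]
        ring
      refine (Real.rpow_le_rpow (norm_nonneg _) h1 hk0.le).trans_eq ?_
      have hq0 : (0 : ℝ) ≤ Fintype.card F := by linarith
      rw [Real.mul_rpow (by norm_num) (by positivity),
        Real.mul_rpow (by positivity) (by positivity), Real.inv_rpow (by positivity),
        ← Real.rpow_natCast, ← Real.rpow_natCast,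
        ← Real.rpow_mul hq0, ← Real.rpow_mul hq0, ← Real.rpow_mul_natCast hq0,
        ← Real.rpow_mul_natCast hq0, mul_comm (k - 1), mul_comm (k - 1)]
    · rw [errorMajorant, if_pos (mem_ball_depth N hres), mul_one, Finset.sum_filter]
      congr 1
      refine Finset.sum_congr rfl fun g _ => ?_
      rw [separated]
      simp only [show res (f ^ r) α ∈ ball F M from mem_ball_depth N hres, true_and]
      split_ifs <;> ring
  · push Not at h
    rw [approx_eq_zero h, norm_zero, Real.zero_rpow hk0.ne', zero_mul]
    exact Finset.sum_nonneg fun f hf => Finset.sum_nonneg (hnn f hf)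

/-- The sum over degrees that bounds the mixed moment of the approximation and its error. -/
def crossSum (q Q U : ℝ) (r N x : ℕ) : ℝ :=
  ∑ j ∈ Finset.range (x / r + 1), ∑ M ∈ Finset.Icc (N - x + r * j) N,
    (N + 1 - M : ℕ) * ((U ^ (r * j))⁻¹ * q ^ (2 * (r * j)) * (Q ^ M * (q ^ M)⁻¹))

theorem integral_norm_approx_rpow_mul_error_le {r N x : ℕ} (hr : 2 ≤ r) (hx : 2 * x ≤ N) {k : ℝ}
    (hk : 1 < k) :
    ∫ α in torus F, ‖approx r N x α‖ ^ (k - 1) * ‖G r N α - approx r N x α‖ ∂(haar F) ≤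
      4 ^ (k - 1) * (10 * (Fintype.card F : ℝ) ^ (N / r)) *
        crossSum (Fintype.card F) ((Fintype.card F : ℝ) ^ (k - 1))
          ((Fintype.card F : ℝ) ^ (k - 1 - 1 / (r : ℝ))) r N x := by
  classical
  have hrel := card_rpow_pow_mul (F := F) (r := r) (by omega) k
  have hU0 : 0 < (Fintype.card F : ℝ) ^ (k - 1 - 1 / (r : ℝ)) :=
    Real.rpow_pos_of_pos (by have := two_le_card (F := F); linarith) _
  have hQ0 : 0 < (Fintype.card F : ℝ) ^ (k - 1) :=
    Real.rpow_pos_of_pos (by have := two_le_card (F := F); linarith) _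
  have hinv : BallInvariant (N + 1) fun α : KInf F =>
      ‖approx r N x α‖ ^ (k - 1) * ‖G r N α - approx r N x α‖ := fun α δ hδ => by
    dsimp only
    rw [ballInvariant_approx hr (by omega : x ≤ N) α δ hδ, ballInvariant_G r N α δ hδ]
  have hbd : ∀ f ∈ majorIndex F r x, ∀ M ∈ Finset.Icc (N - x + r * f.natDegree) N,
      BallInvariant N (errorMajorant r N M f) := fun f hf M hM => by
    obtain ⟨hfm, hfs, hfx⟩ := (mem_majorIndex hr).1 hf
    exact ballInvariant_errorMajorant hr hfm (by omega) (Finset.mem_Icc.1 hM).2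
  have hint := fun f hf M hM => (hbd f hf M hM).integrableOn.const_mul
    (4 ^ (k - 1) * ((((Fintype.card F : ℝ) ^ (k - 1)) ^ (r * f.natDegree))⁻¹ *
          ((Fintype.card F : ℝ) ^ (k - 1)) ^ M))
  refine (setIntegral_mono_on hinv.integrableOn (integrable_finsetSum _ fun f hf =>
    integrable_finsetSum _ (hint f hf)) (isOpen_torus F).measurableSet
    fun α _ => norm_approx_rpow_mul_error_le hr hx hk α).trans ?_
  rw [integral_finsetSum _ fun f hf => integrable_finsetSum _ (hint f hf)]
  set q : ℝ := (Fintype.card F : ℝ) with hqd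
  have hq : 2 ≤ q := two_le_card
  set Q : ℝ := q ^ (k - 1) with hQd
  set U : ℝ := q ^ (k - 1 - 1 / (r : ℝ)) with hUd
  set φ : ℕ → ℝ := fun j => ∑ M ∈ Finset.Icc (N - x + r * j) N,
    4 ^ (k - 1) * ((Q ^ (r * j))⁻¹ * Q ^ M) *
      (10 * q ^ (N / r) * ((N + 1 - M : ℕ) * (q ^ (2 * (r * j)) * (q ^ M)⁻¹))) with hφ
  have hφ0 : ∀ j, 0 ≤ φ j := fun j => Finset.sum_nonneg fun M _ => by positivity
  calc _ ≤ ∑ f ∈ majorIndex F r x, φ f.natDegree := by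
        refine Finset.sum_le_sum fun f hf => ?_
        obtain ⟨hfm, hfs, hfx⟩ := (mem_majorIndex hr).1 hf
        rw [integral_finsetSum _ (hint f hf)]
        refine Finset.sum_le_sum fun M hM => ?_
        rw [integral_const_mul]
        exact mul_le_mul_of_nonneg_left (integral_errorMajorant_le hr hfm (by omega)
          (Finset.mem_Icc.1 hM).2) (by positivity)
    _ ≤ ∑ j ∈ Finset.range (x / r + 1), q ^ j * φ j := by
        refine sum_natDegree_le hφ0 fun f hf => ?_
        obtain ⟨hfm, hfs, hfx⟩ := (mem_majorIndex hr).1 hf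
        refine ⟨hfm, Finset.mem_range.2 (Nat.lt_succ_iff.2 ?_)⟩
        rwa [Nat.le_div_iff_mul_le (by omega), mul_comm]
    _ = _ := by
        rw [crossSum, Finset.mul_sum]
        refine Finset.sum_congr rfl fun j _ => ?_
        rw [hφ, Finset.mul_sum, Finset.mul_sum]
        refine Finset.sum_congr rfl fun M _ => ?_
        rw [hrel]
        field_simp

end Cross

/-! ### Elementary inequalities -/

section Inequalities

theorem rpow_sub_rpow_le {a b k : ℝ} (hb : 0 ≤ b) (hab : b ≤ a) (hk : 1 ≤ k) :
    a ^ k - b ^ k ≤ k * (a ^ (k - 1) * (a - b)) := by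
  rcases hb.eq_or_lt with rfl | hb0
  · rcases hab.eq_or_lt with rfl | ha
    · simp
    · rw [Real.zero_rpow (by linarith), sub_zero, sub_zero, Real.rpow_sub_one ha.ne',
        div_mul_cancel₀ _ ha.ne']
      exact le_mul_of_one_le_left (Real.rpow_nonneg ha.le _) hk
  · have ha : 0 < a := hb0.trans_le hab
    have h := one_add_mul_self_le_rpow_one_add (s := b / a - 1)
      (by have : 0 ≤ b / a := by positivity
          linarith) hk
    rw [add_sub_cancel, Real.div_rpow hb ha.le, le_div_iff₀ (Real.rpow_pos_of_pos ha _)] at h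
    have h2 : a ^ k = a ^ (k - 1) * a := by
      rw [Real.rpow_sub_one ha.ne', div_mul_cancel₀ _ ha.ne']
    have h3 : (1 + k * (b / a - 1)) * a ^ k = a ^ k - k * (a ^ (k - 1) * (a - b)) := by
      rw [h2]
      field_simp
      ring
    linarith

theorem add_rpow_le_two_rpow_mul {a b p : ℝ} (ha : 0 ≤ a) (hb : 0 ≤ b) (hp : 0 ≤ p) :
    (a + b) ^ p ≤ 2 ^ p * (a ^ p + b ^ p) := by
  have h1 : 0 ≤ a ^ p := Real.rpow_nonneg ha p
  have h2 : 0 ≤ b ^ p := Real.rpow_nonneg hb p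
  have h3 : (0 : ℝ) ≤ 2 ^ p := by positivity
  rcases le_total a b with h | h
  · refine (Real.rpow_le_rpow (by linarith) (show a + b ≤ 2 * b by linarith) hp).trans ?_
    rw [Real.mul_rpow (by norm_num) hb]
    exact mul_le_mul_of_nonneg_left (by linarith) h3
  · refine (Real.rpow_le_rpow (by linarith) (show a + b ≤ 2 * a by linarith) hp).trans ?_
    rw [Real.mul_rpow (by norm_num) ha]
    exact mul_le_mul_of_nonneg_left (by linarith) h3

/-- A version of the mean value theorem for `|z| ^ k`, with the increment `z - w` separated from
`w`. -/
theorem abs_norm_rpow_sub_le {k : ℝ} (hk : 1 < k) (z w : ℂ) :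
    |‖z‖ ^ k - ‖w‖ ^ k| ≤
      k * 2 ^ (k - 1) * (‖w‖ ^ (k - 1) * ‖z - w‖ + ‖z - w‖ ^ k) := by
  have hd := abs_norm_sub_norm_le z w
  have hz : ‖z‖ ≤ ‖w‖ + ‖z - w‖ := by
    have := norm_add_le w (z - w)
    rwa [add_sub_cancel] at this
  have hmax : ∀ m : ℝ, 0 ≤ m → m ≤ ‖w‖ + ‖z - w‖ →
      k * (m ^ (k - 1) * |‖z‖ - ‖w‖|) ≤
        k * 2 ^ (k - 1) * (‖w‖ ^ (k - 1) * ‖z - w‖ + ‖z - w‖ ^ k) := fun m hm0 hm => by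
    have h1 : m ^ (k - 1) ≤ 2 ^ (k - 1) * (‖w‖ ^ (k - 1) + ‖z - w‖ ^ (k - 1)) :=
      (Real.rpow_le_rpow hm0 hm (by linarith)).trans
        (add_rpow_le_two_rpow_mul (norm_nonneg _) (norm_nonneg _) (by linarith))
    have h2 : ‖z - w‖ ^ (k - 1) * ‖z - w‖ = ‖z - w‖ ^ k := by
      rw [← Real.rpow_add_one' (norm_nonneg _) (by linarith), sub_add_cancel]
    calc k * (m ^ (k - 1) * |‖z‖ - ‖w‖|)
        ≤ k * (2 ^ (k - 1) * (‖w‖ ^ (k - 1) + ‖z - w‖ ^ (k - 1)) * ‖z - w‖) := by gcongr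
      _ = _ := by
        rw [← h2]
        ring
  rcases le_total ‖w‖ ‖z‖ with h | h
  · have h0 := Real.rpow_le_rpow (norm_nonneg w) h (by linarith : 0 ≤ k)
    rw [abs_of_nonneg (by linarith)]
    refine (rpow_sub_rpow_le (norm_nonneg w) h hk.le).trans ?_
    have := hmax ‖z‖ (norm_nonneg _) hz
    rwa [abs_of_nonneg (by linarith : 0 ≤ ‖z‖ - ‖w‖)] at this
  · have h0 := Real.rpow_le_rpow (norm_nonneg z) h (by linarith : 0 ≤ k)
    rw [abs_sub_comm, abs_of_nonneg (by linarith)]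
    refine (rpow_sub_rpow_le (norm_nonneg z) h hk.le).trans ?_
    have := hmax ‖w‖ (norm_nonneg _) (by linarith [norm_nonneg (z - w)])
    rwa [abs_sub_comm, abs_of_nonneg (by linarith : 0 ≤ ‖w‖ - ‖z‖)] at this

/-- By Bernoulli's inequality, `q ^ (δ / 3 * N)` grows at least linearly in `N`. -/
theorem exists_pow_three_le_rpow {q δ : ℝ} (hq : 1 < q) (hδ : 0 < δ) :
    ∃ K : ℝ, 0 ≤ K ∧ ∀ N : ℕ, ((N : ℝ) + 1) ^ 3 ≤ K * q ^ ((N : ℝ) * δ) := by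
  set b : ℝ := q ^ (δ / 3) with hb
  have hb1 : 1 < b := Real.one_lt_rpow hq (by positivity)
  set m : ℝ := min 1 (b - 1) with hm
  have hm0 : 0 < m := lt_min one_pos (by linarith)
  refine ⟨(m ^ 3)⁻¹, by positivity, fun N => ?_⟩
  have h1 : ((N : ℝ) + 1) * m ≤ b ^ N := by
    have h2 := one_add_mul_sub_le_pow (a := b) (by linarith) N
    have h3 : (N : ℝ) * m ≤ N * (b - 1) :=
      mul_le_mul_of_nonneg_left (min_le_right _ _) (Nat.cast_nonneg N)
    have h4 : m ≤ 1 := min_le_left _ _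
    nlinarith
  have h5 : q ^ ((N : ℝ) * δ) = (b ^ N) ^ 3 := by
    rw [← pow_mul, hb, ← Real.rpow_mul_natCast (by linarith)]
    congr 1
    push_cast
    ring
  rw [h5, inv_mul_eq_div, le_div_iff₀ (by positivity), ← mul_pow]
  exact pow_le_pow_left₀ (by positivity) h1 3

end Inequalities

/-! ### Comparison of exponents -/

section Exponents

theorem theta_zero_pos {r : ℕ} (hr : 2 ≤ r) {k : ℝ} (hk : 1 + 1 / (r : ℝ) < k) :
    0 < theta r k 0 := by
  have hr' : 1 / (r : ℝ) ≤ 1 / 2 :=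
    one_div_le_one_div_of_le (by norm_num) (by exact_mod_cast hr)
  have hr0 : 0 < 1 / (r : ℝ) := by positivity
  have hc : 0 < 1 - 1 / (r : ℝ) := by linarith
  have hu : 0 < k - 1 - 1 / (r : ℝ) := by linarith
  unfold theta
  split_ifs with h1 h2
  · exact hc
  · rw [sub_zero]
    positivity
  · rw [sub_zero]
    have : 0 < (1 - 1 / (r : ℝ)) * (k - 1 - 1 / (r : ℝ)) + (3 - k) :=
      add_pos_of_pos_of_nonneg (by positivity) (by linarith)
    positivity

/-- Half of the product of `1 - 1 / r` and `k - 1 - 1 / r` is at least the exponent `θ` also in the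
range `k ≤ 2 + 1 / r`. -/
theorem theta_le {r : ℕ} (hr : 2 ≤ r) {k ε : ℝ} (hk : 1 + 1 / (r : ℝ) < k)
    (hk3 : k ≤ 3 + 1 / (r : ℝ)) :
    theta r k ε ≤ (1 - 1 / (r : ℝ)) * (k - 1 - 1 / (r : ℝ)) / 2 - ε := by
  have hr' : 1 / (r : ℝ) ≤ 1 / 2 :=
    one_div_le_one_div_of_le (by norm_num) (by exact_mod_cast hr)
  have hr0 : 0 < 1 / (r : ℝ) := by positivity
  set c : ℝ := 1 / (r : ℝ) with hcdef
  have hc : 0 < 1 - c := by linarith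
  have hu : 0 < k - 1 - c := by linarith
  rw [theta, if_neg (not_lt.2 hk3), ← hcdef]
  split_ifs with h2
  · exact le_of_eq (by ring)
  · have hd : 0 < (1 - c) * (k - 1 - c) + (3 - k) :=
      add_pos_of_pos_of_nonneg (by positivity) (by linarith)
    refine sub_le_sub_right ?_ ε
    rw [div_le_div_iff₀ hd two_pos]
    -- the denominator exceeds `2 (1 - c)` by `c (2 + c - k)`
    have h3 : 0 ≤ (1 - c) * (k - 1 - c) * (c * (2 + c - k)) :=
      mul_nonneg (by positivity) (mul_nonneg hr0.le (by linarith))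
    nlinarith [h3]

theorem crossSum_term_eq {q : ℝ} (hq : 0 < q) (r j M : ℕ) (k : ℝ) :
    ((q ^ (k - 1 - 1 / (r : ℝ))) ^ (r * j))⁻¹ * q ^ (2 * (r * j)) *
      ((q ^ (k - 1)) ^ M * (q ^ M)⁻¹) =
        q ^ ((3 + 1 / (r : ℝ) - k) * (r * j : ℕ) + (k - 2) * (M : ℝ)) := by
  rw [← Real.rpow_mul_natCast hq.le, ← Real.rpow_mul_natCast hq.le, ← Real.rpow_natCast q (2 * _),
    ← Real.rpow_natCast q M, ← Real.rpow_neg hq.le, ← Real.rpow_neg hq.le, ← Real.rpow_add hq,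
    ← Real.rpow_add hq, ← Real.rpow_add hq]
  congr 1
  push_cast
  ring

theorem pow_div_le_rpow {q : ℝ} (hq : 1 ≤ q) {r : ℕ} (N : ℕ) :
    q ^ (N / r) ≤ q ^ ((N : ℝ) / r) := by
  rw [← Real.rpow_natCast]
  exact Real.rpow_le_rpow_of_exponent_le hq Nat.cast_div_le

/-- For `k ≤ 3 + 1 / r` the bound for the terms of the sum grows towards the boundary of the major
arcs, where the condition on `x` makes it match the other errors. -/
theorem crossSum_le {q k : ℝ} (hq : 1 ≤ q) {r N x : ℕ} (hr : 2 ≤ r)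
    (hx : 2 * r * x ≤ (r - 1) * N) (hk3 : k ≤ 3 + 1 / (r : ℝ)) :
    q ^ (N / r) * crossSum q (q ^ (k - 1)) (q ^ (k - 1 - 1 / (r : ℝ))) r N x ≤
      ((N : ℝ) + 1) ^ 3 * ((q ^ (k - 1)) ^ N * ((q ^ (k - 1 - 1 / (r : ℝ))) ^ x)⁻¹) := by
  have hq0 : 0 < q := by linarith
  have hxN := two_mul_le_of_le hr hx
  have hr0 : (0 : ℝ) < r := by exact_mod_cast (by omega : 0 < r)
  have hxc : 2 * (x : ℝ) ≤ (1 - 1 / (r : ℝ)) * N := by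
    have h1 : 2 * (r : ℝ) * x ≤ ((r : ℝ) - 1) * N := by
      have : ((2 * r * x : ℕ) : ℝ) ≤ (((r - 1) * N : ℕ) : ℝ) := by exact_mod_cast hx
      push_cast [Nat.cast_sub (show 1 ≤ r by omega)] at this
      exact this
    have h2 : (1 - 1 / (r : ℝ)) * N = ((r : ℝ) - 1) * N / r := by field_simp
    rw [h2, le_div_iff₀ hr0]
    linarith
  set Z : ℝ := (q ^ (k - 1)) ^ N * ((q ^ (k - 1 - 1 / (r : ℝ))) ^ x)⁻¹ with hZ
  have hZ0 : 0 ≤ Z := by positivity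
  have hterm : ∀ j ∈ Finset.range (x / r + 1), ∀ M ∈ Finset.Icc (N - x + r * j) N,
      q ^ (N / r) * ((N + 1 - M : ℕ) * (((q ^ (k - 1 - 1 / (r : ℝ))) ^ (r * j))⁻¹ *
        q ^ (2 * (r * j)) * ((q ^ (k - 1)) ^ M * (q ^ M)⁻¹))) ≤ (N + 1) * Z := by
    intro j hj M hM
    rw [Finset.mem_Icc] at hM
    have hN1 : ((N + 1 - M : ℕ) : ℝ) ≤ N + 1 := by exact_mod_cast Nat.sub_le _ _
    have hmain : q ^ (N / r) * (((q ^ (k - 1 - 1 / (r : ℝ))) ^ (r * j))⁻¹ *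
        q ^ (2 * (r * j)) * ((q ^ (k - 1)) ^ M * (q ^ M)⁻¹)) ≤ Z := by
      rw [crossSum_term_eq hq0 r j M k]
      refine (mul_le_mul_of_nonneg_right (pow_div_le_rpow hq N) (by positivity)).trans ?_
      rw [hZ, ← Real.rpow_mul_natCast hq0.le, ← Real.rpow_mul_natCast hq0.le,
        ← Real.rpow_neg hq0.le, ← Real.rpow_add hq0, ← Real.rpow_add hq0]
      refine Real.rpow_le_rpow_of_exponent_le hq ?_
      have h1 : (N : ℝ) + (r * j : ℕ) ≤ M + x := by exact_mod_cast (by omega)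
      have h2 : (M : ℝ) ≤ N := by exact_mod_cast hM.2
      have h3 : (N : ℝ) / r = 1 / r * N := by ring
      set D : ℝ := ((r * j : ℕ) : ℝ)
      rw [h3]
      set c : ℝ := 1 / (r : ℝ)
      have hc0 : 0 < c := by positivity
      -- the two slacks: the position of `M` in its range, and the distance from its upper end
      nlinarith [mul_nonneg (sub_nonneg.2 hk3) (sub_nonneg.2 h1),
        mul_nonneg (show 0 ≤ 1 + c by linarith) (sub_nonneg.2 h2)]
    calc _ = ((N + 1 - M : ℕ) : ℝ) * (q ^ (N / r) * (((q ^ (k - 1 - 1 / (r : ℝ))) ^ (r * j))⁻¹ *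
        q ^ (2 * (r * j)) * ((q ^ (k - 1)) ^ M * (q ^ M)⁻¹))) := by ring
      _ ≤ (N + 1) * Z := mul_le_mul hN1 hmain (by positivity) (by positivity)
  rw [crossSum, Finset.mul_sum]
  calc _ ≤ ∑ j ∈ Finset.range (x / r + 1), ((N : ℝ) + 1) * ((N + 1) * Z) := by
        refine Finset.sum_le_sum fun j hj => ?_
        rw [Finset.mul_sum]
        refine (Finset.sum_le_card_nsmul _ _ _ (hterm j hj)).trans ?_
        rw [nsmul_eq_mul, Nat.card_Icc]
        refine mul_le_mul_of_nonneg_right ?_ (by positivity)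
        exact_mod_cast Nat.sub_le _ _
    _ ≤ ((N : ℝ) + 1) * (((N : ℝ) + 1) * ((N + 1) * Z)) := by
        rw [Finset.sum_const, nsmul_eq_mul, Finset.card_range]
        refine mul_le_mul_of_nonneg_right ?_ (by positivity)
        have : x / r ≤ x := Nat.div_le_self x r
        exact_mod_cast (by omega : x / r + 1 ≤ N + 1)
    _ = _ := by ring

/-- For `k > 3 + 1 / r` the terms of the sum decay geometrically from the center of the major arc of
`f = 1`. -/
theorem exists_crossSum_le {q k : ℝ} (hq : 1 < q) {r : ℕ} (hr : 2 ≤ r)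
    (hk3 : 3 + 1 / (r : ℝ) < k) :
    ∃ K : ℝ, 0 ≤ K ∧ ∀ N x : ℕ,
      q ^ (N / r) * crossSum q (q ^ (k - 1)) (q ^ (k - 1 - 1 / (r : ℝ))) r N x ≤
        K * q ^ ((N : ℝ) * (k - 1 - (1 - 1 / (r : ℝ)))) := by
  have hq0 : 0 < q := by linarith
  have hr1 : (1 : ℝ) ≤ r := by exact_mod_cast (by omega : 1 ≤ r)
  have hc0 : 0 < 1 / (r : ℝ) := by positivity
  set a : ℝ := q ^ ((3 + 1 / (r : ℝ) - k) * r) with ha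
  set b : ℝ := q ^ (2 - k) with hb
  have ha1 : a < 1 := Real.rpow_lt_one_of_one_lt_of_neg hq (by nlinarith)
  have hb1 : b < 1 := Real.rpow_lt_one_of_one_lt_of_neg hq (by linarith)
  have ha0 : 0 < a := Real.rpow_pos_of_pos hq0 _
  have hb0 : 0 < b := Real.rpow_pos_of_pos hq0 _
  have hsa : Summable fun j : ℕ => a ^ j := summable_geometric_of_lt_one ha0.le ha1
  have hsb : Summable fun y : ℕ => ((y : ℝ) + 1) * b ^ y := by
    have h1 := summable_pow_mul_geometric_of_norm_lt_one 1
      (show ‖b‖ < 1 by rwa [Real.norm_of_nonneg hb0.le])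
    refine (h1.add (summable_geometric_of_lt_one hb0.le hb1)).congr fun y => ?_
    rw [pow_one]
    ring
  refine ⟨(∑' j : ℕ, a ^ j) * ∑' y : ℕ, ((y : ℝ) + 1) * b ^ y,
    mul_nonneg (tsum_nonneg fun _ => by positivity) (tsum_nonneg fun _ => by positivity),
    fun N x => ?_⟩
  set Z : ℝ := q ^ ((N : ℝ) * (k - 1 - (1 - 1 / (r : ℝ)))) with hZ
  have hZ0 : 0 ≤ Z := by positivity
  have hterm : ∀ j M : ℕ, M ≤ N →
      q ^ (N / r) * ((N + 1 - M : ℕ) * (((q ^ (k - 1 - 1 / (r : ℝ))) ^ (r * j))⁻¹ *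
        q ^ (2 * (r * j)) * ((q ^ (k - 1)) ^ M * (q ^ M)⁻¹))) ≤
      Z * a ^ j * ((((N - M : ℕ) : ℝ) + 1) * b ^ (N - M)) := by
    intro j M hM
    have hN1 : ((N + 1 - M : ℕ) : ℝ) = ((N - M : ℕ) : ℝ) + 1 := by
      rw [Nat.succ_sub hM]
      push_cast
      rfl
    rw [crossSum_term_eq hq0 r j M k, hN1]
    refine (mul_le_mul_of_nonneg_right (pow_div_le_rpow hq.le N) (by positivity)).trans_eq ?_
    have h1 : q ^ ((N : ℝ) / r) *
        q ^ ((3 + 1 / (r : ℝ) - k) * (r * j : ℕ) + (k - 2) * (M : ℝ)) =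
        Z * a ^ j * b ^ (N - M) := by
      rw [hZ, ha, hb, ← Real.rpow_mul_natCast hq0.le, ← Real.rpow_mul_natCast hq0.le,
        ← Real.rpow_add hq0, ← Real.rpow_add hq0, ← Real.rpow_add hq0, Nat.cast_sub hM]
      congr 1
      push_cast
      ring
    linear_combination (((N - M : ℕ) : ℝ) + 1) * h1
  rw [crossSum, Finset.mul_sum]
  calc _ ≤ ∑ j ∈ Finset.range (x / r + 1), Z * a ^ j * ∑' y : ℕ, ((y : ℝ) + 1) * b ^ y := by
        refine Finset.sum_le_sum fun j _ => ?_
        rw [Finset.mul_sum]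
        refine (Finset.sum_le_sum fun M hM => hterm j M (Finset.mem_Icc.1 hM).2).trans ?_
        rw [← Finset.mul_sum]
        refine mul_le_mul_of_nonneg_left ?_ (by positivity)
        rw [← Finset.sum_image (s := Finset.Icc (N - x + r * j) N) (g := fun M => N - M)
          (f := fun y : ℕ => ((y : ℝ) + 1) * b ^ y)]
        · exact hsb.sum_le_tsum _ fun _ _ => by positivity
        · intro M hM M' hM' h
          have h1 := (Finset.mem_Icc.1 hM).2
          have h2 := (Finset.mem_Icc.1 hM').2
          simp only at h
          omega
    _ = (Z * ∑' y : ℕ, ((y : ℝ) + 1) * b ^ y) * ∑ j ∈ Finset.range (x / r + 1), a ^ j := by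
        rw [Finset.mul_sum]
        exact Finset.sum_congr rfl fun j _ => by ring
    _ ≤ (Z * ∑' y : ℕ, ((y : ℝ) + 1) * b ^ y) * ∑' j : ℕ, a ^ j :=
        mul_le_mul_of_nonneg_left (hsa.sum_le_tsum _ fun _ _ => by positivity)
          (mul_nonneg hZ0 (tsum_nonneg fun _ => by positivity))
    _ = _ := by ring

end Exponents

/-! ### The moments of the error -/

section Moments

variable {F : Type*} [Field F] [Fintype F]

theorem exists_integral_error_critical_le {r : ℕ} (hr : 2 ≤ r) :
    ∃ K : ℝ, 0 ≤ K ∧ ∀ N x : ℕ, 2 * x ≤ N →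
      ∫ α in torus F, ‖G r N α - approx r N x α‖ ^ (1 + 1 / (r : ℝ)) ∂(haar F) ≤
        K * (((N : ℝ) + 1) ^ 3 * (Fintype.card F : ℝ) ^ ((N : ℝ) / r)) := by
  obtain ⟨K, hK0, hK⟩ := exists_integral_approx_critical_le (F := F) hr
  have hr0 : (0 : ℝ) ≤ 1 / (r : ℝ) := by positivity
  set κ : ℝ := 1 + 1 / (r : ℝ) with hκ
  have h2 : (0 : ℝ) ≤ 2 ^ κ := by positivity
  refine ⟨2 ^ κ * (7 + K), by positivity, fun N x hx => ?_⟩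
  have hG : BallInvariant (N + 1) fun α : KInf F => ‖G r N α‖ ^ κ :=
    (ballInvariant_G r N).comp fun z => ‖z‖ ^ κ
  have hA : BallInvariant (N + 1) fun α : KInf F => ‖approx r N x α‖ ^ κ :=
    (ballInvariant_approx hr (by omega)).comp fun z => ‖z‖ ^ κ
  have hE : BallInvariant (N + 1) fun α : KInf F => ‖G r N α - approx r N x α‖ ^ κ :=
    fun α δ hδ => by
      dsimp only
      rw [ballInvariant_G r N α δ hδ, ballInvariant_approx hr (by omega : x ≤ N) α δ hδ]
  have hN1 : (1 : ℝ) ≤ (N : ℝ) + 1 := by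
    have : (0 : ℝ) ≤ N := Nat.cast_nonneg N
    linarith
  calc ∫ α in torus F, ‖G r N α - approx r N x α‖ ^ κ ∂(haar F)
      ≤ ∫ α in torus F, 2 ^ κ * (‖G r N α‖ ^ κ + ‖approx r N x α‖ ^ κ) ∂(haar F) := by
        refine integral_mono hE.integrableOn
          ((hG.integrableOn.add hA.integrableOn).const_mul _) fun α => ?_
        exact (Real.rpow_le_rpow (norm_nonneg _) (norm_sub_le _ _) (by linarith)).trans
          (add_rpow_le_two_rpow_mul (norm_nonneg _) (norm_nonneg _) (by linarith))
    _ = 2 ^ κ * (∫ α in torus F, ‖G r N α‖ ^ κ ∂(haar F) +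
          ∫ α in torus F, ‖approx r N x α‖ ^ κ ∂(haar F)) := by
        rw [integral_const_mul, integral_add hG.integrableOn hA.integrableOn]
    _ ≤ 2 ^ κ * (7 * (N + 1) ^ 3 * (Fintype.card F : ℝ) ^ ((N : ℝ) / r) +
          K * (((N : ℝ) + 1) ^ 3 * (Fintype.card F : ℝ) ^ ((N : ℝ) / r))) := by
        refine mul_le_mul_of_nonneg_left (add_le_add (integral_rpow_G_le hr N)
          ((hK N x hx).trans ?_)) h2
        gcongr
        exact le_self_pow₀ hN1 (by norm_num)
    _ = _ := by ring

/-- The uniform bound for the error, raised to the power `u = k - 1 - 1 / r`, is combined with the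
moment of the error of order `1 + 1 / r`. -/
theorem exists_integral_error_le {r : ℕ} (hr : 2 ≤ r) {k : ℝ} (hk : 1 + 1 / (r : ℝ) < k) :
    ∃ K : ℝ, 0 ≤ K ∧ ∀ N x : ℕ, 2 * r * x ≤ (r - 1) * N →
      ∫ α in torus F, ‖G r N α - approx r N x α‖ ^ k ∂(haar F) ≤
        K * (((N : ℝ) + 1) ^ 3 * (((Fintype.card F : ℝ) ^ (k - 1)) ^ N *
          (((Fintype.card F : ℝ) ^ (k - 1 - 1 / (r : ℝ))) ^ x)⁻¹)) := by
  obtain ⟨K, hK0, hK⟩ := exists_integral_error_critical_le (F := F) hr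
  have hr0 : (0 : ℝ) ≤ 1 / (r : ℝ) := by positivity
  have hq := two_le_card (F := F)
  set q : ℝ := (Fintype.card F : ℝ) with hqd
  have hq0 : 0 < q := by linarith
  refine ⟨14 ^ (k - 1 - 1 / (r : ℝ)) * K, by positivity, fun N x hx => ?_⟩
  have hxN : 2 * x ≤ N := two_mul_le_of_le hr hx
  have hE : ∀ p : ℝ, BallInvariant (N + 1) fun α : KInf F => ‖G r N α - approx r N x α‖ ^ p :=
    fun p α δ hδ => by
      dsimp only
      rw [ballInvariant_G r N α δ hδ, ballInvariant_approx hr (by omega : x ≤ N) α δ hδ]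
  calc ∫ α in torus F, ‖G r N α - approx r N x α‖ ^ k ∂(haar F)
      ≤ ∫ α in torus F, (14 * q ^ (N - x)) ^ (k - 1 - 1 / (r : ℝ)) *
          ‖G r N α - approx r N x α‖ ^ (1 + 1 / (r : ℝ)) ∂(haar F) := by
        refine setIntegral_mono_on (hE k).integrableOn ((hE _).integrableOn.const_mul _)
          (isOpen_torus F).measurableSet fun α _ => ?_
        have h1 := norm_G_sub_approx_le hr hx α
        have h2 : ‖G r N α - approx r N x α‖ ^ k =
            ‖G r N α - approx r N x α‖ ^ (k - 1 - 1 / (r : ℝ)) *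
              ‖G r N α - approx r N x α‖ ^ (1 + 1 / (r : ℝ)) := by
          rw [← Real.rpow_add' (norm_nonneg _) (by linarith)]
          congr 1
          ring
        rw [h2]
        exact mul_le_mul_of_nonneg_right (Real.rpow_le_rpow (norm_nonneg _) h1 (by linarith))
          (Real.rpow_nonneg (norm_nonneg _) _)
    _ ≤ (14 * q ^ (N - x)) ^ (k - 1 - 1 / (r : ℝ)) * (K * (((N : ℝ) + 1) ^ 3 *
          q ^ ((N : ℝ) / r))) := by
        rw [integral_const_mul]
        exact mul_le_mul_of_nonneg_left (hK N x hxN) (by positivity)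
    _ = _ := by
        have h3 : (q ^ (N - x)) ^ (k - 1 - 1 / (r : ℝ)) * q ^ ((N : ℝ) / r) =
            (q ^ (k - 1)) ^ N * ((q ^ (k - 1 - 1 / (r : ℝ))) ^ x)⁻¹ := by
          rw [← Real.rpow_natCast q (N - x), ← Real.rpow_mul hq0.le, ← Real.rpow_add hq0,
            ← Real.rpow_mul_natCast hq0.le, ← Real.rpow_mul_natCast hq0.le,
            ← Real.rpow_neg hq0.le, ← Real.rpow_add hq0, Nat.cast_sub (by omega)]
          congr 1
          ring
        rw [Real.mul_rpow (by norm_num) (by positivity), ← h3]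
        ring

end Moments

/-! ### The asymptotic formula -/

section Asymptotic

variable {F : Type*} [Field F] [Fintype F]

/-- Comparison of the moment of the exponential sum with that of its approximation. -/
theorem exists_abs_moment_sub_le {r : ℕ} (hr : 2 ≤ r) {k : ℝ} (hk : 1 + 1 / (r : ℝ) < k) :
    ∃ K : ℝ, 0 ≤ K ∧ ∀ N x : ℕ, 2 * r * x ≤ (r - 1) * N →
      |moment F r k N - leadingConstant F r k * ((Fintype.card F : ℝ) ^ (k - 1)) ^ N| ≤
        K * (((N : ℝ) + 1) ^ 3 * (((Fintype.card F : ℝ) ^ (k - 1)) ^ N *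
          (((Fintype.card F : ℝ) ^ (k - 1 - 1 / (r : ℝ))) ^ x)⁻¹) +
        (Fintype.card F : ℝ) ^ (N / r) * crossSum (Fintype.card F)
          ((Fintype.card F : ℝ) ^ (k - 1))
          ((Fintype.card F : ℝ) ^ (k - 1 - 1 / (r : ℝ))) r N x) := by
  have hr0 : (0 : ℝ) ≤ 1 / (r : ℝ) := by positivity
  have hk1 : 1 < k := by linarith
  obtain ⟨K₁, hK₁0, hK₁⟩ := exists_abs_integral_approx_sub_le (F := F) hr hk
  obtain ⟨K₂, hK₂0, hK₂⟩ := exists_integral_error_le (F := F) hr hk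
  have hcross := fun N x hx =>
    integral_norm_approx_rpow_mul_error_le (F := F) (r := r) (N := N) (x := x) hr hx hk1
  set q : ℝ := (Fintype.card F : ℝ) with hqd
  have hq : 2 ≤ q := two_le_card (F := F)
  set Q : ℝ := q ^ (k - 1) with hQd
  set U : ℝ := q ^ (k - 1 - 1 / (r : ℝ)) with hUd
  have hQ0 : 0 < Q := Real.rpow_pos_of_pos (by linarith) _
  have hU0 : 0 < U := Real.rpow_pos_of_pos (by linarith) _
  set L : ℝ := k * 2 ^ (k - 1) with hL
  have hL0 : 0 ≤ L := by positivity
  set W : ℝ := 4 ^ (k - 1) * 10 with hW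
  have hW0 : 0 ≤ W := by positivity
  refine ⟨K₁ + L * (K₂ + W), by positivity, fun N x hx => ?_⟩
  have hxN := two_mul_le_of_le hr hx
  set A := approx (F := F) r N x with hA
  have hG : BallInvariant (N + 1) (G (F := F) r N) := ballInvariant_G r N
  have hAi : BallInvariant (N + 1) A := ballInvariant_approx hr (by omega)
  have hGk : IntegrableOn (fun α => ‖G r N α‖ ^ k) (torus F) (haar F) :=
    (hG.comp fun z => ‖z‖ ^ k).integrableOn
  have hAk : IntegrableOn (fun α => ‖A α‖ ^ k) (torus F) (haar F) :=
    (hAi.comp fun z => ‖z‖ ^ k).integrableOn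
  have hX : IntegrableOn (fun α => ‖A α‖ ^ (k - 1) * ‖G r N α - A α‖) (torus F) (haar F) :=
    BallInvariant.integrableOn (L := N + 1) fun α δ hδ => by
      rw [hG α δ hδ, hAi α δ hδ]
  have hE : IntegrableOn (fun α => ‖G r N α - A α‖ ^ k) (torus F) (haar F) :=
    BallInvariant.integrableOn (L := N + 1) fun α δ hδ => by
      rw [hG α δ hδ, hAi α δ hδ]
  have hdiff : |moment F r k N - ∫ α in torus F, ‖A α‖ ^ k ∂(haar F)| ≤
      L * (∫ α in torus F, ‖A α‖ ^ (k - 1) * ‖G r N α - A α‖ ∂(haar F) +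
        ∫ α in torus F, ‖G r N α - A α‖ ^ k ∂(haar F)) := by
    rw [moment, ← integral_sub hGk hAk]
    refine abs_integral_le_integral_abs.trans ?_
    rw [← integral_add hX hE, ← integral_const_mul]
    exact integral_mono (hGk.sub hAk).abs ((hX.add hE).const_mul _)
      fun α => abs_norm_rpow_sub_le hk1 (G r N α) (A α)
  set Z : ℝ := Q ^ N * (U ^ x)⁻¹ with hZ
  have hZ0 : 0 ≤ Z := by positivity
  set T : ℝ := q ^ (N / r) * crossSum q Q U r N x with hT
  have hT0 : 0 ≤ T := mul_nonneg (by positivity)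
    (Finset.sum_nonneg fun _ _ => Finset.sum_nonneg fun _ _ => by positivity)
  have hP : 1 ≤ ((N : ℝ) + 1) ^ 3 := one_le_pow₀ (by linarith [Nat.cast_nonneg (α := ℝ) N])
  have h1 := hK₁ N x hxN
  have h2 := hK₂ N x hx
  have h3 : ∫ α in torus F, ‖A α‖ ^ (k - 1) * ‖G r N α - A α‖ ∂(haar F) ≤ W * T :=
    (hcross N x hxN).trans_eq (by rw [hW, hT]; ring)
  have h4 : Z ≤ ((N : ℝ) + 1) ^ 3 * Z := le_mul_of_one_le_left hZ0 hP
  set P : ℝ := ((N : ℝ) + 1) ^ 3 * Z with hPd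
  have hP0 : 0 ≤ P := by positivity
  calc _ ≤ |moment F r k N - ∫ α in torus F, ‖A α‖ ^ k ∂(haar F)| +
        |∫ α in torus F, ‖A α‖ ^ k ∂(haar F) - leadingConstant F r k * Q ^ N| :=
        abs_sub_le _ _ _
    _ ≤ L * (W * T + K₂ * P) + K₁ * P := by
        refine add_le_add (hdiff.trans (mul_le_mul_of_nonneg_left (add_le_add h3 h2) hL0)) ?_
        exact h1.trans (mul_le_mul_of_nonneg_left h4 hK₁0)
    _ ≤ _ := by
        have e1 : 0 ≤ K₁ * T := mul_nonneg hK₁0 hT0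
        have e2 : 0 ≤ L * (K₂ * T) := mul_nonneg hL0 (mul_nonneg hK₂0 hT0)
        have e3 : 0 ≤ L * (W * P) := mul_nonneg hL0 (mul_nonneg hW0 hP0)
        nlinarith [e1, e2, e3]

/-- The saving for the largest admissible width `x` of the major arcs. -/
theorem pow_mul_inv_pow_le {q k : ℝ} (hq : 1 ≤ q) {r : ℕ} (hr : 2 ≤ r)
    (hk : 1 + 1 / (r : ℝ) < k) (N : ℕ) :
    (q ^ (k - 1)) ^ N * ((q ^ (k - 1 - 1 / (r : ℝ))) ^ ((r - 1) * N / (2 * r)))⁻¹ ≤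
      q ^ (k - 1 - 1 / (r : ℝ)) *
        q ^ ((N : ℝ) * (k - 1 - (1 - 1 / (r : ℝ)) * (k - 1 - 1 / (r : ℝ)) / 2)) := by
  have hq0 : 0 < q := by linarith
  have hr0 : (0 : ℝ) < r := by exact_mod_cast (by omega : 0 < r)
  set x : ℕ := (r - 1) * N / (2 * r) with hx
  have h1 : (1 - 1 / (r : ℝ)) * N ≤ 2 * (x + 1) := by
    have h := Nat.lt_mul_div_succ ((r - 1) * N) (show 0 < 2 * r by omega)
    rw [← hx] at h
    have h' : (((r - 1) * N : ℕ) : ℝ) ≤ ((2 * r * (x + 1) : ℕ) : ℝ) := by exact_mod_cast h.le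
    push_cast [Nat.cast_sub (show 1 ≤ r by omega)] at h'
    have h2 : (1 - 1 / (r : ℝ)) * N = ((r : ℝ) - 1) * N / r := by field_simp
    rw [h2, div_le_iff₀ hr0]
    linarith
  rw [← Real.rpow_mul_natCast hq0.le, ← Real.rpow_mul_natCast hq0.le, ← Real.rpow_neg hq0.le,
    ← Real.rpow_add hq0, ← Real.rpow_add hq0]
  refine Real.rpow_le_rpow_of_exponent_le hq ?_
  nlinarith [mul_nonneg (show 0 ≤ k - 1 - 1 / (r : ℝ) by linarith) (sub_nonneg.2 h1)]

theorem exists_abs_moment_sub_le_theta {r : ℕ} (hr : 2 ≤ r) {k : ℝ} (hk : 1 + 1 / (r : ℝ) < k)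
    {ε : ℝ} (hε : 0 < ε) : ∃ K : ℝ, ∀ N : ℕ,
      |moment F r k N - leadingConstant F r k * (Fintype.card F : ℝ) ^ ((N : ℝ) * (k - 1))| ≤
        K * (Fintype.card F : ℝ) ^ ((N : ℝ) * (k - 1 - theta r k ε)) := by
  obtain ⟨K, hK0, hK⟩ := exists_abs_moment_sub_le (F := F) hr hk
  set q : ℝ := (Fintype.card F : ℝ) with hqd
  have hq : 2 ≤ q := two_le_card (F := F)
  have hq0 : 0 < q := by linarith
  have hr' : 1 / (r : ℝ) ≤ 1 / 2 :=
    one_div_le_one_div_of_le (by norm_num) (by exact_mod_cast hr)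
  set σ : ℝ := (1 - 1 / (r : ℝ)) * (k - 1 - 1 / (r : ℝ)) / 2 with hσ
  set V : ℝ := q ^ (k - 1 - 1 / (r : ℝ)) with hV
  have hV0 : 0 < V := Real.rpow_pos_of_pos hq0 _
  have hx : ∀ N : ℕ, 2 * r * ((r - 1) * N / (2 * r)) ≤ (r - 1) * N :=
    fun N => Nat.mul_div_le _ _
  have hNq : ∀ N : ℕ, q ^ ((N : ℝ) * (k - 1)) = (q ^ (k - 1)) ^ N := fun N => by
    rw [← Real.rpow_mul_natCast hq0.le, mul_comm]
  -- a power saving of `σ` is as good as one of `σ - δ` without the polynomial factor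
  have hpoly : ∀ δ : ℝ, 0 < δ → ∃ K' : ℝ, 0 ≤ K' ∧ ∀ N : ℕ, ((N : ℝ) + 1) ^ 3 *
      ((q ^ (k - 1)) ^ N * (V ^ ((r - 1) * N / (2 * r)))⁻¹) ≤
        K' * q ^ ((N : ℝ) * (k - 1 - (σ - δ))) := fun δ hδ => by
    obtain ⟨P, hP0, hP⟩ := exists_pow_three_le_rpow (q := q) (by linarith) hδ
    refine ⟨P * V, by positivity, fun N => ?_⟩
    have h1 := mul_le_mul (hP N) (pow_mul_inv_pow_le (q := q) (by linarith) hr hk N)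
      (by positivity) (by positivity)
    refine h1.trans_eq ?_
    rw [mul_mul_mul_comm, ← Real.rpow_add hq0]
    congr 2
    ring
  simp only [hNq]
  by_cases hk3 : 3 + 1 / (r : ℝ) < k
  · have hθ : theta r k ε = 1 - 1 / (r : ℝ) := by rw [theta, if_pos hk3]
    have hδ : 0 < σ - (1 - 1 / (r : ℝ)) := by
      have h1 : 0 < (1 - 1 / (r : ℝ)) * (k - 3 - 1 / (r : ℝ)) :=
        mul_pos (by linarith) (by linarith)
      rw [hσ]
      linarith
    obtain ⟨P, hP0, hP⟩ := hpoly _ hδ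
    obtain ⟨M, hM0, hM⟩ := exists_crossSum_le (q := q) (by linarith) hr hk3
    refine ⟨K * (P + M), fun N => (hK N _ (hx N)).trans ?_⟩
    rw [mul_assoc, add_mul, hθ]
    refine mul_le_mul_of_nonneg_left (add_le_add ?_ (hM N _)) hK0
    have := hP N
    rwa [sub_sub_cancel] at this
  · have hθ := theta_le (ε := ε) hr hk (not_lt.1 hk3)
    obtain ⟨P, hP0, hP⟩ := hpoly ε hε
    refine ⟨K * (2 * P), fun N => (hK N _ (hx N)).trans ?_⟩
    have h1 := crossSum_le (q := q) (by linarith) hr (hx N) (not_lt.1 hk3)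
    have h2 : q ^ ((N : ℝ) * (k - 1 - (σ - ε))) ≤ q ^ ((N : ℝ) * (k - 1 - theta r k ε)) := by
      refine Real.rpow_le_rpow_of_exponent_le (by linarith) ?_
      exact mul_le_mul_of_nonneg_left (by linarith) (Nat.cast_nonneg N)
    have h3 := hP N
    have h4 := mul_le_mul_of_nonneg_left h2 hP0
    rw [mul_assoc]
    refine mul_le_mul_of_nonneg_left ?_ hK0
    linarith

end Asymptotic

end

end RFreeMoments

theorem theorem2 (F : Type*) [Field F] [Fintype F] (r : ℕ) (hr : 2 ≤ r) (k : ℝ)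
    (hk : 1 + 1 / (r : ℝ) < k) :
    Summable (fun f : {f : F[X] // f.Monic} => RFreeMoments.polyAbs f.1 ^ (-(r : ℝ))) ∧
    Summable (fun f : {f : F[X] // f.Monic} => RFreeMoments.singularTerm r k f.1) ∧
    0 < RFreeMoments.theta r k 0 ∧
    ∀ ε : ℝ, 0 < ε → ∃ K : ℝ, ∀ N : ℕ,
      |RFreeMoments.moment F r k N -
          RFreeMoments.leadingConstant F r k * (Fintype.card F : ℝ) ^ ((N : ℝ) * (k - 1))| ≤
        K * (Fintype.card F : ℝ) ^ ((N : ℝ) * (k - 1 - RFreeMoments.theta r k ε)) :=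
  ⟨(RFreeMoments.summable_wt hr).congr fun f => (RFreeMoments.polyAbs_rpow_neg r f.2).symm,
    RFreeMoments.summable_singularTerm hr hk, RFreeMoments.theta_zero_pos hr hk,
    fun _ hε => RFreeMoments.exists_abs_moment_sub_le_theta hr hk hε⟩
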